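/- Notation. Let $dV_k$ be Lebesgue measure on $\mathbb C^k$ divided by $\pi^k$, let $\mathbb L=\{z\in\mathbb C:\operatorname{Re}z<0\}$, and put $$G(z,w)=e^{z\bar w-|z|^2/2-|w|^2/2},\quad \gamma(z)=\tfrac1{\sqrt{2\pi}}e^{-z^2/2},\quad F(z)=\int_{-\infty}^0\gamma(z-t)\,dt=\tfrac12\operatorname{erfc}\!\big(\tfrac z{\sqrt2}\big),\quad H(z)=\int_{-\infty}^0\frac{\gamma(z-t)}{F(t)}\,dt .$$ Hard edge Ginibre ensemble. Let $Q(\zeta)=|\zeta|^2$ for $|\zeta|\le1$ and $Q(\zeta)=+\infty$ otherwise. For $n\ge1$ let $(\zeta_j)_1^n$ be distributed on $\mathbb C^n$ according to $$d\mathbf P_n=\frac1{Z_n}e^{-H_n}\,dV_n,\qquad H_n(\zeta)=\sum_{j\ne k}\log\frac1{|\zeta_j-\zeta_k|}+n\sum_{j=1}^nQ(\zeta_j),\qquad Z_n=\int e^{-H_n}\,dV_n .$$ Its $k$-point intensity is, at pairwise distinct points, $$\mathbf R_{n,k}(\eta_1,\dots,\eta_k)=\lim_{\varepsilon\downarrow0}\varepsilon^{-2k}\,\mathbf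 P_n\Big(\bigcap_{j=1}^k\{\text{some }\zeta_i\text{ lies in }D(\eta_j;\varepsilon)\}\Big),$$ and $\mathbf R_{n,k}=0$ when two of the points coincide. Rescaling about $1$ by $z_j=\sqrt n\,(\zeta_j-1)$ gives the process $\Theta_n=\{z_j\}_1^n$ with intensities $R_{n,k}(z_1,\dots,z_k)=n^{-k}\,\mathbf R_{n,k}(1+z_1/\sqrt n,\dots,1+z_k/\sqrt n)$. Point fields. A point field is a probability measure on the space of locally finite configurations of points in $\mathbb C$ (repetitions allowed), with the $\sigma$-algebra generated by the counts $N_B$ of points in Borel sets $B$. It has correlation kernel $K$ if, for every $k\ge1$, the function $R_k(z_1,\dots,z_k)=\det(K(z_i,z_j))_{i,j=1}^k$ is a $k$-point intensity function, that is: $R_k$ is nonnegative and locally integrable, and $$\mathbb E\prod_{j=1}^m\frac{N_{B_j}!}{(N_{B_j}-k_j)!}=\int_{B_1^{k_1}\times\cdots\times B_m^{k_m}}R_k\,dV_k$$ for all pairwise disjoint bounded Borel sets $B_1,\dots,B_m$ and all $k_1+\cdots+k_m=k$ (in any order of the coordinates). Theorem. There exists a unique point field $BG_h$ in $\mathbb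 C$ with correlation kernel $$K(z,w)=G(z,w)\,H(z+\bar w)\,\mathbf 1_{\mathbb L}(z)\,\mathbf 1_{\mathbb L}(w).$$ The processes $\Theta_n$ converge to $BG_h$ in the following sense. For every $k\ge1$, as $n\to\infty$, $R_{n,k}\to R_k=\det(K(z_i,z_j))_{i,j=1}^k$ almost everywhere on $\mathbb C^k$; this convergence is locally bounded, i.e. for every compact $C\subset\mathbb C^k$ there is a constant $M$ with $|R_{n,k}|\le M$ almost everywhere on $C$ for all $n\ge1$; and $R_{n,k}\to R_k$ locally uniformly on $\mathbb L^k$. -/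

import Mathlib

open MeasureTheory Filter Topology

noncomputable section

namespace HardEdgeGinibre

/-! ### Reference measures -/

/-- The volume measure `dV_k` on `ℂ^k`: Lebesgue measure divided by `π ^ k`
(for `k = 1` the unit disc has mass one). -/
def vol (k : ℕ) : Measure (Fin k → ℂ) :=
  (ENNReal.ofReal Real.pi⁻¹) ^ k • volume

/-! ### The hard edge Ginibre ensemble -/

/-- The hard edge Ginibre potential: `|ζ|²` on the closed unit disc and `+∞` outside of it. -/
def potential (ζ : ℂ) : EReal :=
  if ‖ζ‖ ≤ 1 then ((‖ζ‖ ^ 2 : ℝ) : EReal) else ⊤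

/-- The Hamiltonian `∑_{j ≠ k} log (1 / |ζ_j - ζ_k|) + n ∑_j Q(ζ_j)`. It equals `+∞` if two points
coincide or if some point is outside of the closed unit disc. -/
def hamiltonian (n : ℕ) (ζ : Fin n → ℂ) : EReal :=
  (∑ p ∈ (Finset.univ : Finset (Fin n)).offDiag, -ENNReal.log ‖ζ p.1 - ζ p.2‖ₑ)
    + (n : EReal) * ∑ j, potential (ζ j)

/-- The Boltzmann weight `exp (-H_n)`. -/
def boltzmannWeight (n : ℕ) (ζ : Fin n → ℂ) : ENNReal :=
  EReal.exp (-hamiltonian n ζ)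

/-- The partition function `Z_n`. -/
def partitionFunction (n : ℕ) : ENNReal :=
  ∫⁻ ζ, boltzmannWeight n ζ ∂(vol n)

/-- The Boltzmann-Gibbs law `dP_n = (1 / Z_n) exp (-H_n) dV_n` on `ℂ^n`. -/
def gibbs (n : ℕ) : Measure (Fin n → ℂ) :=
  (partitionFunction n)⁻¹ • (vol n).withDensity (boltzmannWeight n)

/-- The number `N_B` of particles of the `n`-point system `ζ` that lie in `B`. -/
def particleCount {n : ℕ} (ζ : Fin n → ℂ) (B : Set ℂ) : ℕ :=
  {i : Fin n | ζ i ∈ B}.ncard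

open Classical in
/-- The joint `k`-point intensity of the `n`-point system: at pairwise distinct points it is
`lim_{ε ↓ 0} P_n (N_{D(η_j; ε)} ≥ 1 for all j) / ε ^ (2 k)`,
and it is zero if two of the points coincide. -/
def jointIntensity (n k : ℕ) (η : Fin k → ℂ) : ℝ :=
  if Function.Injective η then
    limUnder (𝓝[>] (0 : ℝ)) fun ε : ℝ =>
      (gibbs n).real {ζ | ∀ j, 1 ≤ particleCount ζ (Metric.ball (η j) ε)} / ε ^ (2 * k)
  else 0

/-- The joint intensity of the process rescaled about the boundary point `1`
by `z_j = √n (ζ_j - 1)`. -/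
def rescaledIntensity (n k : ℕ) (z : Fin k → ℂ) : ℝ :=
  (1 / (n : ℝ) ^ k) * jointIntensity n k fun j => 1 + z j / (Real.sqrt n : ℂ)

/-! ### Random point fields -/

/-- A locally finite configuration of points in `ℂ`, repetitions being allowed; it is recorded by
the multiplicity of each point. -/
structure Configuration where
  mult : ℂ → ℕ
  locallyFinite : ∀ C : Set ℂ, IsCompact C → {z ∈ C | mult z ≠ 0}.Finite

/-- The number `N_B` of points of the configuration `X` in `B`, counted with multiplicity: a point
`z` of multiplicity `m` is represented by the pairs `(z, 0), …, (z, m - 1)`. -/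
def Configuration.count (X : Configuration) (B : Set ℂ) : ℕ∞ :=
  {p : ℂ × ℕ | p.1 ∈ B ∧ p.2 < X.mult p.1}.encard

/-- The `σ`-algebra on configurations generated by the cylinder sets `{N_B = n}`, `B` Borel. -/
instance : MeasurableSpace Configuration :=
  MeasurableSpace.generateFrom
    {C | ∃ (B : Set ℂ) (n : ℕ), MeasurableSet B ∧ C = {X : Configuration | X.count B = n}}

/-- `ρ` is a `k`-point intensity function of the random point field `P`: it is nonnegative and
locally integrable, and for pairwise disjoint bounded Borel sets `B_1, …, B_m`,
`E ∏_j N_{B_j}! / (N_{B_j} - k_j)!` is the `dV_k`-integral of `ρ` over the product of the sets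
`B_j`, each taken `k_j` times, where `k_1 + ⋯ + k_m = k`. The map `σ` tells to which of the sets
`B_j` each of the `k` coordinates belongs, so that `k_j` is the size of the fibre over `j`. -/
def IsIntensityFunction (P : ProbabilityMeasure Configuration) (k : ℕ)
    (ρ : (Fin k → ℂ) → ℝ) : Prop :=
  (∀ z, 0 ≤ ρ z) ∧ LocallyIntegrable ρ (vol k) ∧
    ∀ (m : ℕ) (B : Fin m → Set ℂ) (σ : Fin k → Fin m),
      (∀ j, MeasurableSet (B j)) → (∀ j, Bornology.IsBounded (B j)) →
      Pairwise (fun i j => Disjoint (B i) (B j)) →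
      ∫⁻ X, ((∏ j, (X.count (B j)).toNat.descFactorial
            (Finset.univ.filter fun i => σ i = j).card : ℕ) : ENNReal)
          ∂(P : Measure Configuration)
        = ∫⁻ z in {z | ∀ i, z i ∈ B (σ i)}, ENNReal.ofReal (ρ z) ∂(vol k)

/-- The function `(z_1, …, z_k) ↦ det (K(z_i, z_j))`. -/
def kernelDet (K : ℂ → ℂ → ℂ) (k : ℕ) (z : Fin k → ℂ) : ℂ :=
  (Matrix.of fun i j => K (z i) (z j)).det

/-- `K` is a correlation kernel of `P`: for each `k ≥ 1` the function `det (K(z_i, z_j))` is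
(real-valued and) a `k`-point intensity function of `P`. -/
def IsCorrelationKernel (P : ProbabilityMeasure Configuration) (K : ℂ → ℂ → ℂ) : Prop :=
  ∀ k : ℕ, 1 ≤ k → ∃ ρ : (Fin k → ℂ) → ℝ,
    (∀ z, (ρ z : ℂ) = kernelDet K k z) ∧ IsIntensityFunction P k ρ

/-! ### The hard edge plasma kernel -/

/-- The Gaussian kernel `γ(z) = (2π)^{-1/2} exp (-z² / 2)`. -/
def gaussian (z : ℂ) : ℂ :=
  1 / (Real.sqrt (2 * Real.pi) : ℂ) * Complex.exp (-z ^ 2 / 2)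

/-- The convolution `γ * g`, as a function on `ℂ`, for a bounded function `g` on `ℝ`. -/
def gaussianConv (g : ℝ → ℂ) (z : ℂ) : ℂ :=
  ∫ t : ℝ, gaussian (z - t) * g t

/-- The free boundary plasma function `F(z) = (1/2) erfc (z / √2) = γ * 1_{(-∞, 0)}`. -/
def freePlasma : ℂ → ℂ :=
  gaussianConv ((Set.Iio (0 : ℝ)).indicator fun _ => 1)

/-- The hard edge plasma function `H = γ * (1_{(-∞, 0)} / F)`. -/
def hardPlasma : ℂ → ℂ :=
  gaussianConv ((Set.Iio (0 : ℝ)).indicator fun t => 1 / freePlasma (t : ℂ))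

/-- The Ginibre kernel. -/
def ginibreKernel (z w : ℂ) : ℂ :=
  Complex.exp (z * (starRingEnd ℂ) w - (‖z‖ : ℂ) ^ 2 / 2 - (‖w‖ : ℂ) ^ 2 / 2)

/-- The open left half plane. -/
def leftHalfPlane : Set ℂ := {z | z.re < 0}

/-- The hard edge plasma kernel. -/
def hardKernel (z w : ℂ) : ℂ :=
  ginibreKernel z w * hardPlasma (z + (starRingEnd ℂ) w)
    * leftHalfPlane.indicator (fun _ => 1) z * leftHalfPlane.indicator (fun _ => 1) w

end HardEdgeGinibre

end

open HardEdgeGinibre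

/-! Finite n. The weight exp(-H_n) is the squared modulus of a Vandermonde determinant times radial
factors, so the ensemble has density `pdet` / n! for the projection kernel of the weighted monomials
`orthoPoly n`. Gaudin's lemma integrates points out one at a time, and therefore the factorial
moments of the counts are integrals of k-point determinants (`lintegral_gibbs_descProd`). The
probability that k small disjoint discs are all occupied differs from such an integral by a
negligible (k+1)-point term. Off the unit circle the intensity is thus the determinant itself
(`jointIntensity_eq_pdet`).

Convergence. After zooming in at 1 and a change of phase that leaves determinants alone, the kernel
is a sum over degrees j living on the scale n - j ≈ τ√n. Each term converges: a second order
expansion of the logarithm treats (1 + a/√n + b/n)^j, and the rescaled norms of the monomials tend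
to a Gaussian tail integral, the source of F(-τ). A lower bound for those norms
(`pow_mul_exp_le_monomialNorm`) gives Gaussian decay in τ uniformly in n, hence dominated
convergence; the limiting integral over τ is the convolution that defines H. The arguments may move
along a filter, so one statement yields pointwise and locally uniform convergence and the continuity
of the limit. Uniform bounds on the diagonal and det ≤ C^k (`IsPosKernel.pdet_le_pow`) give local
boundedness.

Existence. As a limit, the hard edge kernel is positive semidefinite, and its diagonal is at most 2
because F ≥ 1/2 on the negative axis. In a disc, an alternating series in the determinants defines
Janossy densities; if they are nonnegative they define a finite point process with the right
intensities (`lintegral_listLaw_descProd`). For projection kernels of finite rank nonnegativity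
follows by downward induction on the number of points (`IsOrthonormalFamily.janossy_nonneg`), and it
survives the limit (`tendsto_janossy`). The processes in growing discs are consistent by the
uniqueness theorem, and a Markov chain built from conditional laws (`exists_coupling`) glues them
into one field.

Uniqueness. Factorial moments that grow at most geometrically determine the joint law of the counts
by an absolutely convergent inversion formula (`hasSum_measureReal_singleton`). Counts of bounded
sets generate the σ-algebra (`ext_of_isIntensityFunction`). -/

open scoped ComplexOrder ENNReal

set_option linter.unusedSectionVars false

namespace HardEdgeGinibre

/-! ### Determinants of positive semidefinite kernels -/

/-- The matrix `(K (z i) (z j))`. -/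
def kernelMatrix (K : ℂ → ℂ → ℂ) {ι : Type} (z : ι → ℂ) : Matrix ι ι ℂ :=
  Matrix.of fun i j => K (z i) (z j)

/-- The real part of `det (K (z i) (z j))`. -/
noncomputable def pdet (K : ℂ → ℂ → ℂ) {ι : Type} [Fintype ι] [DecidableEq ι] (z : ι → ℂ) : ℝ :=
  (kernelMatrix K z).det.re

/-- All matrices `(K (z i) (z j))` are positive semidefinite. -/
def IsPosKernel (K : ℂ → ℂ → ℂ) : Prop :=
  ∀ (ι : Type) [Fintype ι] (z : ι → ℂ), (kernelMatrix K z).PosSemidef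

section

variable {K : ℂ → ℂ → ℂ} {ι κ : Type} [Fintype ι] [DecidableEq ι] [Fintype κ] [DecidableEq κ]

lemma IsPosKernel.pdet_nonneg (hK : IsPosKernel K) (z : ι → ℂ) : 0 ≤ pdet K z :=
  (Complex.le_def.1 (hK _ z).det_nonneg).1

lemma IsPosKernel.ofReal_pdet (hK : IsPosKernel K) (z : ι → ℂ) :
    (pdet K z : ℂ) = (kernelMatrix K z).det :=
  Complex.ext rfl (by simpa using (Complex.le_def.1 (hK _ z).det_nonneg).2)

lemma pdet_comp_equiv (K : ℂ → ℂ → ℂ) (e : ι ≃ κ) (z : κ → ℂ) :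
    pdet K (z ∘ e) = pdet K z := by
  have : kernelMatrix K (z ∘ e) = (kernelMatrix K z).submatrix e e := rfl
  rw [pdet, this, Matrix.det_submatrix_equiv_self, pdet]

lemma pdet_of_isEmpty [IsEmpty ι] (K : ℂ → ℂ → ℂ) (z : ι → ℂ) : pdet K z = 1 := by
  simp [pdet]

/-- The determinant is the product of the nonnegative eigenvalues, hence at most (trace / card)^card
by the arithmetic-geometric mean inequality. A bound on the diagonal of K alone therefore controls
all determinants geometrically in the number of points. -/
lemma IsPosKernel.pdet_le_pow (hK : IsPosKernel K) (z : ι → ℂ) {C : ℝ}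
    (hC : ∀ i, ‖K (z i) (z i)‖ ≤ C) : pdet K z ≤ C ^ Fintype.card ι := by
  rcases isEmpty_or_nonempty ι with h | h
  · simp [pdet_of_isEmpty]
  have hM := hK _ z
  set M := kernelMatrix K z
  have hn : (0 : ℝ) < Fintype.card ι := by exact_mod_cast Fintype.card_pos
  have hdet : pdet K z = ∏ i, hM.1.eigenvalues i := by
    have := hM.1.det_eq_prod_eigenvalues
    rw [pdet, this, ← RCLike.ofReal_prod]
    rfl
  have htr : ∑ i, hM.1.eigenvalues i = (M.trace).re := by
    have := hM.1.trace_eq_sum_eigenvalues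
    rw [this, ← RCLike.ofReal_sum]
    rfl
  have hnn := hM.eigenvalues_nonneg
  have key := Real.geom_mean_le_arith_mean Finset.univ (fun _ : ι => (1 : ℝ))
    (fun i => hM.1.eigenvalues i) (by simp) (by simpa using hn) (fun i _ => hnn i)
  simp only [Real.rpow_one, one_mul, Finset.sum_const, Finset.card_univ, nsmul_eq_mul,
    mul_one] at key
  have htrle : (M.trace).re ≤ Fintype.card ι * C := by
    rw [Matrix.trace, Complex.re_sum]
    calc ∑ i, (M.diag i).re ≤ ∑ i : ι, C :=
          Finset.sum_le_sum fun i _ => (Complex.re_le_norm _).trans (hC i)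
      _ = _ := by simp
  have hprod : 0 ≤ ∏ i, hM.1.eigenvalues i := Finset.prod_nonneg fun i _ => hnn i
  have h1 : (∏ i, hM.1.eigenvalues i) ^ ((Fintype.card ι : ℝ))⁻¹ ≤ C := by
    refine key.trans ?_
    rw [htr, div_le_iff₀ hn, mul_comm]
    exact htrle
  rw [hdet]
  calc ∏ i, hM.1.eigenvalues i
      = ((∏ i, hM.1.eigenvalues i) ^ ((Fintype.card ι : ℝ))⁻¹) ^ Fintype.card ι := by
        rw [← Real.rpow_natCast, ← Real.rpow_mul hprod, inv_mul_cancel₀ hn.ne', Real.rpow_one]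
    _ ≤ C ^ Fintype.card ι := pow_le_pow_left₀ (Real.rpow_nonneg hprod _) h1 _

lemma measurable_kernelMatrix_det (hK : Measurable (Function.uncurry K)) :
    Measurable fun z : ι → ℂ => (kernelMatrix K z).det := by
  simp only [Matrix.det_apply, kernelMatrix, Matrix.of_apply]
  refine Finset.measurable_sum _ fun σ _ => ?_
  refine Measurable.const_smul (Finset.measurable_prod _ fun i _ => ?_) _
  exact hK.comp (f := fun z : ι → ℂ => (z (σ i), z i))
    ((measurable_pi_apply _).prodMk (measurable_pi_apply _))

lemma measurable_pdet (hK : Measurable (Function.uncurry K)) :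
    Measurable fun z : ι → ℂ => pdet K z :=
  Complex.measurable_re.comp (measurable_kernelMatrix_det hK)

/-- A row of zeros. -/
lemma pdet_eq_zero_of_row (z : ι → ℂ) (i : ι) (h : ∀ w, K (z i) w = 0) : pdet K z = 0 := by
  rw [pdet, Matrix.det_eq_zero_of_row_eq_zero i (fun j => h _), Complex.zero_re]

lemma pdet_eq_zero_of_eq (z : ι → ℂ) {i j : ι} (hij : i ≠ j) (h : z i = z j) : pdet K z = 0 := by
  rw [pdet, Matrix.det_zero_of_row_eq hij, Complex.zero_re]
  ext k
  simp [kernelMatrix, h]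

end

/-- Expansion of the determinant of a bordered positive semidefinite matrix. -/
lemma det_fromBlocks_bordered {ι : Type} [Fintype ι] [DecidableEq ι] {M : Matrix ι ι ℂ}
    (hM : M.PosSemidef) (u v : ι → ℂ) (d : ℂ) :
    (Matrix.fromBlocks M (Matrix.replicateCol Unit u) (Matrix.replicateRow Unit v)
      (Matrix.of fun _ _ => d)).det = d * M.det - v ⬝ᵥ (M.adjugate.mulVec u) := by
  -- M may be singular, so the Schur complement is taken for the positive definite M + t·1 with t >
  -- 0. Written with the adjugate, both sides are continuous in t, and t → 0. They appear as applied
  -- functions to let `hcont` unify.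
  have hinv : ∀ t : ℝ, 0 < t → (fun t : ℝ => (Matrix.fromBlocks (M + (t : ℂ) • 1)
      (Matrix.replicateCol Unit u) (Matrix.replicateRow Unit v)
      (Matrix.of fun _ _ => d)).det) t = (fun t : ℝ => d * (M + (t : ℂ) • 1).det
        - v ⬝ᵥ ((M + (t : ℂ) • 1).adjugate.mulVec u)) t := by
    intro t ht
    have hpd : (M + (t : ℂ) • (1 : Matrix ι ι ℂ)).PosDef := by
      refine Matrix.PosDef.posSemidef_add hM ?_
      exact Matrix.PosDef.one.smul (by exact_mod_cast ht)
    set A := M + (t : ℂ) • (1 : Matrix ι ι ℂ)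
    have hu : IsUnit A := hpd.isUnit
    have := hu.invertible
    have hdet : A.det ≠ 0 := hpd.det_pos.ne'
    simp only
    rw [Matrix.det_fromBlocks₁₁, Matrix.det_unique (n := Unit)]
    have hi : ⅟A = A.det⁻¹ • A.adjugate := by
      rw [Matrix.invOf_eq_nonsing_inv, Matrix.inv_def, Ring.inverse_eq_inv']
    rw [hi]
    simp only [Matrix.sub_apply, Matrix.of_apply, Matrix.mul_smul, Matrix.smul_mul,
      Matrix.smul_apply, smul_eq_mul]
    rw [mul_sub, ← mul_assoc, mul_inv_cancel₀ hdet, one_mul, mul_comm, Matrix.mul_assoc]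
    congr 1
  have hcont : ∀ f g : ℝ → ℂ, Continuous f → Continuous g → (∀ t, 0 < t → f t = g t) →
      f 0 = g 0 := by
    intro f g hf hg h
    have h1 : Tendsto f (𝓝[>] 0) (𝓝 (f 0)) := hf.continuousWithinAt
    have h2 : Tendsto g (𝓝[>] 0) (𝓝 (g 0)) := hg.continuousWithinAt
    refine tendsto_nhds_unique (h1.congr' ?_) h2
    filter_upwards [self_mem_nhdsWithin] with t ht using h t ht
  have := hcont _ _ ?_ ?_ hinv
  · simpa using this
  · refine Continuous.matrix_det ?_
    refine Continuous.matrix_fromBlocks ?_ continuous_const continuous_const continuous_const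
    exact continuous_const.add (Complex.continuous_ofReal.smul continuous_const)
  · have hA : Continuous fun t : ℝ => M + (t : ℂ) • (1 : Matrix ι ι ℂ) :=
      continuous_const.add (Complex.continuous_ofReal.smul continuous_const)
    refine (continuous_const.mul hA.matrix_det).sub ?_
    exact Continuous.dotProduct continuous_const (hA.matrix_adjugate.matrix_mulVec continuous_const)


/-! ### Kernels of finite rank -/

/-- The kernel `∑ j, φ j z * conj (φ j w)`. -/
noncomputable def finKernel {n : ℕ} (φ : Fin n → ℂ → ℂ) (z w : ℂ) : ℂ :=
  ∑ j, φ j z * (starRingEnd ℂ) (φ j w)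

/-- A finite orthonormal family in `L²(μ)`. -/
structure IsOrthonormalFamily {n : ℕ} (φ : Fin n → ℂ → ℂ) (μ : Measure ℂ) : Prop where
  measurable : ∀ j, Measurable (φ j)
  integrable : ∀ j l, Integrable (fun x => φ j x * (starRingEnd ℂ) (φ l x)) μ
  integral_eq : ∀ j l, ∫ x, φ j x * (starRingEnd ℂ) (φ l x) ∂μ = if j = l then 1 else 0

section

variable {n : ℕ} {φ : Fin n → ℂ → ℂ} {μ : Measure ℂ} {ι : Type} [Fintype ι] [DecidableEq ι]

lemma kernelMatrix_finKernel {ι : Type} (φ : Fin n → ℂ → ℂ) (z : ι → ℂ) :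
    kernelMatrix (finKernel φ) z =
      (Matrix.of fun i j => φ j (z i)) * (Matrix.of fun i j => φ j (z i)).conjTranspose := by
  ext i j
  simp [kernelMatrix, finKernel, Matrix.mul_apply]

lemma isPosKernel_finKernel (φ : Fin n → ℂ → ℂ) : IsPosKernel (finKernel φ) := by
  intro ι _ z
  rw [kernelMatrix_finKernel]
  exact Matrix.posSemidef_self_mul_conjTranspose _

/-- The matrix factors through ℂ^n, so its rank is at most n: a projection process of rank n never
has more than n points. -/
lemma pdet_finKernel_of_lt (φ : Fin n → ℂ → ℂ) (z : ι → ℂ) (h : n < Fintype.card ι) :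
    pdet (finKernel φ) z = 0 := by
  by_contra hne
  have hdet : (kernelMatrix (finKernel φ) z).det ≠ 0 := by
    intro h0
    exact hne (by rw [pdet, h0, Complex.zero_re])
  have hu : IsUnit (kernelMatrix (finKernel φ) z) :=
    (Matrix.isUnit_iff_isUnit_det _).2 (isUnit_iff_ne_zero.2 hdet)
  have h1 := Matrix.rank_of_isUnit _ hu
  rw [kernelMatrix_finKernel] at h1
  have h2 := (Matrix.rank_mul_le_left (Matrix.of fun i j => φ j (z i))
    (Matrix.of fun i j => φ j (z i)).conjTranspose).trans (Matrix.rank_le_card_width _)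
  rw [Fintype.card_fin] at h2
  omega

lemma pdet_finKernel_fin (φ : Fin n → ℂ → ℂ) (z : Fin n → ℂ) :
    pdet (finKernel φ) z = ‖(Matrix.of fun i j => φ j (z i)).det‖ ^ 2 := by
  rw [pdet, kernelMatrix_finKernel, Matrix.det_mul, Matrix.det_conjTranspose]
  set d := (Matrix.of fun i j => φ j (z i)).det
  have : d * star d = ((‖d‖ ^ 2 : ℝ) : ℂ) := by
    rw [Complex.star_def, Complex.mul_conj, Complex.normSq_eq_norm_sq]
  rw [this, Complex.ofReal_re]

lemma measurable_finKernel (hφ : ∀ j, Measurable (φ j)) :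
    Measurable (Function.uncurry (finKernel φ)) := by
  simp only [Function.uncurry_def, finKernel]
  refine Finset.measurable_sum _ fun j _ => ?_
  exact ((hφ j).comp measurable_fst).mul
    (Complex.continuous_conj.measurable.comp ((hφ j).comp measurable_snd))

/-- Isolates the dependence on the new point x in K(x,x) and the products K(x,·)K(·,x), exactly what
orthonormality can integrate. -/
lemma det_kernelMatrix_sumElim {K : ℂ → ℂ → ℂ} (hK : IsPosKernel K) (z : ι → ℂ) (x : ℂ) :
    (kernelMatrix K (Sum.elim z fun _ : Unit => x)).det
      = K x x * (kernelMatrix K z).det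
        - ∑ i, ∑ j, (kernelMatrix K z).adjugate i j * (K x (z i) * K (z j) x) := by
  have h : kernelMatrix K (Sum.elim z fun _ : Unit => x) =
      Matrix.fromBlocks (kernelMatrix K z) (Matrix.replicateCol Unit fun i => K (z i) x)
        (Matrix.replicateRow Unit fun j => K x (z j)) (Matrix.of fun _ _ => K x x) := by
    ext (i | i) (j | j) <;> rfl
  rw [h, det_fromBlocks_bordered (hK _ z)]
  congr 1
  simp only [dotProduct, Matrix.mulVec, Finset.mul_sum]
  refine Finset.sum_congr rfl fun i _ => Finset.sum_congr rfl fun j _ => by ring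

/-- Reproducing property: the kernel is that of an orthogonal projection in L²(μ). -/
lemma IsOrthonormalFamily.integrable_finKernel_mul (h : IsOrthonormalFamily φ μ) (a b : ℂ) :
    Integrable (fun x => finKernel φ x a * finKernel φ b x) μ ∧
      ∫ x, finKernel φ x a * finKernel φ b x ∂μ = finKernel φ b a := by
  have e : (fun x => finKernel φ x a * finKernel φ b x) = fun x => ∑ j, ∑ l,
      ((starRingEnd ℂ) (φ j a) * φ l b) * (φ j x * (starRingEnd ℂ) (φ l x)) := by
    funext x
    rw [finKernel, finKernel, Finset.sum_mul_sum]
    refine Finset.sum_congr rfl fun j _ => Finset.sum_congr rfl fun l _ => by ring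
  have hi : ∀ j l, Integrable (fun x => ((starRingEnd ℂ) (φ j a) * φ l b) *
      (φ j x * (starRingEnd ℂ) (φ l x))) μ := fun j l => (h.integrable j l).const_mul _
  rw [e]
  refine ⟨integrable_finsetSum _ fun j _ => integrable_finsetSum _ fun l _ => hi j l, ?_⟩
  rw [integral_finsetSum _ fun j _ => integrable_finsetSum _ fun l _ => hi j l]
  simp_rw [integral_finsetSum _ fun l _ => hi _ l, integral_const_mul, h.integral_eq]
  simp [finKernel, mul_comm]

lemma IsOrthonormalFamily.integrable_finKernel_diag (h : IsOrthonormalFamily φ μ) :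
    Integrable (fun x => finKernel φ x x) μ ∧ ∫ x, finKernel φ x x ∂μ = n := by
  refine ⟨integrable_finsetSum _ fun j _ => h.integrable j j, ?_⟩
  simp only [finKernel]
  rw [integral_finsetSum _ fun j _ => h.integrable j j]
  simp [h.integral_eq]

/-- Gaudin's lemma: integrating out one point of a determinant. -/
lemma IsOrthonormalFamily.integral_pdet_sumElim (h : IsOrthonormalFamily φ μ) (z : ι → ℂ) :
    Integrable (fun x => pdet (finKernel φ) (Sum.elim z fun _ : Unit => x)) μ ∧
    ∫ x, pdet (finKernel φ) (Sum.elim z fun _ : Unit => x) ∂μ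
      = ((n : ℝ) - Fintype.card ι) * pdet (finKernel φ) z := by
  set K := finKernel φ
  set M := kernelMatrix K z
  have e : (fun x => (kernelMatrix K (Sum.elim z fun _ : Unit => x)).det) = fun x =>
      K x x * M.det - ∑ i, ∑ j, M.adjugate i j * (K x (z i) * K (z j) x) :=
    funext fun x => det_kernelMatrix_sumElim (isPosKernel_finKernel φ) z x
  have h1 : Integrable (fun x => K x x * M.det) μ := h.integrable_finKernel_diag.1.mul_const _
  have h2 : ∀ i j, Integrable (fun x => M.adjugate i j * (K x (z i) * K (z j) x)) μ :=
    fun i j => (h.integrable_finKernel_mul _ _).1.const_mul _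
  have h3 : Integrable (fun x => ∑ i, ∑ j, M.adjugate i j * (K x (z i) * K (z j) x)) μ :=
    integrable_finsetSum _ fun i _ => integrable_finsetSum _ fun j _ => h2 i j
  have hint : Integrable (fun x => (kernelMatrix K (Sum.elim z fun _ : Unit => x)).det) μ := by
    rw [e]; exact h1.sub h3
  have hval : ∫ x, (kernelMatrix K (Sum.elim z fun _ : Unit => x)).det ∂μ
      = ((n : ℂ) - Fintype.card ι) * M.det := by
    rw [e, integral_sub h1 h3, integral_mul_const, h.integrable_finKernel_diag.2,
      integral_finsetSum _ fun i _ => integrable_finsetSum _ fun j _ => h2 i j]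
    simp_rw [integral_finsetSum _ fun j _ => h2 _ j, integral_const_mul]
    -- With x integrated out by the reproducing property, the double sum becomes tr(adj(M) M) = card
    -- · det M, which is subtracted from n · det M.
    have : ∑ i, ∑ j, M.adjugate i j * ∫ x, K x (z i) * K (z j) x ∂μ = (M.adjugate * M).trace := by
      simp only [Matrix.trace, Matrix.diag, Matrix.mul_apply]
      refine Finset.sum_congr rfl fun i _ => Finset.sum_congr rfl fun j _ => ?_
      rw [(h.integrable_finKernel_mul _ _).2]
      rfl
    rw [this, Matrix.adjugate_mul, Matrix.trace_smul, Matrix.trace_one, smul_eq_mul]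
    ring
  refine ⟨hint.re, ?_⟩
  have := integral_re hint
  simp only [RCLike.re_eq_complex_re] at this
  simp only [pdet]
  rw [this, hval, ← Complex.ofReal_natCast, ← Complex.ofReal_natCast, ← Complex.ofReal_sub,
    Complex.re_ofReal_mul]

end


/-! ### Configurations -/

namespace Configuration

/-- The points of `X` in `B`, with multiplicities. -/
def points (X : Configuration) (B : Set ℂ) : Set (ℂ × ℕ) :=
  {p : ℂ × ℕ | p.1 ∈ B ∧ p.2 < X.mult p.1}

lemma count_eq_encard (X : Configuration) (B : Set ℂ) : X.count B = (X.points B).encard := rfl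

lemma points_mono (X : Configuration) {B B' : Set ℂ} (h : B ⊆ B') : X.points B ⊆ X.points B' :=
  fun _ hp => ⟨h hp.1, hp.2⟩

lemma finite_points (X : Configuration) {B : Set ℂ} (hB : Bornology.IsBounded B) :
    (X.points B).Finite := by
  have h1 := X.locallyFinite _ hB.isCompact_closure
  refine (h1.biUnion fun z _ => (Set.finite_singleton z).prod (Set.finite_Iio (X.mult z))).subset ?_
  rintro ⟨z, i⟩ ⟨hz, hi⟩
  simp only [Set.mem_iUnion]
  refine ⟨z, ⟨subset_closure hz, ?_⟩, rfl, hi⟩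
  intro h
  simp only at hi
  omega

lemma count_ne_top (X : Configuration) {B : Set ℂ} (hB : Bornology.IsBounded B) :
    X.count B ≠ ⊤ := by
  rw [count_eq_encard, Set.encard_ne_top_iff]
  exact X.finite_points hB

lemma toNat_count_eq_iff (X : Configuration) {B : Set ℂ} (hB : Bornology.IsBounded B) (n : ℕ) :
    (X.count B).toNat = n ↔ X.count B = n := by
  constructor
  · intro h
    rw [← h, ENat.natCast_toNat (X.count_ne_top hB)]
  · intro h
    rw [h, ENat.toNat_natCast]

lemma count_union (X : Configuration) {B B' : Set ℂ} (h : Disjoint B B') :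
    X.count (B ∪ B') = X.count B + X.count B' := by
  have h1 : X.points (B ∪ B') = X.points B ∪ X.points B' := by
    ext p
    simp only [points, Set.mem_union, Set.mem_ofPred_eq]
    tauto
  rw [count_eq_encard, h1, Set.encard_union_eq]
  · rfl
  · rw [Set.disjoint_left] at h ⊢
    exact fun p hp hp' => h hp.1 hp'.1

lemma count_empty (X : Configuration) : X.count ∅ = 0 := by
  rw [count_eq_encard, Set.encard_eq_zero]
  ext p
  simp [points]

lemma count_biUnion {ι : Type*} (X : Configuration) (s : Finset ι) (B : ι → Set ℂ)
    (h : (s : Set ι).PairwiseDisjoint B) :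
    X.count (⋃ i ∈ s, B i) = ∑ i ∈ s, X.count (B i) := by
  classical
  induction s using Finset.induction_on with
  | empty => simp [count_empty]
  | insert a s ha ih =>
    rw [Finset.sum_insert ha, Finset.set_biUnion_insert, count_union, ih]
    · exact h.subset (by simp)
    · rw [Set.disjoint_iUnion₂_right]
      intro i hi
      refine h (by simp) (by simp [hi]) ?_
      rintro rfl
      exact ha hi

/-- Expresses the event {N_B = n} through countably many counts of bounded sets. For the converse,
nested finite sets of equal cardinality coincide. -/
lemma count_eq_coe_iff (X : Configuration) (B : Set ℂ) (n : ℕ) :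
    X.count B = n ↔ ∃ r₀ : ℕ, ∀ r : ℕ, r₀ ≤ r → X.count (B ∩ Metric.ball 0 r) = n := by
  have key : ∀ p ∈ X.points B, ∃ r : ℕ, p ∈ X.points (B ∩ Metric.ball 0 r) := by
    intro p hp
    obtain ⟨r, hr⟩ := exists_nat_gt ‖p.1‖
    exact ⟨r, ⟨hp.1, by simpa using hr⟩, hp.2⟩
  have mono : ∀ {r s : ℕ}, r ≤ s →
      X.points (B ∩ Metric.ball 0 r) ⊆ X.points (B ∩ Metric.ball 0 s) := fun {r s} h =>
    X.points_mono (Set.inter_subset_inter_right _ (Metric.ball_subset_ball (by exact_mod_cast h)))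
  simp only [count_eq_encard]
  constructor
  · intro h
    have hfin : (X.points B).Finite := Set.finite_of_encard_eq_coe h
    choose! r hr using key
    refine ⟨hfin.toFinset.sup r, fun s hs => ?_⟩
    rw [← h]
    congr 1
    refine (X.points_mono Set.inter_subset_left).antisymm fun p hp => ?_
    exact mono ((Finset.le_sup (f := r) (hfin.mem_toFinset.2 hp)).trans hs) (hr p hp)
  · rintro ⟨r₀, h⟩
    rw [← h r₀ le_rfl]
    congr 1
    refine Set.Subset.antisymm (fun p hp => ?_) (X.points_mono Set.inter_subset_left)
    obtain ⟨r, hr⟩ := key p hp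
    obtain ⟨s, hrs, hs⟩ : ∃ s, r ≤ s ∧ r₀ ≤ s := ⟨max r r₀, le_max_left _ _, le_max_right _ _⟩
    have hfin : (X.points (B ∩ Metric.ball 0 s)).Finite := Set.finite_of_encard_eq_coe (h s hs)
    have h1 : X.points (B ∩ Metric.ball 0 r₀) = X.points (B ∩ Metric.ball 0 s) :=
      hfin.eq_of_subset_of_encard_le' (mono hs) ((h s hs).trans (h r₀ le_rfl).symm).le
    rw [h1]
    exact mono hrs hr

lemma measurableSet_count_eq {B : Set ℂ} (hB : MeasurableSet B) (n : ℕ) :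
    MeasurableSet {X : Configuration | X.count B = n} :=
  MeasurableSpace.measurableSet_generateFrom ⟨B, n, hB, rfl⟩

lemma measurable_toNat_count {B : Set ℂ} (hB : MeasurableSet B) (hb : Bornology.IsBounded B) :
    Measurable fun X : Configuration => (X.count B).toNat := by
  refine measurable_to_countable' fun n => ?_
  convert measurableSet_count_eq hB n using 1
  ext X
  simp [toNat_count_eq_iff X hb]

/-- Measurability of a map into the space of configurations can be tested on counts of
bounded sets. -/
lemma measurable_of_count {Ω : Type*} [MeasurableSpace Ω] {f : Ω → Configuration}
    (h : ∀ B : Set ℂ, MeasurableSet B → Bornology.IsBounded B → ∀ n : ℕ,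
      MeasurableSet {ω | (f ω).count B = n}) : Measurable f := by
  refine measurable_generateFrom ?_
  rintro _ ⟨B, n, hB, rfl⟩
  have : f ⁻¹' {X | X.count B = n} = ⋃ r₀ : ℕ, ⋂ r : ℕ, ⋂ (_ : r₀ ≤ r),
      {ω | (f ω).count (B ∩ Metric.ball 0 r) = n} := by
    ext ω
    simp only [Set.mem_preimage, Set.mem_ofPred_eq, Set.mem_iUnion, Set.mem_iInter]
    exact count_eq_coe_iff _ _ _
  rw [this]
  refine MeasurableSet.iUnion fun r₀ => MeasurableSet.iInter fun r => MeasurableSet.iInter fun _ =>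
    h _ (hB.inter Metric.isOpen_ball.measurableSet)
      (Metric.isBounded_ball.subset Set.inter_subset_right) n

/-- The restriction of a configuration to a set. -/
noncomputable def restrict (S : Set ℂ) (X : Configuration) : Configuration where
  mult := S.indicator X.mult
  locallyFinite C hC := (X.locallyFinite C hC).subset fun z hz => ⟨hz.1, fun h => hz.2 (by
    by_cases hS : z ∈ S <;> simp [hS, h])⟩

lemma count_restrict (S : Set ℂ) (X : Configuration) (B : Set ℂ) :
    (restrict S X).count B = X.count (B ∩ S) := by
  rw [count_eq_encard, count_eq_encard]
  congr 1
  ext ⟨z, i⟩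
  by_cases hS : z ∈ S <;> simp [points, restrict, hS]

lemma measurable_restrict {S : Set ℂ} (hS : MeasurableSet S) :
    Measurable (restrict S) := by
  refine measurable_of_count fun B hB _ n => ?_
  simp only [count_restrict]
  exact measurableSet_count_eq (hB.inter hS) n

/-- The configuration of the first `m` points of a sequence. -/
noncomputable def ofSeq (p : ℕ × (ℕ → ℂ)) : Configuration where
  mult z := ((Finset.range p.1).filter fun i => p.2 i = z).card
  locallyFinite C _ := by
    refine (((Finset.range p.1).image p.2).finite_toSet).subset ?_
    rintro z ⟨-, hz⟩
    obtain ⟨i, hi⟩ := Finset.card_pos.1 (Nat.pos_of_ne_zero hz)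
    rw [Finset.mem_filter] at hi
    exact Finset.mem_coe.2 (Finset.mem_image.2 ⟨i, hi⟩)

open Classical in
-- A list is carried as a length and an infinite sequence whose further entries are ignored. The
-- space ℕ × (ℕ → ℂ) is standard Borel, as the disintegration in `exists_coupling` requires.
lemma count_ofSeq (p : ℕ × (ℕ → ℂ)) (B : Set ℂ) :
    (ofSeq p).count B = (((Finset.range p.1).filter fun i => p.2 i ∈ B).card : ℕ) := by
  set S := ((Finset.range p.1).filter fun i => p.2 i ∈ B)
  have hS : S.card = ∑ z ∈ S.image p.2, (ofSeq p).mult z := by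
    rw [Finset.card_eq_sum_card_image p.2 S]
    refine Finset.sum_congr rfl fun z hz => ?_
    obtain ⟨i, hi, rfl⟩ := Finset.mem_image.1 hz
    rw [Finset.mem_filter] at hi
    simp only [ofSeq]
    congr 1
    ext j
    simp only [S, Finset.mem_filter]
    constructor
    · tauto
    · rintro ⟨h1, h2⟩
      exact ⟨⟨h1, h2 ▸ hi.2⟩, h2⟩
  have h2 : (ofSeq p).points B = (((S.image p.2).sigma fun z => Finset.range ((ofSeq p).mult z)).map
      (Equiv.sigmaEquivProd ℂ ℕ).toEmbedding : Finset (ℂ × ℕ)) := by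
    ext ⟨z, j⟩
    simp only [points, Set.mem_ofPred_eq, Finset.coe_map, Set.mem_image, Finset.mem_coe,
      Finset.mem_sigma, Finset.mem_image, Finset.mem_range]
    constructor
    · rintro ⟨hz, hj⟩
      refine ⟨⟨z, j⟩, ⟨?_, hj⟩, rfl⟩
      have hpos : 0 < ((Finset.range p.1).filter fun i => p.2 i = z).card :=
        lt_of_le_of_lt (Nat.zero_le j) hj
      obtain ⟨i, hi⟩ := Finset.card_pos.1 hpos
      rw [Finset.mem_filter] at hi
      exact ⟨i, Finset.mem_filter.2 ⟨hi.1, by rw [hi.2]; exact hz⟩, hi.2⟩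
    · rintro ⟨⟨z', j'⟩, ⟨⟨i, hi, hz⟩, hj⟩, h⟩
      obtain ⟨rfl, rfl⟩ := Prod.mk_inj.1 h
      exact ⟨by rw [← hz]; exact (Finset.mem_filter.1 hi).2, hj⟩
  rw [count_eq_encard, h2, Set.encard_coe_eq_coe_finsetCard, Finset.card_map, Finset.card_sigma, hS]
  simp

lemma measurable_ofSeq : Measurable ofSeq := by
  classical
  refine measurable_of_count fun B hB _ n => ?_
  simp only [count_ofSeq, Nat.cast_inj]
  refine measurableSet_eq_fun (f := fun p : ℕ × (ℕ → ℂ) =>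
    ((Finset.range p.1).filter fun i => p.2 i ∈ B).card) (g := fun _ => n) ?_ measurable_const
  refine measurable_from_prod_countable_right fun m => ?_
  simp only [Finset.card_filter]
  refine Finset.measurable_sum _ fun i _ => ?_
  exact Measurable.ite (measurable_pi_apply i hB) measurable_const measurable_const

end Configuration


/-! ### Uniqueness of point fields with given intensity functions -/

/-- The normalized Lebesgue measure on `ℂ`. -/
noncomputable def lam : Measure ℂ := ENNReal.ofReal Real.pi⁻¹ • volume

instance : IsFiniteMeasureOnCompacts lam := by
  unfold lam
  exact IsFiniteMeasureOnCompacts.smul _ ENNReal.ofReal_ne_top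

instance : SigmaFinite lam := inferInstance

lemma vol_eq_pi (k : ℕ) : vol k = Measure.pi fun _ : Fin k => lam := by
  refine (Measure.pi_eq fun s _ => ?_).symm
  rw [vol, Measure.smul_apply, volume_pi_pi]
  simp only [lam, Measure.smul_apply, smul_eq_mul, Finset.prod_mul_distrib, Finset.prod_const,
    Finset.card_univ, Fintype.card_fin]

/-! ### Binomial inversion and laws determined by factorial moments. -/

lemma sum_range_neg_one_pow_mul_choose_mul_choose (n x : ℕ) :
    ∑ k ∈ Finset.range (x + 1), (-1 : ℝ) ^ (k + n) * k.choose n * x.choose k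
      = if x = n then 1 else 0 := by
  have h0 : ∀ k ∈ Finset.range (x + 1), (-1 : ℝ) ^ (k + n) * k.choose n * x.choose k
      = if n ≤ k then x.choose n * ((-1 : ℝ) ^ (k - n) * (x - n).choose (k - n)) else 0 := by
    intro k hk
    rw [Finset.mem_range] at hk
    split_ifs with h
    -- The identity C(x,k) C(k,n) = C(x,n) C(x-n,k-n) reduces the sum to the expansion of
    -- (1-1)^(x-n).
    · have h1 := Nat.choose_mul (n := x) (k := k) (s := n) h
      have h2 : (x.choose k : ℝ) * k.choose n = x.choose n * (x - n).choose (k - n) := by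
        exact_mod_cast h1
      have h3 : (-1 : ℝ) ^ (k + n) = (-1) ^ (k - n) := by
        obtain ⟨d, rfl⟩ := Nat.exists_eq_add_of_le h
        rw [show n + d + n = 2 * n + d by ring, pow_add, pow_mul]
        simp
      rw [h3]
      linear_combination (-1 : ℝ) ^ (k - n) * h2
    · rw [Nat.choose_eq_zero_of_lt (by omega)]
      simp
  rw [Finset.sum_congr rfl h0]
  rcases lt_or_ge x n with hx | hx
  · rw [if_neg hx.ne]
    refine Finset.sum_eq_zero fun k hk => ?_
    rw [Finset.mem_range] at hk
    rw [if_neg (by omega)]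
  · obtain ⟨d, rfl⟩ := Nat.exists_eq_add_of_le hx
    rw [show n + d + 1 = n + (d + 1) by ring, Finset.sum_range_add, Finset.sum_eq_zero, zero_add]
    · have h1 : ∀ k ∈ Finset.range (d + 1), (if n ≤ n + k then ((n + d).choose n : ℝ) *
          ((-1 : ℝ) ^ (n + k - n) * (n + d - n).choose (n + k - n)) else 0)
          = (n + d).choose n * ((-1 : ℝ) ^ k * d.choose k) := by
        intro k _
        rw [if_pos (by omega), Nat.add_sub_cancel_left, Nat.add_sub_cancel_left]
      rw [Finset.sum_congr rfl h1, ← Finset.mul_sum]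
      have h2 := Int.alternating_sum_range_choose (n := d)
      have h3 : ∑ k ∈ Finset.range (d + 1), ((-1 : ℝ) ^ k * d.choose k)
          = if d = 0 then 1 else 0 := by
        have := congrArg (Int.cast : ℤ → ℝ) h2
        push_cast at this
        rw [this]
      rw [h3]
      by_cases hd : d = 0 <;> simp [hd]
    · intro k hk
      rw [Finset.mem_range] at hk
      rw [if_neg (by omega)]

/-- The product of descending factorials. -/
def descProd {ι : Type} [Fintype ι] (κ x : ι → ℕ) : ℕ := ∏ j, (x j).descFactorial (κ j)

section

variable {ι : Type} [Fintype ι] [DecidableEq ι]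

/-- The coefficients of the inversion formula for factorial moments. -/
noncomputable def invCoeff (n κ : ι → ℕ) : ℝ :=
  ∏ j, ((-1 : ℝ) ^ (κ j + n j) * (κ j).choose (n j) / (κ j).factorial)

/-- Pointwise inversion, one coordinate at a time. For fixed x the series is finite, since C(x_j,
κ_j) = 0 as soon as κ_j > x_j; convergence is an issue only after integration. -/
lemma hasSum_invCoeff_mul_descProd (n x : ι → ℕ) :
    HasSum (fun κ => invCoeff n κ * (descProd κ x : ℝ)) (if x = n then 1 else 0) := by
  have h : ∀ κ : ι → ℕ, invCoeff n κ * (descProd κ x : ℝ)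
      = ∏ j, ((-1 : ℝ) ^ (κ j + n j) * (κ j).choose (n j) * (x j).choose (κ j)) := by
    intro κ
    rw [invCoeff, descProd, Nat.cast_prod, ← Finset.prod_mul_distrib]
    refine Finset.prod_congr rfl fun j _ => ?_
    rw [Nat.descFactorial_eq_factorial_mul_choose]
    have : ((κ j).factorial : ℝ) ≠ 0 := by exact_mod_cast (κ j).factorial_ne_zero
    push_cast
    field_simp
  simp only [h]
  have h2 : (if x = n then (1 : ℝ) else 0) = ∑ κ ∈ Fintype.piFinset fun j => Finset.range (x j + 1),
      ∏ j, ((-1 : ℝ) ^ (κ j + n j) * (κ j).choose (n j) * (x j).choose (κ j)) := by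
    rw [← Finset.prod_univ_sum (fun j => Finset.range (x j + 1))
      fun j k => ((-1 : ℝ) ^ (k + n j) * k.choose (n j) * (x j).choose k)]
    simp only [sum_range_neg_one_pow_mul_choose_mul_choose]
    rw [Finset.prod_ite_zero]
    simp [funext_iff]
  rw [h2]
  refine hasSum_sum_of_ne_finset_zero fun κ hκ => ?_
  simp only [Fintype.mem_piFinset, Finset.mem_range, not_forall] at hκ
  obtain ⟨j, hj⟩ := hκ
  refine Finset.prod_eq_zero (Finset.mem_univ j) ?_
  rw [Nat.choose_eq_zero_of_lt (by omega : x j < κ j)]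
  simp

lemma summable_prod_pow_div_factorial {A : ℝ} (hA : 0 ≤ A) :
    Summable fun κ : ι → ℕ => ∏ j, (A ^ κ j / (κ j).factorial) := by
  refine summable_of_sum_le (c := ∏ _j : ι, Real.exp A)
    (fun κ => Finset.prod_nonneg fun j _ => by positivity) fun s => ?_
  have hsub : s ⊆ Fintype.piFinset fun j => Finset.range (s.sup (fun κ => κ j) + 1) := by
    intro κ hκ
    simp only [Fintype.mem_piFinset, Finset.mem_range]
    intro j
    have := Finset.le_sup (f := fun κ : ι → ℕ => κ j) hκ
    omega
  calc ∑ κ ∈ s, ∏ j, (A ^ κ j / (κ j).factorial)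
      ≤ ∑ κ ∈ Fintype.piFinset fun j => Finset.range (s.sup (fun κ => κ j) + 1),
        ∏ j, (A ^ κ j / (κ j).factorial) :=
        Finset.sum_le_sum_of_subset_of_nonneg hsub
          fun κ _ _ => Finset.prod_nonneg fun j _ => by positivity
    _ = ∏ j, ∑ k ∈ Finset.range (s.sup (fun κ => κ j) + 1), A ^ k / k.factorial :=
        (Finset.prod_univ_sum (fun j => Finset.range (s.sup (fun κ => κ j) + 1))
          fun j k => A ^ k / (k.factorial : ℝ)).symm
    _ ≤ ∏ _j : ι, Real.exp A := by
        refine Finset.prod_le_prod (fun j _ => Finset.sum_nonneg fun k _ => by positivity)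
          fun j _ => Real.sum_le_exp_of_nonneg hA _

/-- A law on `ℕ^ι` whose factorial moments grow at most geometrically is given by an inversion
formula. -/
lemma hasSum_measureReal_singleton (μ : Measure (ι → ℕ)) [IsFiniteMeasure μ] {A : ℝ} (hA : 0 ≤ A)
    (hμ : ∀ κ : ι → ℕ, ∫⁻ x, (descProd κ x : ℝ≥0∞) ∂μ ≤ ENNReal.ofReal (A ^ ∑ j, κ j))
    (n : ι → ℕ) :
    HasSum (fun κ => invCoeff n κ * (∫⁻ x, (descProd κ x : ℝ≥0∞) ∂μ).toReal) (μ.real {n}) := by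
  have hmeas : ∀ κ : ι → ℕ, Measurable fun x : ι → ℕ => (descProd κ x : ℝ≥0∞) :=
    fun κ => measurable_of_countable _
  have hfin : ∀ κ : ι → ℕ, ∫⁻ x, (descProd κ x : ℝ≥0∞) ∂μ ≠ ⊤ :=
    fun κ => ((hμ κ).trans_lt ENNReal.ofReal_lt_top).ne
  have hI : ∀ κ : ι → ℕ, ∫ x, (descProd κ x : ℝ) ∂μ
      = (∫⁻ x, (descProd κ x : ℝ≥0∞) ∂μ).toReal := by
    intro κ
    rw [← integral_toReal (hmeas κ).aemeasurable (by simp)]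
    simp
  have hint : ∀ κ : ι → ℕ, Integrable (fun x : ι → ℕ => (descProd κ x : ℝ)) μ := by
    intro κ
    have := integrable_toReal_of_lintegral_ne_top (hmeas κ).aemeasurable (hfin κ)
    simpa using this
  have hsum : Summable fun κ : ι → ℕ => ∫ x, ‖invCoeff n κ * (descProd κ x : ℝ)‖ ∂μ := by
    -- The factor 2 in 2A pays for C(κ_j, n_j) ≤ 2^κ_j, and A^κ_j bounds the moment; the factorials
    -- in `invCoeff` make the majorant summable.
    refine Summable.of_nonneg_of_le (fun κ => integral_nonneg fun _ => norm_nonneg _) (fun κ => ?_)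
      (summable_prod_pow_div_factorial (ι := ι) (A := 2 * A) (by positivity))
    have h1 : ∀ x : ι → ℕ, ‖invCoeff n κ * (descProd κ x : ℝ)‖
        = ‖invCoeff n κ‖ * (descProd κ x : ℝ) := by
      intro x; rw [norm_mul, Real.norm_natCast]
    simp only [h1]
    rw [integral_const_mul, hI]
    have h2 : (∫⁻ x, (descProd κ x : ℝ≥0∞) ∂μ).toReal ≤ A ^ ∑ j, κ j :=
      ENNReal.toReal_le_of_le_ofReal (by positivity) (hμ κ)
    have h3 : ‖invCoeff n κ‖ ≤ ∏ j, (2 ^ κ j / ((κ j).factorial : ℝ)) := by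
      rw [invCoeff, norm_prod]
      refine Finset.prod_le_prod (fun j _ => norm_nonneg _) fun j _ => ?_
      rw [norm_div, norm_mul, norm_pow, norm_neg, norm_one, one_pow, one_mul, Real.norm_natCast,
        Real.norm_natCast]
      gcongr
      exact_mod_cast Nat.choose_le_two_pow _ _
    calc ‖invCoeff n κ‖ * (∫⁻ x, (descProd κ x : ℝ≥0∞) ∂μ).toReal
        ≤ (∏ j, (2 ^ κ j / ((κ j).factorial : ℝ))) * A ^ ∑ j, κ j := by gcongr
      _ = ∏ j, ((2 * A) ^ κ j / ((κ j).factorial : ℝ)) := by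
        rw [← Finset.prod_pow_eq_pow_sum, ← Finset.prod_mul_distrib]
        refine Finset.prod_congr rfl fun j _ => ?_
        rw [mul_pow]; ring
  have key := hasSum_integral_of_summable_integral_norm (fun κ => (hint κ).const_mul (invCoeff n κ))
    hsum
  have h4 : ∫ x, ∑' κ, invCoeff n κ * (descProd κ x : ℝ) ∂μ = μ.real {n} := by
    simp only [(hasSum_invCoeff_mul_descProd n _).tsum_eq]
    have : (fun x : ι → ℕ => if x = n then (1 : ℝ) else 0)
        = Set.indicator {n} fun _ => (1 : ℝ) := by
      ext x
      simp [Set.indicator]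
    rw [this, integral_indicator_const _ (measurableSet_singleton n)]
    simp
  rw [h4] at key
  simpa only [integral_const_mul, hI] using key

lemma Measure.ext_of_descProd {μ ν : Measure (ι → ℕ)} [IsFiniteMeasure μ] [IsFiniteMeasure ν]
    {A : ℝ} (hA : 0 ≤ A)
    (hμ : ∀ κ : ι → ℕ, ∫⁻ x, (descProd κ x : ℝ≥0∞) ∂μ ≤ ENNReal.ofReal (A ^ ∑ j, κ j))
    (h : ∀ κ : ι → ℕ, ∫⁻ x, (descProd κ x : ℝ≥0∞) ∂μ = ∫⁻ x, (descProd κ x : ℝ≥0∞) ∂ν) :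
    μ = ν := by
  refine Measure.ext_of_singleton fun n => ?_
  have h1 := hasSum_measureReal_singleton μ hA hμ n
  have h2 := hasSum_measureReal_singleton ν hA (fun κ => h κ ▸ hμ κ) n
  simp only [h] at h1
  exact (measureReal_eq_measureReal_iff).1 (h1.unique h2)

end


/-- Turns a multi-index of orders into an assignment of coordinates to sets, the form in which the
moments in `IsIntensityFunction` are given. -/
lemma exists_map_card_fiber {m : ℕ} (κ : Fin m → ℕ) :
    ∃ σ : Fin (∑ j, κ j) → Fin m, ∀ j, (Finset.univ.filter fun i => σ i = j).card = κ j := by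
  refine ⟨fun i => (finSigmaFinEquiv.symm i).1, fun j => ?_⟩
  have : (Finset.univ.filter fun i : Fin (∑ j, κ j) => (finSigmaFinEquiv.symm i).1 = j)
      = Finset.univ.map ((Function.Embedding.sigmaMk (β := fun j => Fin (κ j)) j).trans
        finSigmaFinEquiv.toEmbedding) := by
    ext i
    simp only [Finset.mem_filter, Finset.mem_univ, true_and, Finset.mem_map,
      Function.Embedding.trans_apply, Function.Embedding.sigmaMk_apply, Equiv.coe_toEmbedding]
    constructor
    · intro h
      obtain ⟨⟨j', a⟩, rfl⟩ := finSigmaFinEquiv.surjective i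
      rw [Equiv.symm_apply_apply] at h
      subst h
      exact ⟨a, rfl⟩
    · rintro ⟨a, rfl⟩
      rw [Equiv.symm_apply_apply]
  rw [this]
  simp

/-- The counts of a finite family of sets. -/
noncomputable def counts {ι : Type} (B : ι → Set ℂ) (X : Configuration) : ι → ℕ :=
  fun j => (X.count (B j)).toNat

lemma measurable_counts {ι : Type} {B : ι → Set ℂ} (hB : ∀ j, MeasurableSet (B j))
    (hb : ∀ j, Bornology.IsBounded (B j)) : Measurable (counts B) :=
  measurable_pi_lambda _ fun j => Configuration.measurable_toNat_count (hB j) (hb j)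

/-- Local geometric bounds for a family of intensity functions. -/
def GeomBounded (ρ : ∀ k : ℕ, (Fin k → ℂ) → ℝ) : Prop :=
  ∀ r : ℝ, ∃ C : ℝ, ∀ (k : ℕ) (z : Fin k → ℂ), (∀ i, ‖z i‖ ≤ r) → ρ k z ≤ C ^ k

lemma lam_ball_lt_top (r : ℝ) : lam (Metric.ball 0 r) < ⊤ :=
  (measure_mono Metric.ball_subset_closedBall).trans_lt (isCompact_closedBall 0 r).measure_lt_top

lemma vol_box_le {m k : ℕ} {B : Fin m → Set ℂ} {r : ℝ} (hr : ∀ j, B j ⊆ Metric.ball 0 r)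
    (σ : Fin k → Fin m) :
    vol k {z | ∀ i, z i ∈ B (σ i)} ≤ ENNReal.ofReal ((lam (Metric.ball 0 r)).toReal ^ k) := by
  have h : {z : Fin k → ℂ | ∀ i, z i ∈ B (σ i)} = Set.univ.pi fun i => B (σ i) := by
    ext z; simp
  rw [h, vol_eq_pi, Measure.pi_pi, ENNReal.ofReal_pow ENNReal.toReal_nonneg,
    ENNReal.ofReal_toReal (lam_ball_lt_top r).ne]
  calc ∏ i, lam (B (σ i)) ≤ ∏ _i : Fin k, lam (Metric.ball 0 r) :=
        Finset.prod_le_prod' fun i _ => measure_mono (hr _)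
    _ = _ := by simp

/-! ### From intensity functions to the law of the counts. -/

section

variable {P P' : ProbabilityMeasure Configuration} {ρ : ∀ k : ℕ, (Fin k → ℂ) → ℝ}

lemma exists_ball_of_bounded {ι : Type} [Finite ι] {B : ι → Set ℂ}
    (hb : ∀ j, Bornology.IsBounded (B j)) : ∃ r : ℝ, ∀ j, B j ⊆ Metric.ball 0 r := by
  obtain ⟨r, hr⟩ := ((Bornology.isBounded_iUnion).2 hb).subset_ball 0
  exact ⟨r, fun j => (Set.subset_iUnion B j).trans hr⟩

lemma lintegral_descProd_counts_eq (hP : ∀ k, 1 ≤ k → IsIntensityFunction P k (ρ k))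
    {m : ℕ} {B : Fin m → Set ℂ} (hB : ∀ j, MeasurableSet (B j))
    (hb : ∀ j, Bornology.IsBounded (B j)) (hd : Pairwise fun i j => Disjoint (B i) (B j))
    (κ : Fin m → ℕ) (σ : Fin (∑ j, κ j) → Fin m)
    (hσ : ∀ j, (Finset.univ.filter fun i => σ i = j).card = κ j) (h0 : 1 ≤ ∑ j, κ j) :
    ∫⁻ X, (descProd κ (counts B X) : ℝ≥0∞) ∂(P : Measure Configuration)
      = ∫⁻ z in {z | ∀ i, z i ∈ B (σ i)}, ENNReal.ofReal (ρ _ z) ∂(vol _) := by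
  have := (hP _ h0).2.2 m B σ hB hb hd
  simp only [hσ] at this
  exact this

/-- A factorial moment of total order k is at most (|C| · L)^k, with L the mass of a ball containing
all the sets, so the inversion formula applies. -/
lemma map_counts_eq_of_disjoint (hP : ∀ k, 1 ≤ k → IsIntensityFunction P k (ρ k))
    (hP' : ∀ k, 1 ≤ k → IsIntensityFunction P' k (ρ k)) (hρ : GeomBounded ρ)
    {m : ℕ} {B : Fin m → Set ℂ} (hB : ∀ j, MeasurableSet (B j))
    (hb : ∀ j, Bornology.IsBounded (B j)) (hd : Pairwise fun i j => Disjoint (B i) (B j)) :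
    (P : Measure Configuration).map (counts B) = (P' : Measure Configuration).map (counts B) := by
  have hm := measurable_counts hB hb
  obtain ⟨r, hr⟩ := exists_ball_of_bounded hb
  obtain ⟨C, hC⟩ := hρ r
  have hmap : ∀ (Q : ProbabilityMeasure Configuration) (κ : Fin m → ℕ),
      ∫⁻ x, (descProd κ x : ℝ≥0∞) ∂(Q : Measure Configuration).map (counts B)
        = ∫⁻ X, (descProd κ (counts B X) : ℝ≥0∞) ∂(Q : Measure Configuration) :=
    fun Q κ => lintegral_map (measurable_of_countable _) hm
  have hinst : ∀ Q : ProbabilityMeasure Configuration,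
      IsProbabilityMeasure ((Q : Measure Configuration).map (counts B)) :=
    fun Q => Measure.isProbabilityMeasure_map hm.aemeasurable
  -- The moment of order zero is not covered by the hypotheses, which start at k = 1; it is just the
  -- total mass.
  have hzero : ∀ κ : Fin m → ℕ, ¬ 1 ≤ ∑ j, κ j → ∀ x, descProd κ x = 1 := by
    intro κ hκ x
    have : ∀ j, κ j = 0 := by
      have : ∑ j, κ j = 0 := by omega
      simpa using this
    simp [descProd, this]
  set L := (lam (Metric.ball 0 r)).toReal
  have hL : 0 ≤ L := ENNReal.toReal_nonneg
  refine Measure.ext_of_descProd (A := |C| * L) (by positivity) (fun κ => ?_) (fun κ => ?_)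
  · rw [hmap]
    by_cases h0 : 1 ≤ ∑ j, κ j
    · obtain ⟨σ, hσ⟩ := exists_map_card_fiber κ
      rw [lintegral_descProd_counts_eq hP hB hb hd κ σ hσ h0]
      calc ∫⁻ z in {z | ∀ i, z i ∈ B (σ i)}, ENNReal.ofReal (ρ _ z) ∂(vol _)
          ≤ ∫⁻ z in {z | ∀ i, z i ∈ B (σ i)}, ENNReal.ofReal (|C| ^ ∑ j, κ j) ∂(vol _) := by
            refine setLIntegral_mono measurable_const fun z hz => ?_
            refine ENNReal.ofReal_le_ofReal ((hC _ z fun i => ?_).trans ?_)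
            · simpa using (Metric.mem_ball.1 (hr _ (hz i))).le
            · exact (le_abs_self _).trans (abs_pow _ _).le
        _ ≤ ENNReal.ofReal (|C| ^ ∑ j, κ j) * ENNReal.ofReal (L ^ ∑ j, κ j) := by
            rw [setLIntegral_const]
            gcongr
            exact vol_box_le hr σ
        _ = _ := by rw [← ENNReal.ofReal_mul (by positivity), mul_pow]
    · simp only [hzero κ h0]
      have : ∑ j, κ j = 0 := by omega
      simp [this]
  · rw [hmap, hmap]
    by_cases h0 : 1 ≤ ∑ j, κ j
    · obtain ⟨σ, hσ⟩ := exists_map_card_fiber κ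
      rw [lintegral_descProd_counts_eq hP hB hb hd κ σ hσ h0,
        lintegral_descProd_counts_eq hP' hB hb hd κ σ hσ h0]
    · simp only [hzero κ h0]
      simp

/-- The atoms of the algebra generated by a finite family of sets. -/
def atom {ι : Type} (B : ι → Set ℂ) (s : Finset ι) : Set ℂ := {z | ∀ i, z ∈ B i ↔ i ∈ s}

lemma map_counts_eq (hP : ∀ k, 1 ≤ k → IsIntensityFunction P k (ρ k))
    (hP' : ∀ k, 1 ≤ k → IsIntensityFunction P' k (ρ k)) (hρ : GeomBounded ρ)
    {ι : Type} [Fintype ι] {B : ι → Set ℂ} (hB : ∀ j, MeasurableSet (B j))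
    (hb : ∀ j, Bornology.IsBounded (B j)) :
    (P : Measure Configuration).map (counts B) = (P' : Measure Configuration).map (counts B) := by
  classical
  -- Overlapping sets are cut into disjoint atoms. The atom of the empty index set, the complement
  -- of the union, is left out: it is unbounded and lies in none of the sets.
  let e := Fintype.equivFin {s : Finset ι // s.Nonempty}
  let A : Fin (Fintype.card {s : Finset ι // s.Nonempty}) → Set ℂ := fun j => atom B (e.symm j).1
  have hAm : ∀ j, MeasurableSet (A j) := by
    intro j
    have : A j = ⋂ i, if i ∈ (e.symm j).1 then B i else (B i)ᶜ := by
      ext z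
      simp only [A, atom, Set.mem_ofPred_eq, Set.mem_iInter]
      refine forall_congr' fun i => ?_
      split_ifs with h <;> simp [h]
    rw [this]
    refine MeasurableSet.iInter fun i => ?_
    split_ifs
    exacts [hB i, (hB i).compl]
  have hAb : ∀ j, Bornology.IsBounded (A j) := by
    intro j
    obtain ⟨i, hi⟩ := (e.symm j).2
    exact (hb i).subset fun z hz => (hz i).2 hi
  have hAd : Pairwise fun i j => Disjoint (A i) (A j) := by
    intro i j hij
    rw [Set.disjoint_left]
    intro z hz hz'
    refine hij (e.symm.injective (Subtype.ext (Finset.ext fun l => ?_)))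
    rw [← hz l, ← hz' l]
  let T : (Fin (Fintype.card {s : Finset ι // s.Nonempty}) → ℕ) → ι → ℕ :=
    fun x i => ∑ j ∈ Finset.univ.filter fun j => i ∈ (e.symm j).1, x j
  have hT : counts B = T ∘ counts A := by
    funext X i
    have hBi : B i = ⋃ j ∈ Finset.univ.filter fun j => i ∈ (e.symm j).1, A j := by
      ext z
      simp only [Set.mem_iUnion, Finset.mem_filter, Finset.mem_univ, true_and]
      constructor
      · intro hz
        have hi : i ∈ Finset.univ.filter fun l => z ∈ B l := by simpa using hz
        refine ⟨e ⟨Finset.univ.filter fun l => z ∈ B l, ⟨i, hi⟩⟩, ?_, ?_⟩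
        · simpa using hz
        · intro l
          simp
      · rintro ⟨j, hj, hz⟩
        exact (hz i).2 hj
    simp only [Function.comp_apply, T, counts]
    conv_lhs => rw [hBi]
    rw [X.count_biUnion _ _ fun j _ l _ hjl => hAd hjl]
    rw [ENat.toNat_sum]
    intro j _
    exact X.count_ne_top (hAb j)
  have hTm : Measurable T := measurable_of_countable _
  rw [hT, ← Measure.map_map hTm (measurable_counts hAm hAb),
    ← Measure.map_map hTm (measurable_counts hAm hAb),
    map_counts_eq_of_disjoint hP hP' hρ hAm hAb hAd]

/-- The cylinder sets of bounded Borel sets. -/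
def boundedCylinders : Set (Set Configuration) :=
  {S | ∃ (ι : Type) (_ : Fintype ι) (B : ι → Set ℂ) (n : ι → ℕ), (∀ j, MeasurableSet (B j)) ∧
    (∀ j, Bornology.IsBounded (B j)) ∧ S = counts B ⁻¹' {n}}

/-- The sets may overlap and the index type is any finite type, so two cylinders intersect in the
cylinder over the disjoint sum. -/
lemma isPiSystem_boundedCylinders : IsPiSystem boundedCylinders := by
  rintro _ ⟨ι, _, B, n, hB, hb, rfl⟩ _ ⟨ι', _, B', n', hB', hb', rfl⟩ -
  refine ⟨ι ⊕ ι', inferInstance, Sum.elim B B', Sum.elim n n', ?_, ?_, ?_⟩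
  · rintro (j | j)
    exacts [hB j, hB' j]
  · rintro (j | j)
    exacts [hb j, hb' j]
  · ext X
    simp [counts, funext_iff]

lemma generateFrom_boundedCylinders :
    (inferInstance : MeasurableSpace Configuration)
      = MeasurableSpace.generateFrom boundedCylinders := by
  apply le_antisymm
  · have h : @Measurable _ _ (MeasurableSpace.generateFrom boundedCylinders) _
        (id : Configuration → Configuration) := by
      refine @Configuration.measurable_of_count _ (MeasurableSpace.generateFrom boundedCylinders) _
        fun B hB hb n => ?_
      refine MeasurableSpace.measurableSet_generateFrom
        ⟨Unit, inferInstance, fun _ => B, fun _ => n, fun _ => hB, fun _ => hb, ?_⟩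
      ext X
      simp [counts, funext_iff, X.toNat_count_eq_iff hb]
    intro S hS
    exact h hS
  · refine MeasurableSpace.generateFrom_le ?_
    rintro _ ⟨ι, _, B, n, hB, hb, rfl⟩
    exact measurable_counts hB hb (measurableSet_singleton n)

/-- A point field with locally geometrically bounded intensity functions is determined by them. -/
theorem ext_of_isIntensityFunction (hP : ∀ k, 1 ≤ k → IsIntensityFunction P k (ρ k))
    (hP' : ∀ k, 1 ≤ k → IsIntensityFunction P' k (ρ k)) (hρ : GeomBounded ρ) : P = P' := by
  refine ProbabilityMeasure.toMeasure_injective ?_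
  refine ext_of_generate_finite _ generateFrom_boundedCylinders isPiSystem_boundedCylinders ?_
    (by simp)
  rintro _ ⟨ι, _, B, n, hB, hb, rfl⟩
  rw [← Measure.map_apply (measurable_counts hB hb) (measurableSet_singleton n),
    ← Measure.map_apply (measurable_counts hB hb) (measurableSet_singleton n),
    map_counts_eq hP hP' hρ hB hb]

end


/-! ### Product measures and symmetric integrals -/

/-- The power `μ^ι` of a measure on `ℂ`. -/
noncomputable def powMeasure (μ : Measure ℂ) (ι : Type) [Fintype ι] : Measure (ι → ℂ) :=
  Measure.pi fun _ => μ

section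

variable {ι κ : Type} [Fintype ι] [Fintype κ] {μ : Measure ℂ} [SigmaFinite μ]

instance : SigmaFinite (powMeasure μ ι) := by unfold powMeasure; infer_instance

instance {μ : Measure ℂ} [IsFiniteMeasure μ] : IsFiniteMeasure (powMeasure μ ι) := by
  unfold powMeasure; infer_instance

lemma vol_eq_powMeasure (k : ℕ) : vol k = powMeasure lam (Fin k) := vol_eq_pi k

/-- Reindexing of the coordinates, as a measurable equivalence. -/
def reindexEquiv (e : ι ≃ κ) : (κ → ℂ) ≃ᵐ (ι → ℂ) where
  toFun y := y ∘ e
  invFun x := x ∘ e.symm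
  left_inv y := by funext i; simp
  right_inv x := by funext i; simp
  measurable_toFun := measurable_pi_lambda _ fun i => measurable_pi_apply (e i)
  measurable_invFun := measurable_pi_lambda _ fun i => measurable_pi_apply (e.symm i)

lemma measurePreserving_reindexEquiv (e : ι ≃ κ) :
    MeasurePreserving (reindexEquiv e) (powMeasure μ κ) (powMeasure μ ι) := by
  refine ⟨(reindexEquiv e).measurable, (Measure.pi_eq fun s hs => ?_).symm⟩
  rw [Measure.map_apply (reindexEquiv e).measurable (MeasurableSet.univ_pi hs)]
  have : reindexEquiv e ⁻¹' (Set.univ.pi s) = Set.univ.pi fun j => s (e.symm j) := by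
    ext y
    simp only [Set.mem_preimage, Set.mem_univ_pi]
    constructor
    · intro h j
      simpa [reindexEquiv] using h (e.symm j)
    · intro h i
      simpa [reindexEquiv] using h (e i)
  rw [this, powMeasure, Measure.pi_pi]
  exact e.symm.prod_comp fun i => μ (s i)

lemma lintegral_comp_equiv (e : ι ≃ κ) (f : (ι → ℂ) → ℝ≥0∞) :
    ∫⁻ y, f (y ∘ e) ∂powMeasure μ κ = ∫⁻ x, f x ∂powMeasure μ ι :=
  (measurePreserving_reindexEquiv e).lintegral_comp_emb (reindexEquiv e).measurableEmbedding f

lemma integral_comp_equiv (e : ι ≃ κ) (f : (ι → ℂ) → ℝ) :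
    ∫ y, f (y ∘ e) ∂powMeasure μ κ = ∫ x, f x ∂powMeasure μ ι :=
  (measurePreserving_reindexEquiv e).integral_comp (reindexEquiv e).measurableEmbedding f

lemma measurePreserving_sumElim :
    MeasurePreserving (fun p : (ι → ℂ) × (κ → ℂ) => Sum.elim p.1 p.2)
      ((powMeasure μ ι).prod (powMeasure μ κ)) (powMeasure μ (ι ⊕ κ)) := by
  have := measurePreserving_sumPiEquivProdPi_symm (X := fun _ : ι ⊕ κ => ℂ) (fun _ => μ)
  unfold powMeasure
  convert this using 1
  ext p (i | i) <;> rfl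

lemma measurable_sumElim :
    Measurable (fun p : (ι → ℂ) × (κ → ℂ) => Sum.elim p.1 p.2) :=
  (measurePreserving_sumElim (μ := lam)).measurable

lemma lintegral_sum {f : (ι ⊕ κ → ℂ) → ℝ≥0∞} (hf : Measurable f) :
    ∫⁻ y, f y ∂powMeasure μ (ι ⊕ κ)
      = ∫⁻ x, ∫⁻ w, f (Sum.elim x w) ∂powMeasure μ κ ∂powMeasure μ ι := by
  rw [← measurePreserving_sumElim.lintegral_comp hf]
  exact lintegral_prod _ (hf.comp measurable_sumElim).aemeasurable

lemma integral_sum {f : (ι ⊕ κ → ℂ) → ℝ} (hf : Integrable f (powMeasure μ (ι ⊕ κ))) :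
    ∫ y, f y ∂powMeasure μ (ι ⊕ κ)
      = ∫ x, ∫ w, f (Sum.elim x w) ∂powMeasure μ κ ∂powMeasure μ ι := by
  have h := measurePreserving_sumElim (μ := μ) (ι := ι) (κ := κ)
  rw [← h.map_eq, integral_map h.measurable.aemeasurable (by rw [h.map_eq]; exact hf.1)]
  exact integral_prod _ (h.integrable_comp_of_integrable hf)

lemma measurePreserving_const [Unique κ] :
    MeasurePreserving (fun (x : ℂ) (_ : κ) => x) μ (powMeasure μ κ) := by
  convert (measurePreserving_funUnique μ κ).symm using 1
  · funext x i
    rw [Subsingleton.elim i default]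
    rfl
  · unfold powMeasure
    congr!

lemma lintegral_unique [Unique κ] {f : (κ → ℂ) → ℝ≥0∞} (hf : Measurable f) :
    ∫⁻ y, f y ∂powMeasure μ κ = ∫⁻ x, f (fun _ => x) ∂μ :=
  (measurePreserving_const.lintegral_comp hf).symm

lemma integral_unique_pi [Unique κ] {f : (κ → ℂ) → ℝ} (hf : Measurable f) :
    ∫ y, f y ∂powMeasure μ κ = ∫ x, f (fun _ => x) ∂μ := by
  have h := measurePreserving_const (μ := μ) (κ := κ)
  rw [← h.map_eq, integral_map h.measurable.aemeasurable hf.aestronglyMeasurable]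

end

/-! ### Factorial moments of a finite set of points -/

section

variable {α β γ : Type} [Fintype α] [Fintype β] [Fintype γ] [DecidableEq β]
  [DecidableEq γ]

/-- Embeddings which respect a disjoint family of sets are families of embeddings. -/
def embeddingRespectEquiv (S : γ → Finset β) (hS : Pairwise fun i j => Disjoint (S i) (S j))
    (σ : α → γ) :
    {e : α ↪ β // ∀ l, e l ∈ S (σ l)} ≃ ∀ j, ({l // σ l = j} ↪ S j) where
  toFun e j := ⟨fun l => ⟨e.1 l.1, by have := e.2 l.1; rwa [l.2] at this⟩, fun l l' h =>
    Subtype.ext (e.1.injective (congrArg Subtype.val h))⟩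
  invFun f := ⟨⟨fun l => (f (σ l) ⟨l, rfl⟩).1, fun l l' h => by
      have hσ : σ l = σ l' := by
        by_contra hne
        exact Finset.disjoint_left.1 (hS hne) (f (σ l) ⟨l, rfl⟩).2
          (by simp only at h; rw [h]; exact (f (σ l') ⟨l', rfl⟩).2)
      have key : ∀ j (h1 : σ l = j), (f (σ l) ⟨l, rfl⟩).1 = (f j ⟨l, h1⟩).1 := by
        rintro j rfl
        rfl
      simp only at h
      rw [key _ hσ] at h
      exact congrArg Subtype.val ((f (σ l')).injective (Subtype.ext h))⟩, fun l => (f (σ l) ⟨l, rfl⟩).2⟩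
  left_inv e := by ext; rfl
  right_inv f := by
    funext j
    ext ⟨l, rfl⟩
    rfl

lemma card_embedding_respect [DecidableEq α] (S : γ → Finset β) (hS : Pairwise fun i j => Disjoint (S i) (S j))
    (σ : α → γ) :
    Fintype.card {e : α ↪ β // ∀ l, e l ∈ S (σ l)}
      = ∏ j, (S j).card.descFactorial (Finset.univ.filter fun l => σ l = j).card := by
  rw [Fintype.card_congr (embeddingRespectEquiv S hS σ), Fintype.card_pi]
  refine Finset.prod_congr rfl fun j _ => ?_
  rw [Fintype.card_embedding_eq, Fintype.card_coe, Fintype.card_subtype]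

end

open Classical in
/-- The product of the factorial powers of the numbers of points in disjoint sets is the number of
ways to choose distinct points in the sets. -/
lemma prod_descFactorial_eq_sum {m k M : ℕ} {B : Fin M → Set ℂ}
    (hB : Pairwise fun i j => Disjoint (B i) (B j)) (σ : Fin k → Fin M) (z : Fin m → ℂ) :
    ((∏ j, ((Finset.univ.filter fun i => z i ∈ B j).card).descFactorial
        (Finset.univ.filter fun l => σ l = j).card : ℕ) : ℝ≥0∞)
      = ∑ e : Fin k ↪ Fin m, {x : Fin k → ℂ | ∀ l, x l ∈ B (σ l)}.indicator 1 (z ∘ e) := by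
  rw [← card_embedding_respect (fun j => Finset.univ.filter fun i => z i ∈ B j) ?_ σ,
    Fintype.card_subtype, Finset.card_filter]
  · push_cast
    refine Finset.sum_congr rfl fun e _ => ?_
    simp [Set.indicator]
  · intro i j hij
    rw [Finset.disjoint_left]
    intro a ha ha'
    simp only [Finset.mem_filter, Finset.mem_univ, true_and] at ha ha'
    exact Set.disjoint_left.1 (hB hij) ha ha'

/-- Completes an injective choice of k labels to a relabelling of all points, so that the chosen
ones become the first block. -/
lemma exists_equiv_inl {k l : ℕ} (e : Fin k ↪ Fin (k + l)) :
    ∃ π : Fin k ⊕ Fin l ≃ Fin (k + l), ∀ i, π (Sum.inl i) = e i := by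
  classical
  have hc : Fintype.card ((Set.range e)ᶜ : Set (Fin (k + l))) = l := by
    rw [Fintype.card_compl_set, Fintype.card_fin, Set.card_range_of_injective e.injective,
      Fintype.card_fin]
    omega
  let e1 : Fin k ≃ Set.range e := Equiv.ofInjective e e.injective
  let e2 : Fin l ≃ ((Set.range e)ᶜ : Set (Fin (k + l))) := (Fintype.equivFinOfCardEq hc).symm
  exact ⟨(Equiv.sumCongr e1 e2).trans (Equiv.Set.sumCompl _), fun i => rfl⟩

open Classical in
/-- Factorial moments of the counts of points with a symmetric density. -/
lemma lintegral_mul_prod_descFactorial {μ : Measure ℂ} [SigmaFinite μ] {k l M : ℕ}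
    {B : Fin M → Set ℂ} (hm : ∀ j, MeasurableSet (B j))
    (hB : Pairwise fun i j => Disjoint (B i) (B j)) (σ : Fin k → Fin M)
    {f : (Fin (k + l) → ℂ) → ℝ≥0∞} (hf : Measurable f)
    (hs : ∀ (π : Equiv.Perm (Fin (k + l))) z, f (z ∘ π) = f z) :
    ∫⁻ z, f z * ((∏ j, ((Finset.univ.filter fun i => z i ∈ B j).card).descFactorial
        (Finset.univ.filter fun l => σ l = j).card : ℕ) : ℝ≥0∞) ∂powMeasure μ (Fin (k + l))
      = (k + l).descFactorial k * ∫⁻ x in {x | ∀ i, x i ∈ B (σ i)},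
          ∫⁻ w, f (Sum.elim x w ∘ finSumFinEquiv.symm) ∂powMeasure μ (Fin l)
            ∂powMeasure μ (Fin k) := by
  set Bx := {x : Fin k → ℂ | ∀ i, x i ∈ B (σ i)} with hBx
  have hBm : MeasurableSet Bx := by
    have : Bx = Set.univ.pi fun i => B (σ i) := by ext; simp [hBx]
    rw [this]
    exact MeasurableSet.univ_pi fun i => hm _
  have hcomp : ∀ e : Fin k ↪ Fin (k + l), Measurable fun z : Fin (k + l) → ℂ => z ∘ e :=
    fun e => measurable_pi_lambda _ fun i => measurable_pi_apply (e i)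
  have hind : ∀ e : Fin k ↪ Fin (k + l),
      Measurable fun z : Fin (k + l) → ℂ => Bx.indicator (1 : (Fin k → ℂ) → ℝ≥0∞) (z ∘ e) :=
    fun e => (measurable_one.indicator hBm).comp (hcomp e)
  simp only [prod_descFactorial_eq_sum hB, Finset.mul_sum]
  rw [lintegral_finsetSum (f := fun (e : Fin k ↪ Fin (k + l)) z => f z * Bx.indicator 1 (z ∘ e)) _
    fun e _ => hf.mul (hind e)]
  -- By the symmetry of f every choice of k distinct labels contributes the same integral: relabel
  -- so that the chosen points come first, and separate them from the other l.
  have hterm : ∀ e : Fin k ↪ Fin (k + l),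
      ∫⁻ z, f z * Bx.indicator 1 (z ∘ e) ∂powMeasure μ (Fin (k + l))
      = ∫⁻ x in Bx, ∫⁻ w, f (Sum.elim x w ∘ finSumFinEquiv.symm) ∂powMeasure μ (Fin l)
            ∂powMeasure μ (Fin k) := by
    intro e
    obtain ⟨π, hπ⟩ := exists_equiv_inl e
    have hre : Measurable fun y : Fin k ⊕ Fin l → ℂ => y ∘ π.symm :=
      measurable_pi_lambda _ fun i => measurable_pi_apply (π.symm i)
    rw [← lintegral_comp_equiv π.symm, lintegral_sum (f := fun y => f (y ∘ π.symm) *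
      Bx.indicator 1 ((y ∘ π.symm) ∘ e)) ((hf.mul (hind e)).comp hre), ← lintegral_indicator hBm]
    refine lintegral_congr fun x => ?_
    have h1 : ∀ w : Fin l → ℂ, (Sum.elim x w ∘ π.symm) ∘ e = x := by
      intro w
      funext i
      simp [← hπ i]
    have h2 : ∀ w : Fin l → ℂ, f (Sum.elim x w ∘ π.symm)
        = f (Sum.elim x w ∘ finSumFinEquiv.symm) := by
      intro w
      rw [← hs (π.symm.trans finSumFinEquiv) (Sum.elim x w ∘ finSumFinEquiv.symm)]
      congr 1
      funext i
      simp
    simp only [h1, h2]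
    by_cases hx : x ∈ Bx <;> simp [hx]
  rw [Finset.sum_congr rfl fun e _ => hterm e, Finset.sum_const, Finset.card_univ,
    Fintype.card_embedding_eq, Fintype.card_fin, Fintype.card_fin, nsmul_eq_mul]


/-! ### Janossy densities -/

/-- A measurable positive semidefinite kernel with a bounded diagonal. -/
structure IsBoundedKernel (K : ℂ → ℂ → ℂ) (C : ℝ) : Prop where
  pos : IsPosKernel K
  measurable : Measurable (Function.uncurry K)
  nonneg : 0 ≤ C
  norm_le : ∀ z, ‖K z z‖ ≤ C

/-- The integral of the correlation function over the last `q` points. -/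
noncomputable def corrIntegral (K : ℂ → ℂ → ℂ) (μ : Measure ℂ) {ι : Type} [Fintype ι]
    [DecidableEq ι] (z : ι → ℂ) (q : ℕ) : ℝ :=
  ∫ w, pdet K (Sum.elim z w) ∂powMeasure μ (Fin q)

/-- The Janossy densities, as an alternating series in the correlation functions. -/
noncomputable def janossy (K : ℂ → ℂ → ℂ) (μ : Measure ℂ) {ι : Type} [Fintype ι]
    [DecidableEq ι] (z : ι → ℂ) : ℝ :=
  ∑' q : ℕ, (-1 : ℝ) ^ q / q.factorial * corrIntegral K μ z q

section

variable {K : ℂ → ℂ → ℂ} {C : ℝ} {μ : Measure ℂ} [IsFiniteMeasure μ]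
  {ι κ : Type} [Fintype ι] [DecidableEq ι] [Fintype κ] [DecidableEq κ]

lemma pdet_sumElim_assoc {ι' : Type} [Fintype ι'] [DecidableEq ι'] (z : ι → ℂ) (x : κ → ℂ)
    (w : ι' → ℂ) :
    pdet K (Sum.elim (Sum.elim z x) w) = pdet K (Sum.elim z (Sum.elim x w)) := by
  rw [← pdet_comp_equiv K (Equiv.sumAssoc ι κ ι')]
  congr 1
  ext ((i | i) | i) <;> rfl

lemma pdet_sumElim_comp_left {ι' : Type} [Fintype ι'] [DecidableEq ι'] (e : ι' ≃ ι) (z : ι → ℂ)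
    (w : κ → ℂ) : pdet K (Sum.elim (z ∘ e) w) = pdet K (Sum.elim z w) := by
  rw [← pdet_comp_equiv K (Equiv.sumCongr e (Equiv.refl κ))]
  congr 1
  ext (i | i) <;> rfl

lemma pdet_sumElim_comp_right {ι' : Type} [Fintype ι'] [DecidableEq ι'] (e : ι' ≃ κ) (z : ι → ℂ)
    (w : κ → ℂ) : pdet K (Sum.elim z (w ∘ e)) = pdet K (Sum.elim z w) := by
  rw [← pdet_comp_equiv K (Equiv.sumCongr (Equiv.refl ι) e)]
  congr 1
  ext (i | i) <;> rfl

lemma measurable_sumElim_right (z : ι → ℂ) : Measurable fun w : κ → ℂ => Sum.elim z w :=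
  measurable_sumElim.comp (measurable_const.prodMk measurable_id)

lemma IsBoundedKernel.norm_pdet_le (hK : IsBoundedKernel K C) (z : ι → ℂ) :
    ‖pdet K z‖ ≤ C ^ Fintype.card ι := by
  rw [Real.norm_of_nonneg (hK.pos.pdet_nonneg z)]
  exact hK.pos.pdet_le_pow z fun i => hK.norm_le _

lemma IsBoundedKernel.integrable_pdet_sumElim (hK : IsBoundedKernel K C) (z : ι → ℂ) :
    Integrable (fun w : κ → ℂ => pdet K (Sum.elim z w)) (powMeasure μ κ) :=
  Integrable.of_bound ((measurable_pdet hK.measurable).comp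
    (measurable_sumElim_right z)).aestronglyMeasurable _
    (Eventually.of_forall fun _ => hK.norm_pdet_le _)

lemma IsBoundedKernel.corrIntegral_nonneg (hK : IsBoundedKernel K C) (z : ι → ℂ) (q : ℕ) :
    0 ≤ corrIntegral K μ z q := integral_nonneg fun _ => hK.pos.pdet_nonneg _

lemma powMeasure_real_univ : (powMeasure μ ι).real Set.univ = μ.real Set.univ ^ Fintype.card ι := by
  rw [powMeasure, measureReal_def, Measure.pi_univ, Finset.prod_const, ENNReal.toReal_pow]
  rfl

lemma IsBoundedKernel.corrIntegral_le (hK : IsBoundedKernel K C) (z : ι → ℂ) (q : ℕ) :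
    corrIntegral K μ z q ≤ C ^ Fintype.card ι * (C * μ.real Set.univ) ^ q := by
  have h := norm_integral_le_of_norm_le_const (μ := powMeasure μ (Fin q))
    (f := fun w => pdet K (Sum.elim z w)) (Eventually.of_forall fun w => hK.norm_pdet_le _)
  refine (Real.le_norm_self _).trans (h.trans (le_of_eq ?_))
  rw [powMeasure_real_univ, Fintype.card_sum, Fintype.card_fin]
  ring

lemma IsBoundedKernel.norm_janossy_term_le (hK : IsBoundedKernel K C) (z : ι → ℂ) (q : ℕ) :
    ‖(-1 : ℝ) ^ q / q.factorial * corrIntegral K μ z q‖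
      ≤ C ^ Fintype.card ι * ((C * μ.real Set.univ) ^ q / q.factorial) := by
  rw [norm_mul, norm_div, norm_pow, norm_neg, norm_one, one_pow,
    Real.norm_of_nonneg (hK.corrIntegral_nonneg z q), Real.norm_natCast]
  have := hK.corrIntegral_le (μ := μ) z q
  calc 1 / (q.factorial : ℝ) * corrIntegral K μ z q
      ≤ 1 / (q.factorial : ℝ) * (C ^ Fintype.card ι * (C * μ.real Set.univ) ^ q) := by gcongr
    _ = _ := by ring

lemma IsBoundedKernel.summable_janossy (hK : IsBoundedKernel K C) (z : ι → ℂ) :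
    Summable fun q : ℕ => (-1 : ℝ) ^ q / q.factorial * corrIntegral K μ z q :=
  Summable.of_norm_bounded ((Real.summable_pow_div_factorial _).mul_left _)
    fun q => hK.norm_janossy_term_le z q

lemma IsBoundedKernel.norm_janossy_le (hK : IsBoundedKernel K C) (z : ι → ℂ) :
    ‖janossy K μ z‖ ≤ C ^ Fintype.card ι * Real.exp (C * μ.real Set.univ) := by
  have h1 : HasSum (fun q : ℕ => C ^ Fintype.card ι * ((C * μ.real Set.univ) ^ q / q.factorial))
      (C ^ Fintype.card ι * Real.exp (C * μ.real Set.univ)) := by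
    refine HasSum.mul_left _ ?_
    rw [Real.exp_eq_exp_ℝ]
    exact NormedSpace.expSeries_div_hasSum_exp _
  exact tsum_of_norm_bounded h1 fun q => hK.norm_janossy_term_le z q

lemma IsBoundedKernel.measurable_corrIntegral (hK : IsBoundedKernel K C) (q : ℕ) :
    Measurable fun z : ι → ℂ => corrIntegral K μ z q := by
  have : StronglyMeasurable fun p : (ι → ℂ) × (Fin q → ℂ) => pdet K (Sum.elim p.1 p.2) :=
    ((measurable_pdet hK.measurable).comp measurable_sumElim).stronglyMeasurable
  exact (this.integral_prod_right (ν := powMeasure μ (Fin q))).measurable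

lemma IsBoundedKernel.measurable_janossy (hK : IsBoundedKernel K C) :
    Measurable fun z : ι → ℂ => janossy K μ z := by
  refine measurable_of_tendsto_metrizable (f := fun (N : ℕ) (z : ι → ℂ) => ∑ q ∈ Finset.range N,
    (-1 : ℝ) ^ q / q.factorial * corrIntegral K μ z q) (fun N => ?_) ?_
  · exact Finset.measurable_sum _ fun q _ => (hK.measurable_corrIntegral q).const_mul _
  · rw [tendsto_pi_nhds]
    intro z
    exact (hK.summable_janossy z).hasSum.tendsto_sum_nat

lemma corrIntegral_comp_equiv (e : κ ≃ ι) (z : ι → ℂ) (q : ℕ) :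
    corrIntegral K μ (z ∘ e) q = corrIntegral K μ z q := by
  simp only [corrIntegral, pdet_sumElim_comp_left]

lemma janossy_comp_equiv (e : κ ≃ ι) (z : ι → ℂ) :
    janossy K μ (z ∘ e) = janossy K μ z := by
  simp only [janossy, corrIntegral_comp_equiv]

lemma corrIntegral_zero (z : ι → ℂ) : corrIntegral K μ z 0 = pdet K z := by
  have h : ∀ w : Fin 0 → ℂ, pdet K (Sum.elim z w) = pdet K z := by
    intro w
    rw [← pdet_comp_equiv K (Equiv.sumEmpty ι (Fin 0)) z]
    congr 1
    ext (i | i)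
    · rfl
    · exact i.elim0
  simp only [corrIntegral, h]
  rw [integral_const, powMeasure_real_univ]
  simp

/-- Integration of the correlation integrals over further points. -/
lemma IsBoundedKernel.integral_corrIntegral (hK : IsBoundedKernel K C) (z : ι → ℂ) (l q : ℕ) :
    ∫ w, corrIntegral K μ (Sum.elim z w) q ∂powMeasure μ (Fin l) = corrIntegral K μ z (l + q) := by
  have h1 : corrIntegral K μ z (l + q)
      = ∫ y : Fin l ⊕ Fin q → ℂ, pdet K (Sum.elim z y) ∂powMeasure μ _ := by
    rw [← integral_comp_equiv finSumFinEquiv]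
    simp only [pdet_sumElim_comp_right, corrIntegral]
  rw [h1, integral_sum (hK.integrable_pdet_sumElim z)]
  simp only [corrIntegral, pdet_sumElim_assoc]

lemma IsBoundedKernel.integrable_corrIntegral (hK : IsBoundedKernel K C) (z : ι → ℂ) (q : ℕ) :
    Integrable (fun w : κ → ℂ => corrIntegral K μ (Sum.elim z w) q) (powMeasure μ κ) := by
  refine Integrable.of_bound ((hK.measurable_corrIntegral q).comp
    (measurable_sumElim_right z)).aestronglyMeasurable
    (C ^ Fintype.card (ι ⊕ κ) * (C * μ.real Set.univ) ^ q) (Eventually.of_forall fun w => ?_)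
  rw [Real.norm_of_nonneg (hK.corrIntegral_nonneg _ q)]
  exact hK.corrIntegral_le _ q

/-- Integrating l further points termwise shifts the index of the correlation integrals by l; the
exponential series dominates. -/
lemma IsBoundedKernel.hasSum_integral_janossy (hK : IsBoundedKernel K C) (z : ι → ℂ) (l : ℕ) :
    HasSum (fun q : ℕ => (-1 : ℝ) ^ q / q.factorial * corrIntegral K μ z (l + q))
      (∫ w, janossy K μ (Sum.elim z w) ∂powMeasure μ (Fin l)) := by
  have h := hasSum_integral_of_summable_integral_norm (μ := powMeasure μ (Fin l))
    (F := fun (q : ℕ) w => (-1 : ℝ) ^ q / q.factorial * corrIntegral K μ (Sum.elim z w) q)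
    (fun q => (hK.integrable_corrIntegral z q).const_mul _) ?_
  · simp only [integral_const_mul, hK.integral_corrIntegral] at h
    exact h
  · have h2 : ∀ (q : ℕ) (w : Fin l → ℂ),
        ‖(-1 : ℝ) ^ q / q.factorial * corrIntegral K μ (Sum.elim z w) q‖
          = 1 / (q.factorial : ℝ) * corrIntegral K μ (Sum.elim z w) q := by
      intro q w
      rw [norm_mul, norm_div, norm_pow, norm_neg, norm_one, one_pow,
        Real.norm_of_nonneg (hK.corrIntegral_nonneg _ q), Real.norm_natCast]
    simp only [h2, integral_const_mul, hK.integral_corrIntegral]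
    refine Summable.of_nonneg_of_le (fun q => mul_nonneg (by positivity)
      (hK.corrIntegral_nonneg z _)) (fun q => ?_)
      ((Real.summable_pow_div_factorial (C * μ.real Set.univ)).mul_left
        (C ^ Fintype.card ι * (C * μ.real Set.univ) ^ l))
    calc 1 / (q.factorial : ℝ) * corrIntegral K μ z (l + q)
        ≤ 1 / (q.factorial : ℝ) * (C ^ Fintype.card ι * (C * μ.real Set.univ) ^ (l + q)) := by
          gcongr
          exact hK.corrIntegral_le z _
      _ = _ := by rw [pow_add]; ring

/-- On the diagonal l + q = s the coefficients are those of (1-1)^s / s!, so only s = 0 survives. -/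
lemma sum_antidiagonal_alternating (I : ℕ → ℝ) (s : ℕ) :
    ∑ p ∈ Finset.HasAntidiagonal.antidiagonal s, 1 / (p.1.factorial : ℝ) *
      ((-1 : ℝ) ^ p.2 / p.2.factorial * I (p.1 + p.2)) = if s = 0 then I 0 else 0 := by
  have h : ∀ p ∈ Finset.HasAntidiagonal.antidiagonal s, 1 / (p.1.factorial : ℝ) *
      ((-1 : ℝ) ^ p.2 / p.2.factorial * I (p.1 + p.2))
      = I s / s.factorial * (s.choose p.1 • ((1 : ℝ) ^ p.1 * (-1) ^ p.2)) := by
    intro p hp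
    rw [Finset.HasAntidiagonal.mem_antidiagonal] at hp
    have h1 := Nat.add_choose_mul_factorial_mul_factorial p.1 p.2
    rw [hp, Nat.choose_symm_of_eq_add (by omega : s = p.2 + p.1)] at h1
    have h2 : (s.choose p.1 : ℝ) * p.1.factorial * p.2.factorial = s.factorial := by
      exact_mod_cast h1
    have := Nat.factorial_ne_zero s
    have := Nat.factorial_ne_zero p.1
    have := Nat.factorial_ne_zero p.2
    rw [hp, nsmul_eq_mul, ← h2]
    have : (s.choose p.1 : ℝ) ≠ 0 := by
      intro h0
      rw [h0] at h2
      simp only [zero_mul] at h2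
      exact Nat.factorial_ne_zero s (by exact_mod_cast h2.symm)
    field_simp
    simp
  rw [Finset.sum_congr rfl h, ← Finset.mul_sum, ← (Commute.all (1 : ℝ) (-1)).add_pow' s]
  split_ifs with hs
  · simp [hs]
  · simp [hs]

/-- Absolute convergence, with the square of an exponential series as majorant: it allows the double
series to be summed along rows or along diagonals. -/
lemma summable_alternating {I : ℕ → ℝ} {A x : ℝ} (hx : 0 ≤ x) (h0 : ∀ s, 0 ≤ I s)
    (h : ∀ s, I s ≤ A * x ^ s) :
    Summable fun p : ℕ × ℕ => 1 / (p.1.factorial : ℝ) *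
      ((-1 : ℝ) ^ p.2 / p.2.factorial * I (p.1 + p.2)) := by
  have hexp := Real.summable_pow_div_factorial x
  have hnn : 0 ≤ fun n : ℕ => x ^ n / (n.factorial : ℝ) := fun n => by
    simp only [Pi.zero_apply]
    positivity
  have h1 := (hexp.mul_of_nonneg hexp hnn hnn).mul_left A
  refine h1.of_norm_bounded fun p => ?_
  have h2 : ‖1 / (p.1.factorial : ℝ) * ((-1 : ℝ) ^ p.2 / p.2.factorial * I (p.1 + p.2))‖
      = 1 / (p.1.factorial : ℝ) * (1 / p.2.factorial * I (p.1 + p.2)) := by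
    rw [norm_mul, norm_mul, norm_div, norm_div, norm_pow, norm_neg, norm_one, one_pow,
      Real.norm_of_nonneg (h0 _), Real.norm_natCast, Real.norm_natCast]
  rw [h2]
  calc 1 / (p.1.factorial : ℝ) * (1 / p.2.factorial * I (p.1 + p.2))
      ≤ 1 / (p.1.factorial : ℝ) * (1 / p.2.factorial * (A * x ^ (p.1 + p.2))) := by
        gcongr
        exact h _
    _ = _ := by rw [pow_add]; ring

/-- The correlation functions are recovered from the Janossy densities. -/
lemma IsBoundedKernel.hasSum_janossy (hK : IsBoundedKernel K C) (z : ι → ℂ) :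
    HasSum (fun l : ℕ => 1 / (l.factorial : ℝ) *
      ∫ w, janossy K μ (Sum.elim z w) ∂powMeasure μ (Fin l)) (pdet K z) := by
  set I := fun s => corrIntegral K μ z s with hI
  set a : ℕ × ℕ → ℝ := fun p => 1 / (p.1.factorial : ℝ) *
      ((-1 : ℝ) ^ p.2 / p.2.factorial * I (p.1 + p.2)) with ha
  have hsum : Summable a := summable_alternating (mul_nonneg hK.nonneg measureReal_nonneg)
    (fun s => hK.corrIntegral_nonneg z s) (fun s => hK.corrIntegral_le z s)
  have h1 : HasSum (fun l : ℕ => 1 / (l.factorial : ℝ) *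
      ∫ w, janossy K μ (Sum.elim z w) ∂powMeasure μ (Fin l)) (∑' p, a p) :=
    hsum.hasSum.prod_fiberwise fun l => (hK.hasSum_integral_janossy z l).mul_left _
  -- The same double series regrouped by s = l + q; comparing the two sums inverts the definition of
  -- `janossy`.
  have h2 : HasSum (fun s : ℕ => ∑ p ∈ Finset.HasAntidiagonal.antidiagonal s, a p) (∑' p, a p) := by
    have := (Finset.HasAntidiagonal.sigmaAntidiagonalEquivProd (A := ℕ)).hasSum_iff.2 hsum.hasSum
    have h3 : ∀ s : ℕ, HasSum (fun p : Finset.HasAntidiagonal.antidiagonal s =>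
        (a ∘ Finset.HasAntidiagonal.sigmaAntidiagonalEquivProd) ⟨s, p⟩)
        (∑ p ∈ Finset.HasAntidiagonal.antidiagonal s, a p) :=
      fun s => Finset.hasSum (Finset.HasAntidiagonal.antidiagonal s) a
    exact this.sigma h3
  have h3 : HasSum (fun s : ℕ => ∑ p ∈ Finset.HasAntidiagonal.antidiagonal s, a p) (I 0) := by
    simp only [ha, sum_antidiagonal_alternating]
    exact hasSum_ite_eq 0 (I 0)
  rw [h2.unique h3, hI] at h1
  simpa only [corrIntegral_zero] using h1

end


/-! ### Finite point processes with given Janossy densities -/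

/-- Extension of a finite list of points by zeros, together with its length. -/
noncomputable def toSeq (m : ℕ) (z : Fin m → ℂ) : ℕ × (ℕ → ℂ) :=
  (m, fun i => if h : i < m then z ⟨i, h⟩ else 0)

lemma measurable_toSeq (m : ℕ) : Measurable (toSeq m) := by
  refine measurable_const.prodMk (measurable_pi_lambda _ fun i => ?_)
  by_cases h : i < m
  · simp only [h, dite_true]
    exact measurable_pi_apply _
  · simp only [h, dite_false]
    exact measurable_const

open Classical in
lemma counts_ofSeq_toSeq {M m : ℕ} (B : Fin M → Set ℂ) (z : Fin m → ℂ) (j : Fin M) :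
    counts B (Configuration.ofSeq (toSeq m z)) j
      = (Finset.univ.filter fun i => z i ∈ B j).card := by
  rw [counts, Configuration.count_ofSeq, ENat.toNat_natCast]
  refine (Finset.card_bij (fun (i : Fin m) _ => (i : ℕ)) ?_ ?_ ?_).symm
  · intro i hi
    rw [Finset.mem_filter] at hi ⊢
    exact ⟨Finset.mem_range.2 i.2, by simpa [toSeq] using hi.2⟩
  · intro i _ i' _ h
    exact Fin.ext h
  · intro i hi
    rw [Finset.mem_filter] at hi
    have hi1 : i < m := Finset.mem_range.1 hi.1
    refine ⟨⟨i, hi1⟩, ?_, rfl⟩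
    rw [Finset.mem_filter]
    exact ⟨Finset.mem_univ _, by simpa [toSeq, hi1] using hi.2⟩

/-- The law of a finite list of points with the given Janossy densities. -/
noncomputable def listLaw (K : ℂ → ℂ → ℂ) (μ : Measure ℂ) : Measure (ℕ × (ℕ → ℂ)) :=
  Measure.sum fun m => ((powMeasure μ (Fin m)).withDensity fun z =>
    ENNReal.ofReal (janossy K μ z / m.factorial)).map (toSeq m)

section

variable {K : ℂ → ℂ → ℂ} {C : ℝ} {μ : Measure ℂ} [IsFiniteMeasure μ]

lemma lintegral_listLaw (hK : IsBoundedKernel K C) {f : ℕ × (ℕ → ℂ) → ℝ≥0∞} (hf : Measurable f) :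
    ∫⁻ p, f p ∂listLaw K μ = ∑' m : ℕ, ∫⁻ z : Fin m → ℂ,
      ENNReal.ofReal (janossy K μ z / m.factorial) * f (toSeq m z) ∂powMeasure μ (Fin m) := by
  rw [listLaw, lintegral_sum_measure]
  refine tsum_congr fun m => ?_
  rw [lintegral_map hf (measurable_toSeq m)]
  exact lintegral_withDensity_eq_lintegral_mul _
    ((hK.measurable_janossy.div_const _).ennreal_ofReal) (hf.comp (measurable_toSeq m))

/-- The fibre sizes of a map between finite types. -/
def fiberCard {k M : ℕ} (σ : Fin k → Fin M) (j : Fin M) : ℕ :=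
  (Finset.univ.filter fun i => σ i = j).card

lemma sum_fiberCard {k M : ℕ} (σ : Fin k → Fin M) : ∑ j, fiberCard σ j = k := by
  have := Finset.card_eq_sum_card_fiberwise (s := Finset.univ) (t := Finset.univ) (f := σ)
    (fun i _ => Finset.mem_univ _)
  simpa [fiberCard] using this.symm

open Classical in
-- The contribution of configurations with exactly k + l points. The number (k+l)!/l! of choices of
-- k labels turns the weight 1/(k+l)! into 1/l!.
lemma lintegral_janossy_mul_prod (hK : IsBoundedKernel K C)
    (hJ : ∀ (m : ℕ) (z : Fin m → ℂ), 0 ≤ janossy K μ z) {k M : ℕ} {B : Fin M → Set ℂ}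
    (hm : ∀ j, MeasurableSet (B j))
    (hB : Pairwise fun i j => Disjoint (B i) (B j)) (σ : Fin k → Fin M) (l : ℕ) :
    ∫⁻ z : Fin (k + l) → ℂ, ENNReal.ofReal (janossy K μ z / (k + l).factorial) *
        ((∏ j, ((Finset.univ.filter fun i => z i ∈ B j).card).descFactorial
          (Finset.univ.filter fun l => σ l = j).card : ℕ) : ℝ≥0∞) ∂powMeasure μ (Fin (k + l))
      = ∫⁻ x in {x | ∀ i, x i ∈ B (σ i)}, ENNReal.ofReal (1 / l.factorial *
          ∫ w, janossy K μ (Sum.elim x w) ∂powMeasure μ (Fin l)) ∂powMeasure μ (Fin k) := by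
  rw [lintegral_mul_prod_descFactorial hm hB σ
    ((hK.measurable_janossy.div_const _).ennreal_ofReal)
    (fun π z => by rw [janossy_comp_equiv]), ← lintegral_const_mul']
  · refine lintegral_congr fun x => ?_
    simp only [janossy_comp_equiv]
    have hnn : ∀ w : Fin l → ℂ, 0 ≤ janossy K μ (Sum.elim x w) := by
      intro w
      rw [← janossy_comp_equiv finSumFinEquiv.symm]
      exact hJ _ _
    have hmJ : Measurable fun w : Fin l → ℂ => janossy K μ (Sum.elim x w) :=
      hK.measurable_janossy.comp (measurable_sumElim_right x)
    rw [← ofReal_integral_eq_lintegral_ofReal, integral_div, ← ENNReal.ofReal_natCast,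
      ← ENNReal.ofReal_mul (by positivity)]
    · congr 1
      have h1 : (k + l).factorial = l.factorial * (k + l).descFactorial k := by
        have := Nat.factorial_mul_descFactorial (Nat.le_add_right k l)
        rw [Nat.add_sub_cancel_left] at this
        exact this.symm
      have h2 : (l.factorial : ℝ) ≠ 0 := by exact_mod_cast l.factorial_ne_zero
      have h3 : ((k + l).descFactorial k : ℝ) ≠ 0 := by
        intro h0
        have : (k + l).factorial = 0 := by
          rw [h1, (by exact_mod_cast h0 : (k + l).descFactorial k = 0), mul_zero]
        exact Nat.factorial_ne_zero _ this
      rw [h1]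
      push_cast
      field_simp
    · refine Integrable.of_bound (hmJ.div_const _).aestronglyMeasurable
        (C ^ Fintype.card (Fin k ⊕ Fin l) * Real.exp (C * μ.real Set.univ) / (k + l).factorial)
        (Eventually.of_forall fun w => ?_)
      rw [norm_div, Real.norm_natCast]
      gcongr
      exact hK.norm_janossy_le _
    · exact Eventually.of_forall fun w => div_nonneg (hnn w) (by positivity)
  · exact ENNReal.natCast_ne_top _

lemma tsum_eq_tsum_nat_add {k : ℕ} (a : ℕ → ℝ≥0∞) (h : ∀ m ∈ Finset.range k, a m = 0) :
    ∑' m, a m = ∑' l, a (l + k) := by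
  have h1 := ENNReal.summable.sum_add_tsum_nat_add' (f := a) (k := k)
  rw [Finset.sum_eq_zero h, zero_add] at h1
  exact h1.symm

open Classical in
/-- The factorial moments of the process with law `listLaw`. -/
lemma lintegral_listLaw_descProd (hK : IsBoundedKernel K C)
    (hJ : ∀ (m : ℕ) (z : Fin m → ℂ), 0 ≤ janossy K μ z) {k M : ℕ} {B : Fin M → Set ℂ}
    (hm : ∀ j, MeasurableSet (B j)) (hb : ∀ j, Bornology.IsBounded (B j))
    (hB : Pairwise fun i j => Disjoint (B i) (B j)) (σ : Fin k → Fin M) :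
    ∫⁻ p, (descProd (fiberCard σ) (counts B (Configuration.ofSeq p)) : ℝ≥0∞) ∂listLaw K μ
      = ∫⁻ x in {x | ∀ i, x i ∈ B (σ i)}, ENNReal.ofReal (pdet K x) ∂powMeasure μ (Fin k) := by
  have hmeas : Measurable fun p : ℕ × (ℕ → ℂ) =>
      (descProd (fiberCard σ) (counts B (Configuration.ofSeq p)) : ℝ≥0∞) :=
    (measurable_of_countable fun x => (descProd (fiberCard σ) x : ℝ≥0∞)).comp
      ((measurable_counts hm hb).comp Configuration.measurable_ofSeq)
  rw [lintegral_listLaw hK hmeas]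
  have hdesc : ∀ (m : ℕ) (z : Fin m → ℂ),
      descProd (fiberCard σ) (counts B (Configuration.ofSeq (toSeq m z)))
        = ∏ j, ((Finset.univ.filter fun i => z i ∈ B j).card).descFactorial
          (Finset.univ.filter fun l => σ l = j).card := by
    intro m z
    simp only [descProd, counts_ofSeq_toSeq, fiberCard]
  simp only [hdesc]
  -- With fewer than k points there are no k distinct labels to choose, so the sum over m starts at
  -- k and is reindexed by l = m - k.
  have hsmall : ∀ m ∈ Finset.range k, ∫⁻ z : Fin m → ℂ,
      ENNReal.ofReal (janossy K μ z / m.factorial) *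
        ((∏ j, ((Finset.univ.filter fun i => z i ∈ B j).card).descFactorial
          (Finset.univ.filter fun l => σ l = j).card : ℕ) : ℝ≥0∞) ∂powMeasure μ (Fin m) = 0 := by
    intro m hmk
    rw [Finset.mem_range] at hmk
    refine (lintegral_congr fun z => ?_).trans lintegral_zero
    rw [prod_descFactorial_eq_sum hB]
    have : IsEmpty (Fin k ↪ Fin m) := by
      refine ⟨fun e => ?_⟩
      have := Fintype.card_le_of_embedding e
      simp only [Fintype.card_fin] at this
      omega
    simp
  have hterm : ∀ l : ℕ, ∫⁻ z : Fin (l + k) → ℂ,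
        ENNReal.ofReal (janossy K μ z / (l + k).factorial) *
          ((∏ j, ((Finset.univ.filter fun i => z i ∈ B j).card).descFactorial
          (Finset.univ.filter fun l => σ l = j).card : ℕ) : ℝ≥0∞) ∂powMeasure μ (Fin (l + k))
        = ∫⁻ x in {x | ∀ i, x i ∈ B (σ i)}, ENNReal.ofReal (1 / l.factorial *
          ∫ w, janossy K μ (Sum.elim x w) ∂powMeasure μ (Fin l)) ∂powMeasure μ (Fin k) := by
    intro l
    rw [add_comm l k]
    exact lintegral_janossy_mul_prod hK hJ hm hB σ l
  rw [tsum_eq_tsum_nat_add _ hsmall, tsum_congr hterm, ← lintegral_tsum]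
  · refine lintegral_congr fun x => ?_
    rw [← (hK.hasSum_janossy (μ := μ) x).tsum_eq, ENNReal.ofReal_tsum_of_nonneg]
    · intro l
      refine mul_nonneg (by positivity) (integral_nonneg fun w => ?_)
      simp only [Pi.zero_apply]
      rw [← janossy_comp_equiv finSumFinEquiv.symm]
      exact hJ _ _
    · exact (hK.hasSum_janossy (μ := μ) x).summable
  · intro l
    refine Measurable.aemeasurable ?_
    refine (Measurable.const_mul ?_ _).ennreal_ofReal
    have : StronglyMeasurable fun p : (Fin k → ℂ) × (Fin l → ℂ) =>
        janossy K μ (Sum.elim p.1 p.2) :=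
      (hK.measurable_janossy.comp measurable_sumElim).stronglyMeasurable
    exact (this.integral_prod_right (ν := powMeasure μ (Fin l))).measurable

/-- The total mass is the factorial moment of order zero, and the empty determinant is 1. -/
lemma isProbabilityMeasure_listLaw (hK : IsBoundedKernel K C)
    (hJ : ∀ (m : ℕ) (z : Fin m → ℂ), 0 ≤ janossy K μ z) :
    IsProbabilityMeasure (listLaw K μ) := by
  have h := lintegral_listLaw_descProd (μ := μ) hK hJ (k := 0) (M := 0) (B := fun _ => ∅)
    (fun j => j.elim0) (fun j => j.elim0) (fun j => j.elim0) (fun i => i.elim0)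
  refine ⟨?_⟩
  have h1 : {x : Fin 0 → ℂ | ∀ i : Fin 0, x i ∈ (fun _ : Fin 0 => (∅ : Set ℂ)) (i.elim0)}
      = Set.univ := by
    ext x
    simp
  simp only [descProd, Finset.univ_eq_empty, Finset.prod_empty, Nat.cast_one, lintegral_const,
    one_mul, pdet_of_isEmpty, ENNReal.ofReal_one, Measure.restrict_apply_univ] at h
  rw [h]
  have h2 : {x : Fin 0 → ℂ | ∀ i : Fin 0, x i ∈ (∅ : Set ℂ)} = Set.univ := by
    ext x
    simp
  rw [h2, powMeasure, Measure.pi_univ]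
  simp

end


/-! ### Positivity of the Janossy densities -/

section

variable {n : ℕ} {φ : Fin n → ℂ → ℂ} {C : ℝ} {μ : Measure ℂ} [SigmaFinite μ]
  {B : Set ℂ} {ι : Type} [Fintype ι] [DecidableEq ι]

/-- A new point integrated against ν itself merely joins those already integrated. -/
lemma IsBoundedKernel.setIntegral_corrIntegral_sumElim {K : ℂ → ℂ → ℂ} {ν : Measure ℂ}
    [IsFiniteMeasure ν] (hK : IsBoundedKernel K C) (z : ι → ℂ) (q : ℕ) :
    Integrable (fun x => corrIntegral K ν (Sum.elim z fun _ : Unit => x) q) ν ∧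
    ∫ x, corrIntegral K ν (Sum.elim z fun _ : Unit => x) q ∂ν = corrIntegral K ν z (q + 1) := by
  have hm : Measurable fun w : Unit → ℂ => corrIntegral K ν (Sum.elim z w) q :=
    (hK.measurable_corrIntegral q).comp (measurable_sumElim_right z)
  have hc : Measurable fun x : ℂ => (fun _ : Unit => x) := measurable_pi_lambda _ fun _ => measurable_id
  constructor
  · refine Integrable.of_bound (hm.comp hc).aestronglyMeasurable
      (C ^ Fintype.card (ι ⊕ Unit) * (C * ν.real Set.univ) ^ q) (Eventually.of_forall fun w => ?_)
    rw [Real.norm_of_nonneg (hK.corrIntegral_nonneg _ q)]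
    exact hK.corrIntegral_le _ q
  · rw [← integral_unique_pi (κ := Unit) (μ := ν) hm, add_comm q 1, ← hK.integral_corrIntegral z 1 q,
      ← integral_comp_equiv (μ := ν) (Equiv.ofUnique (Fin 1) Unit)]
    refine integral_congr_ae (Eventually.of_forall fun w => ?_)
    simp only
    rw [← corrIntegral_comp_equiv (Equiv.sumCongr (Equiv.refl ι) (Equiv.ofUnique (Fin 1) Unit))]
    congr 1
    ext (i | i) <;> rfl

/-- Gaudin's lemma under the integral over the q other points. Nonnegativity of the determinants
gives the integrability needed to exchange the two integrals. -/
lemma IsOrthonormalFamily.integral_corrIntegral_sumElim (h : IsOrthonormalFamily φ μ)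
    (hK : IsBoundedKernel (finKernel φ) C) {ν : Measure ℂ} [IsFiniteMeasure ν]
    (z : ι → ℂ) (q : ℕ) :
    Integrable (fun x => corrIntegral (finKernel φ) ν (Sum.elim z fun _ : Unit => x) q) μ ∧
    ∫ x, corrIntegral (finKernel φ) ν (Sum.elim z fun _ : Unit => x) q ∂μ
      = ((n : ℝ) - Fintype.card ι - q) * corrIntegral (finKernel φ) ν z q := by
  have hsym : ∀ (x : ℂ) (w : Fin q → ℂ),
      pdet (finKernel φ) (Sum.elim (Sum.elim z fun _ : Unit => x) w)
        = pdet (finKernel φ) (Sum.elim (Sum.elim z w) fun _ : Unit => x) := by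
    intro x w
    rw [pdet_sumElim_assoc, pdet_sumElim_assoc,
      ← pdet_sumElim_comp_right (Equiv.sumComm (Fin q) Unit)]
    congr 2
    ext (i | i) <;> rfl
  have hmeas : Measurable fun p : ℂ × (Fin q → ℂ) =>
      pdet (finKernel φ) (Sum.elim (Sum.elim z p.2) fun _ : Unit => p.1) := by
    refine (measurable_pdet hK.measurable).comp (measurable_pi_lambda _ ?_)
    rintro ((i | i) | i)
    · exact measurable_const
    · exact (measurable_pi_apply i).comp measurable_snd
    · exact measurable_fst
  have hg : ∀ w : Fin q → ℂ, ∫ x, pdet (finKernel φ) (Sum.elim (Sum.elim z w) fun _ : Unit => x) ∂μ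
      = ((n : ℝ) - Fintype.card ι - q) * pdet (finKernel φ) (Sum.elim z w) := by
    intro w
    rw [(h.integral_pdet_sumElim (Sum.elim z w)).2, Fintype.card_sum, Fintype.card_fin]
    push_cast
    ring
  have hint : Integrable (fun p : ℂ × (Fin q → ℂ) =>
      pdet (finKernel φ) (Sum.elim (Sum.elim z p.2) fun _ : Unit => p.1))
      (μ.prod (powMeasure ν (Fin q))) := by
    rw [integrable_prod_iff' hmeas.aestronglyMeasurable]
    refine ⟨Eventually.of_forall fun w => (h.integral_pdet_sumElim (Sum.elim z w)).1, ?_⟩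
    have e : ∀ w : Fin q → ℂ, ∫ x, ‖pdet (finKernel φ) (Sum.elim (Sum.elim z w) fun _ : Unit => x)‖ ∂μ
        = ((n : ℝ) - Fintype.card ι - q) * pdet (finKernel φ) (Sum.elim z w) := by
      intro w
      have hn : ∀ x : ℂ, ‖pdet (finKernel φ) (Sum.elim (Sum.elim z w) fun _ : Unit => x)‖
          = pdet (finKernel φ) (Sum.elim (Sum.elim z w) fun _ : Unit => x) := fun x =>
        Real.norm_of_nonneg (hK.pos.pdet_nonneg _)
      simp only [hn, hg w]
    simp only [e]
    exact (hK.integrable_pdet_sumElim z).const_mul _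
  simp only [corrIntegral, hsym]
  refine ⟨hint.integral_prod_left, ?_⟩
  rw [integral_integral_swap hint]
  simp only [hg]
  rw [integral_const_mul]

/-- The terms -q c(q) and -c(q+1) telescope against the factorials; only the boundary term at N is
left. -/
lemma sum_range_alternating_eq (c : ℕ → ℝ) (a : ℝ) (N : ℕ) :
    ∑ q ∈ Finset.range N, (-1 : ℝ) ^ q / q.factorial * ((a - q) * c q - c (q + 1))
      = a * ∑ q ∈ Finset.range N, (-1 : ℝ) ^ q / q.factorial * c q
        + (-1 : ℝ) ^ N / N.factorial * (N * c N) := by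
  induction N with
  | zero => simp
  | succ N ih =>
    rw [Finset.sum_range_succ, ih, Finset.sum_range_succ, Nat.factorial_succ]
    have := Nat.factorial_ne_zero N
    have : (N : ℝ) + 1 ≠ 0 := by positivity
    push_cast
    field_simp
    ring

lemma corrIntegral_finKernel_of_lt {ν : Measure ℂ} (z : ι → ℂ) {q : ℕ}
    (hq : n < Fintype.card ι + q) : corrIntegral (finKernel φ) ν z q = 0 := by
  have : ∀ w : Fin q → ℂ, pdet (finKernel φ) (Sum.elim z w) = 0 := fun w =>
    pdet_finKernel_of_lt φ _ (by simpa using hq)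
  simp [corrIntegral, this]

lemma janossy_finKernel {ν : Measure ℂ} (z : ι → ℂ) :
    janossy (finKernel φ) ν z = ∑ q ∈ Finset.range (n + 1), (-1 : ℝ) ^ q / q.factorial *
      corrIntegral (finKernel φ) ν z q := by
  refine tsum_eq_sum fun q hq => ?_
  rw [Finset.mem_range, not_lt] at hq
  rw [corrIntegral_finKernel_of_lt z (by omega), mul_zero]

/-- Heuristically the Janossy density weighs points at z and no other point in B. The remaining n -
card points then lie outside B, and any of them can be the one that is integrated out. -/
lemma IsOrthonormalFamily.setIntegral_compl_janossy (h : IsOrthonormalFamily φ μ)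
    (hK : IsBoundedKernel (finKernel φ) C) (hB : MeasurableSet B)
    [IsFiniteMeasure (μ.restrict B)] (z : ι → ℂ) :
    ∫ x in Bᶜ, janossy (finKernel φ) (μ.restrict B) (Sum.elim z fun _ : Unit => x) ∂μ
      = ((n : ℝ) - Fintype.card ι) * janossy (finKernel φ) (μ.restrict B) z := by
  set c := fun q => corrIntegral (finKernel φ) (μ.restrict B) z q with hc
  have h1 : ∀ q : ℕ, ∫ x in Bᶜ, corrIntegral (finKernel φ) (μ.restrict B)
      (Sum.elim z fun _ : Unit => x) q ∂μ = ((n : ℝ) - Fintype.card ι - q) * c q - c (q + 1) := by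
    intro q
    obtain ⟨hi, he⟩ := h.integral_corrIntegral_sumElim hK (ν := μ.restrict B) z q
    rw [setIntegral_compl hB hi, he, (hK.setIntegral_corrIntegral_sumElim z q).2]
  simp only [janossy_finKernel]
  rw [integral_finsetSum]
  · simp only [integral_const_mul, h1]
    rw [sum_range_alternating_eq, show c (n + 1) = 0 from
      corrIntegral_finKernel_of_lt z (by omega), mul_zero, mul_zero, add_zero]
  · exact fun q _ =>
      (h.integral_corrIntegral_sumElim hK (ν := μ.restrict B) z q).1.integrableOn.const_mul _

/-- The Janossy densities of a projection kernel are nonnegative. -/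
theorem IsOrthonormalFamily.janossy_nonneg (h : IsOrthonormalFamily φ μ)
    (hK : IsBoundedKernel (finKernel φ) C) (hB : MeasurableSet B)
    [IsFiniteMeasure (μ.restrict B)] (z : ι → ℂ) :
    0 ≤ janossy (finKernel φ) (μ.restrict B) z := by
  -- Downward induction on the number of points, d bounding how many are missing from n. With at
  -- least n points only the term q = 0 remains, a determinant; below n the recursion over the
  -- complement of B expresses the density by one with an extra point.
  obtain ⟨d, hd⟩ : ∃ d, n ≤ Fintype.card ι + d := ⟨n, by omega⟩
  induction d generalizing ι with
  | zero =>
    rw [janossy_finKernel, Finset.sum_eq_single 0]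
    · simpa using hK.corrIntegral_nonneg z 0
    · intro q _ hq
      rw [corrIntegral_finKernel_of_lt z (by omega), mul_zero]
    · simp
  | succ d ih =>
    by_cases hlt : n ≤ Fintype.card ι + d
    · exact ih z hlt
    · have h1 := h.setIntegral_compl_janossy hK hB z
      have h2 : 0 ≤ ∫ x in Bᶜ, janossy (finKernel φ) (μ.restrict B)
          (Sum.elim z fun _ : Unit => x) ∂μ :=
        integral_nonneg fun x => ih _ (by simp; omega)
      rw [h1] at h2
      refine nonneg_of_mul_nonneg_right h2 ?_
      have : ((Fintype.card ι : ℕ) : ℝ) < n := by exact_mod_cast (by omega)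
      linarith

end

/-! ### Janossy densities under limits of kernels. -/

section

variable {K : ℕ → ℂ → ℂ → ℂ} {L : ℂ → ℂ → ℂ} {ν : Measure ℂ} [IsFiniteMeasure ν]
  {ι : Type} [Fintype ι] [DecidableEq ι] {B : Set ℂ}

lemma tendsto_pdet (hlim : ∀ z w, Tendsto (fun n => K n z w) atTop (𝓝 (L z w))) (z : ι → ℂ) :
    Tendsto (fun n => pdet (K n) z) atTop (𝓝 (pdet L z)) := by
  have h1 : Tendsto (fun n => kernelMatrix (K n) z) atTop (𝓝 (kernelMatrix L z)) := by
    refine tendsto_pi_nhds.2 fun i => tendsto_pi_nhds.2 fun j => hlim _ _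
  have h2 : Continuous fun M : Matrix ι ι ℂ => M.det.re :=
    Complex.continuous_re.comp (Continuous.matrix_det continuous_id)
  exact (h2.tendsto _).comp h1

/-- Janossy densities depend continuously on the kernel. -/
lemma tendsto_janossy {C : ℝ} (hpos : ∀ n, IsPosKernel (K n))
    (hmeas : ∀ n, Measurable (Function.uncurry (K n)))
    (hlim : ∀ z w, Tendsto (fun n => K n z w) atTop (𝓝 (L z w)))
    (hCB : ∀ n, ∀ x ∈ B, ‖K n x x‖ ≤ C) (hν : ∀ᵐ x ∂ν, x ∈ B)
    (z : ι → ℂ) (hz : ∀ i, z i ∈ B) :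
    Tendsto (fun n => janossy (K n) ν z) atTop (𝓝 (janossy L ν z)) := by
  -- The kernels are uniformly bounded only on B, so the bounds on the determinants hold only almost
  -- everywhere for ν, which is carried by B.
  have hae : ∀ q, ∀ᵐ w ∂powMeasure ν (Fin q), ∀ i, w i ∈ B := by
    intro q
    rw [ae_all_iff]
    exact fun i => (Measure.quasiMeasurePreserving_eval (fun _ : Fin q => ν) i).ae hν
  have hb : ∀ n q, ∀ᵐ w ∂powMeasure ν (Fin q), ‖pdet (K n) (Sum.elim z w)‖
      ≤ C ^ Fintype.card (ι ⊕ Fin q) := by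
    intro n q
    filter_upwards [hae q] with w hw
    rw [Real.norm_of_nonneg ((hpos n).pdet_nonneg _)]
    refine (hpos n).pdet_le_pow _ ?_
    rintro (i | i)
    · exact hCB n _ (hz i)
    · exact hCB n _ (hw i)
  refine tendsto_tsum_of_dominated_convergence
    (bound := fun q : ℕ => C ^ Fintype.card ι * ((C * ν.real Set.univ) ^ q / q.factorial))
    ((Real.summable_pow_div_factorial _).mul_left _) (fun q => ?_)
    (Eventually.of_forall fun n q => ?_)
  · refine Tendsto.const_mul _ ?_
    refine tendsto_integral_of_dominated_convergence (fun _ => C ^ Fintype.card (ι ⊕ Fin q))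
      (fun n => ((measurable_pdet (hmeas n)).comp
        (measurable_sumElim_right z)).aestronglyMeasurable) ?_ (fun n => hb n q)
      (Eventually.of_forall fun w => tendsto_pdet hlim _)
    have : IsFiniteMeasure (powMeasure ν (Fin q)) := by unfold powMeasure; infer_instance
    exact integrable_const _
  · have h := norm_integral_le_of_norm_le_const (hb n q)
    rw [powMeasure_real_univ, Fintype.card_sum, Fintype.card_fin] at h
    rw [norm_mul, norm_div, norm_pow, norm_neg, norm_one, one_pow, Real.norm_natCast]
    calc 1 / (q.factorial : ℝ) * ‖corrIntegral (K n) ν z q‖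
        ≤ 1 / (q.factorial : ℝ) * (C ^ (Fintype.card ι + q) * ν.real Set.univ ^ q) := by
          gcongr
          exact h
      _ = _ := by rw [pow_add, mul_pow]; ring

end


/-! ### Gluing consistent laws -/

section

open ProbabilityTheory

/-- A transition that depends on the past only through f pushes forward to the same transition
started from the law of f. -/
lemma map_compProd_comap {α β γ : Type*} [MeasurableSpace α] [MeasurableSpace β]
    [MeasurableSpace γ] (μ : Measure α) [SFinite μ] (κ : Kernel β γ) [IsSFiniteKernel κ]
    {f : α → β} (hf : Measurable f) :
    (μ ⊗ₘ κ.comap f hf).map (fun p => (f p.1, p.2)) = μ.map f ⊗ₘ κ := by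
  have hm : Measurable fun p : α × γ => (f p.1, p.2) := by fun_prop
  ext s hs
  rw [Measure.map_apply hm hs, Measure.compProd_apply (hm hs), Measure.compProd_apply hs,
    lintegral_map (Kernel.measurable_kernel_prodMk_left hs) hf]
  rfl

lemma map_eval_zero_trajMeasure {X : ℕ → Type*} [∀ n, MeasurableSpace (X n)]
    (μ₀ : Measure (X 0)) [IsProbabilityMeasure μ₀]
    (κ : (n : ℕ) → Kernel (Π i : Finset.Iic n, X i) (X (n + 1))) [∀ n, IsMarkovKernel (κ n)] :
    (Kernel.trajMeasure μ₀ κ).map (fun x => x 0) = μ₀ := by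
  have h : (Kernel.trajMeasure μ₀ κ).map (Preorder.frestrictLe 0)
      = μ₀.map (MeasurableEquiv.piUnique (fun i : Finset.Iic 0 => X i)).symm := by
    rw [Kernel.trajMeasure, Measure.map_comp _ _ (by fun_prop), Kernel.traj_map_frestrictLe,
      Kernel.partialTraj_self, Measure.id_comp]
    rfl
  have h2 : (Kernel.trajMeasure μ₀ κ).map (fun x => x 0)
      = ((Kernel.trajMeasure μ₀ κ).map (Preorder.frestrictLe 0)).map
        (MeasurableEquiv.piUnique (fun i : Finset.Iic 0 => X i)) := by
    rw [Measure.map_map (by fun_prop) (by fun_prop)]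
    rfl
  rw [h2, h]
  exact MeasurableEquiv.map_map_symm (MeasurableEquiv.piUnique (fun i : Finset.Iic 0 => X i))

/-- Laws that are consistent along a sequence of factors are the marginals of a coupling in which
consecutive factors agree. -/
theorem exists_coupling {E α : Type*} [MeasurableSpace E] [StandardBorelSpace E] [Nonempty E]
    [MeasurableSpace α] (ν : ℕ → Measure E) [∀ r, IsProbabilityMeasure (ν r)] {f g : ℕ → E → α}
    (hf : ∀ r, Measurable (f r)) (hg : ∀ r, Measurable (g r))
    (h : ∀ r, (ν (r + 1)).map (g r) = (ν r).map (f r)) :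
    ∃ P : Measure (ℕ → E), IsProbabilityMeasure P ∧ (∀ r, P.map (fun x => x r) = ν r) ∧
      ∀ r, P.map (fun x => (f r (x r), x (r + 1))) = (ν (r + 1)).map fun y => (g r y, y) := by
  have hgm : ∀ r, Measurable fun y => (g r y, y) := fun r => (hg r).prodMk measurable_id
  let ρ : ℕ → Measure (α × E) := fun r => (ν (r + 1)).map fun y => (g r y, y)
  have hρ : ∀ r, IsProbabilityMeasure (ρ r) := fun r =>
    Measure.isProbabilityMeasure_map (hgm r).aemeasurable
  have hfr : ∀ r : ℕ, Measurable fun x : (Π _ : Finset.Iic r, E) => f r (x ⟨r, by simp⟩) :=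
    fun r => (hf r).comp (measurable_pi_apply (⟨r, by simp⟩ : Finset.Iic r))
  -- The coordinate r + 1 is drawn from the conditional law of y under ν (r+1) given that g y equals
  -- the f-image of the coordinate r. Consistency says that this conditioning value has the right
  -- law.
  let κ : (r : ℕ) → Kernel (Π _ : Finset.Iic r, E) E := fun r => (ρ r).condKernel.comap _ (hfr r)
  have hκ : ∀ r, IsMarkovKernel (κ r) := fun r => by infer_instance
  let P : Measure (ℕ → E) := Kernel.trajMeasure (X := fun _ => E) (ν 0) κ
  have hP : IsProbabilityMeasure P := by
    change IsProbabilityMeasure (Kernel.trajMeasure (X := fun _ => E) (ν 0) κ)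
    infer_instance
  have hfst : ∀ r, (ρ r).fst = (ν r).map (f r) := by
    intro r
    rw [← h r, Measure.fst, Measure.map_map measurable_fst (hgm r)]
    rfl
  -- Assumes the marginal at r, which in turn gives the marginal at r + 1; the induction is closed
  -- in `hmarg`.
  have hjoint : ∀ r, P.map (fun x => x r) = ν r →
      P.map (fun x => (f r (x r), x (r + 1))) = ρ r := by
    intro r hr
    have h1 : P.map (Preorder.frestrictLe r) ⊗ₘ κ r
        = P.map (fun x => (Preorder.frestrictLe r x, x (r + 1))) :=
      Kernel.map_frestrictLe_trajMeasure_compProd_eq_map_trajMeasure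
    have hm1 : Measurable fun p : (Π _ : Finset.Iic r, E) × E => (f r (p.1 ⟨r, by simp⟩), p.2) :=
      ((hfr r).comp measurable_fst).prodMk measurable_snd
    have hm3 : Measurable (Preorder.frestrictLe (π := fun _ : ℕ => E) r) := by fun_prop
    have hm2 : Measurable fun x : ℕ → E =>
        (Preorder.frestrictLe (π := fun _ : ℕ => E) r x, x (r + 1)) :=
      hm3.prodMk (measurable_pi_apply (r + 1))
    have h2 := map_compProd_comap (P.map (Preorder.frestrictLe r)) (ρ r).condKernel (hfr r)
    rw [show (P.map (Preorder.frestrictLe r)) ⊗ₘ ((ρ r).condKernel.comap _ (hfr r))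
      = P.map (fun x => (Preorder.frestrictLe r x, x (r + 1))) from h1,
      Measure.map_map hm1 hm2, Measure.map_map (hfr r) hm3] at h2
    have h3 : P.map ((fun x : (Π _ : Finset.Iic r, E) => f r (x ⟨r, by simp⟩)) ∘
        Preorder.frestrictLe r) = (ρ r).fst := by
      rw [hfst, ← hr, Measure.map_map (hf r) (by fun_prop)]
      rfl
    rw [h3, Measure.disintegrate] at h2
    exact h2
  have hmarg : ∀ r, P.map (fun x => x r) = ν r := by
    intro r
    induction r with
    | zero => exact map_eval_zero_trajMeasure (X := fun _ => E) (ν 0) κ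
    | succ r ih =>
      have h1 := congrArg (Measure.map Prod.snd) (hjoint r ih)
      have hm : Measurable fun x : ℕ → E => (f r (x r), x (r + 1)) :=
        Measurable.prodMk ((hf r).comp (measurable_pi_apply (X := fun _ : ℕ => E) r))
          (measurable_pi_apply (r + 1))
      rw [Measure.map_map measurable_snd hm, Measure.map_map measurable_snd (hgm r)] at h1
      exact h1.trans Measure.map_id
  exact ⟨P, hP, hmarg, fun r => hjoint r (hmarg r)⟩

end


/-! ### Existence of point fields -/

lemma lintegral_box_restrict {μ : Measure ℂ} [SigmaFinite μ] {D : Set ℂ}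
    {ι : Type} [Fintype ι] {A : ι → Set ℂ} (hA : ∀ i, MeasurableSet (A i)) (hAD : ∀ i, A i ⊆ D)
    (f : (ι → ℂ) → ℝ≥0∞) :
    ∫⁻ x in {x | ∀ i, x i ∈ A i}, f x ∂powMeasure (μ.restrict D) ι
      = ∫⁻ x in {x | ∀ i, x i ∈ A i}, f x ∂powMeasure μ ι := by
  have h1 : {x : ι → ℂ | ∀ i, x i ∈ A i} = Set.univ.pi A := by
    ext x
    simp
  rw [h1, powMeasure, powMeasure, ← Measure.restrict_pi_pi,
    Measure.restrict_restrict (MeasurableSet.univ_pi hA), ← Set.pi_inter_distrib]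
  congr 3
  ext1 i
  exact Set.inter_eq_left.2 (hAD i)

/-- The discs exhausting the plane. -/
def disc (r : ℕ) : Set ℂ := Metric.ball 0 (r + 1)

lemma measurableSet_disc (r : ℕ) : MeasurableSet (disc r) := Metric.isOpen_ball.measurableSet

lemma isBounded_disc (r : ℕ) : Bornology.IsBounded (disc r) := Metric.isBounded_ball

lemma disc_mono {r s : ℕ} (h : r ≤ s) : disc r ⊆ disc s :=
  Metric.ball_subset_ball (by gcongr)

instance isFiniteMeasure_restrict_disc (r : ℕ) : IsFiniteMeasure (lam.restrict (disc r)) :=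
  ⟨by rw [Measure.restrict_apply_univ]; exact lam_ball_lt_top _⟩

instance isLocallyFiniteMeasure_vol (k : ℕ) : IsLocallyFiniteMeasure (vol k) := by
  rw [vol_eq_pi]
  infer_instance

lemma mem_disc_floor (z : ℂ) : z ∈ disc ⌊‖z‖⌋₊ := by
  simpa [disc] using Nat.lt_floor_add_one ‖z‖

/-- The annulus of the points with a given integer part of the modulus. -/
def annulus (r : ℕ) : Set ℂ := {z | ⌊‖z‖⌋₊ = r}

lemma annulus_subset_disc (r : ℕ) : annulus r ⊆ disc r := by
  rintro z rfl
  exact mem_disc_floor z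

lemma measurableSet_annulus (r : ℕ) : MeasurableSet (annulus r) :=
  (Nat.measurable_floor.comp measurable_norm) (measurableSet_singleton r)

lemma biUnion_annulus_of_subset {B : Set ℂ} {R : ℕ} (h : B ⊆ disc R) :
    ⋃ r ∈ Finset.range (R + 1), B ∩ annulus r = B := by
  ext z
  simp only [Set.mem_iUnion, Finset.mem_range, Set.mem_inter_iff, exists_prop]
  refine ⟨fun ⟨r, _, hz, _⟩ => hz, fun hz => ⟨⌊‖z‖⌋₊, ?_, hz, rfl⟩⟩
  have h1 : ‖z‖ < R + 1 := by simpa [disc] using h hz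
  rw [Nat.floor_lt (norm_nonneg z)]
  exact_mod_cast h1

lemma pairwiseDisjoint_annulus (s : Set ℕ) (B : Set ℂ) :
    s.PairwiseDisjoint fun r => B ∩ annulus r := by
  intro r _ s _ hrs
  rw [Function.onFun, Set.disjoint_left]
  rintro z ⟨_, h1⟩ ⟨_, h2⟩
  exact hrs (h1.symm.trans h2)

lemma exists_subset_disc {B : Set ℂ} (hb : Bornology.IsBounded B) : ∃ R : ℕ, B ⊆ disc R := by
  obtain ⟨r, hr⟩ := hb.subset_ball 0
  obtain ⟨R, hR⟩ := exists_nat_gt r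
  exact ⟨R, hr.trans (Metric.ball_subset_ball (by linarith))⟩

/-! ### Gluing lists over annuli. -/

namespace Configuration

lemma count_congr {X Y : Configuration} {B : Set ℂ} (h : ∀ z ∈ B, X.mult z = Y.mult z) :
    X.count B = Y.count B := by
  rw [count_eq_encard, count_eq_encard]
  congr 1
  ext ⟨z, i⟩
  simp only [points, Set.mem_ofPred_eq]
  refine and_congr_right fun hz => ?_
  rw [h z hz]

/-- The configuration that agrees with the `r`-th of the given lists on the `r`-th annulus. -/
noncomputable def glue (x : ℕ → ℕ × (ℕ → ℂ)) : Configuration where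
  mult z := (ofSeq (x ⌊‖z‖⌋₊)).mult z
  locallyFinite S hS := by
    obtain ⟨R, hR⟩ := exists_subset_disc hS.isBounded
    refine ((Finset.range (R + 1)).finite_toSet.biUnion fun r _ =>
      (ofSeq (x r)).locallyFinite S hS).subset ?_
    rintro z ⟨hz, hm⟩
    have h1 : ‖z‖ < R + 1 := by simpa [disc] using hR hz
    simp only [Set.mem_iUnion]
    refine ⟨⌊‖z‖⌋₊, ?_, hz, hm⟩
    rw [Finset.mem_coe, Finset.mem_range, Nat.floor_lt (norm_nonneg z)]
    exact_mod_cast h1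

lemma count_glue (x : ℕ → ℕ × (ℕ → ℂ)) {B : Set ℂ} {R : ℕ} (h : B ⊆ disc R) :
    (glue x).count B = ∑ r ∈ Finset.range (R + 1), (ofSeq (x r)).count (B ∩ annulus r) := by
  conv_lhs => rw [← biUnion_annulus_of_subset h]
  rw [count_biUnion _ _ _ (pairwiseDisjoint_annulus _ B)]
  refine Finset.sum_congr rfl fun r _ => count_congr fun z hz => ?_
  have : ⌊‖z‖⌋₊ = r := hz.2
  simp [glue, this]

lemma measurable_glue : Measurable glue := by
  refine measurable_of_count fun B hB hb n => ?_
  obtain ⟨R, hR⟩ := exists_subset_disc hb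
  have hbr : ∀ r, Bornology.IsBounded (B ∩ annulus r) := fun r => hb.subset Set.inter_subset_left
  have h1 : {x | (glue x).count B = n} = {x : ℕ → ℕ × (ℕ → ℂ) | ∑ r ∈ Finset.range (R + 1),
      ((ofSeq (x r)).count (B ∩ annulus r)).toNat = n} := by
    ext x
    rw [Set.mem_ofPred_eq, Set.mem_ofPred_eq, count_glue x hR,
      Finset.sum_congr rfl fun r _ => (ENat.natCast_toNat ((ofSeq (x r)).count_ne_top (hbr r))).symm]
    exact_mod_cast Iff.rfl
  rw [h1]
  refine measurableSet_eq_fun (Finset.measurable_sum _ fun r _ => ?_) measurable_const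
  exact ((measurable_toNat_count (hB.inter (measurableSet_annulus r)) (hbr r)).comp
    measurable_ofSeq).comp (measurable_pi_apply r)

end Configuration

open HardEdgeGinibre.Configuration

/-! ### Consistency over discs and the glued field. -/

section

variable {K : ℂ → ℂ → ℂ} {C : ℝ}

lemma IsBoundedKernel.locallyIntegrable_pdet_indicator (hK : IsBoundedKernel K C) {k : ℕ}
    {S : Set (Fin k → ℂ)} (hS : MeasurableSet S) :
    LocallyIntegrable (S.indicator fun z => pdet K z) (vol k) := by
  refine (locallyIntegrable_const (C ^ k)).mono
    ((measurable_pdet hK.measurable).indicator hS).aestronglyMeasurable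
    (Eventually.of_forall fun z => ?_)
  refine (norm_indicator_le_norm_self _ _).trans ((hK.norm_pdet_le z).trans ?_)
  rw [Fintype.card_fin]
  exact Real.le_norm_self _

lemma measurableSet_box {k : ℕ} {A : Fin k → Set ℂ} (hA : ∀ i, MeasurableSet (A i)) :
    MeasurableSet {z : Fin k → ℂ | ∀ i, z i ∈ A i} := by
  have : {z : Fin k → ℂ | ∀ i, z i ∈ A i} = Set.univ.pi A := by
    ext
    simp
  rw [this]
  exact MeasurableSet.univ_pi hA

lemma lintegral_listLaw_disc (hK : IsBoundedKernel K C)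
    (hJ : ∀ r m (z : Fin m → ℂ), 0 ≤ janossy K (lam.restrict (disc r)) z) (s : ℕ) {k M : ℕ}
    {B : Fin M → Set ℂ} (hm : ∀ j, MeasurableSet (B j)) (hs : ∀ j, B j ⊆ disc s)
    (hB : Pairwise fun i j => Disjoint (B i) (B j)) (σ : Fin k → Fin M) :
    ∫⁻ p, (descProd (fiberCard σ) (counts B (ofSeq p)) : ℝ≥0∞) ∂listLaw K (lam.restrict (disc s))
      = ∫⁻ x in {x | ∀ i, x i ∈ B (σ i)}, ENNReal.ofReal (pdet K x) ∂vol k := by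
  rw [lintegral_listLaw_descProd hK (hJ s) hm (fun j => (isBounded_disc s).subset (hs j)) hB σ,
    lintegral_box_restrict (fun i => hm _) (fun i => hs _), vol_eq_powMeasure]

/-- The intensity functions of the process built on a disc s and observed in a smaller disc r do not
depend on s. This is what makes the processes comparable. -/
lemma isIntensityFunction_map_restrict (hK : IsBoundedKernel K C)
    (hJ : ∀ r m (z : Fin m → ℂ), 0 ≤ janossy K (lam.restrict (disc r)) z) {r s : ℕ} (hrs : r ≤ s)
    (P : ProbabilityMeasure Configuration)
    (hP : (P : Measure Configuration)
      = (listLaw K (lam.restrict (disc s))).map fun p => restrict (disc r) (ofSeq p)) (k : ℕ) :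
    IsIntensityFunction P k
      ({z : Fin k → ℂ | ∀ i, z i ∈ disc r}.indicator fun z => pdet K z) := by
  have hSm : MeasurableSet {z : Fin k → ℂ | ∀ i, z i ∈ disc r} :=
    measurableSet_box fun _ => measurableSet_disc r
  refine ⟨fun z => Set.indicator_nonneg (fun z _ => hK.pos.pdet_nonneg z) z,
    hK.locallyIntegrable_pdet_indicator hSm, fun M B σ hm hb hB => ?_⟩
  have hmeas : Measurable fun X : Configuration =>
      (descProd (fiberCard σ) (counts B X) : ℝ≥0∞) :=
    (measurable_of_countable fun x => (descProd (fiberCard σ) x : ℝ≥0∞)).comp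
      (measurable_counts hm hb)
  have h1 := lintegral_listLaw_disc hK hJ s (B := fun j => B j ∩ disc r)
    (fun j => (hm j).inter (measurableSet_disc r))
    (fun j => Set.inter_subset_right.trans (disc_mono hrs))
    (fun i j hij => (hB hij).mono Set.inter_subset_left Set.inter_subset_left) σ
  have h2 : ∀ p, counts B (restrict (disc r) (ofSeq p)) = counts (fun j => B j ∩ disc r) (ofSeq p) := by
    intro p
    ext j
    simp only [counts, count_restrict]
  change ∫⁻ X, (descProd (fiberCard σ) (counts B X) : ℝ≥0∞) ∂(P : Measure Configuration) = _
  have hm' : Measurable fun p => restrict (disc r) (ofSeq p) :=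
    (measurable_restrict (measurableSet_disc r)).comp measurable_ofSeq
  rw [hP, lintegral_map hmeas hm']
  simp only [h2, h1]
  have h3 : {x : Fin k → ℂ | ∀ i, x i ∈ B (σ i) ∩ disc r}
      = {z | ∀ i, z i ∈ disc r} ∩ {x | ∀ i, x i ∈ B (σ i)} := by
    ext x
    simp only [Set.mem_inter_iff, Set.mem_ofPred_eq]
    exact ⟨fun h => ⟨fun i => (h i).2, fun i => (h i).1⟩, fun h i => ⟨h.2 i, h.1 i⟩⟩
  rw [h3, ← Measure.restrict_restrict hSm, ← lintegral_indicator hSm]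
  refine lintegral_congr fun z => ?_
  by_cases hz : z ∈ {z : Fin k → ℂ | ∀ i, z i ∈ disc r} <;> simp only [hz, Set.indicator_of_mem,
    Set.indicator_of_notMem, not_false_eq_true, ENNReal.ofReal_zero]

/-- Both sides have the same geometrically bounded intensity functions, so uniqueness gives
consistency with no computation on Janossy densities. -/
lemma map_restrict_listLaw_eq (hK : IsBoundedKernel K C)
    (hJ : ∀ r m (z : Fin m → ℂ), 0 ≤ janossy K (lam.restrict (disc r)) z) (r : ℕ) :
    (listLaw K (lam.restrict (disc (r + 1)))).map (fun p => restrict (disc r) (ofSeq p))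
      = (listLaw K (lam.restrict (disc r))).map fun p => restrict (disc r) (ofSeq p) := by
  have hm : Measurable fun p => restrict (disc r) (ofSeq p) :=
    (measurable_restrict (measurableSet_disc r)).comp measurable_ofSeq
  have hp : ∀ s, IsProbabilityMeasure (listLaw K (lam.restrict (disc s))) := fun s =>
    isProbabilityMeasure_listLaw hK (hJ s)
  let P : ℕ → ProbabilityMeasure Configuration := fun s =>
    ⟨(listLaw K (lam.restrict (disc s))).map fun p => restrict (disc r) (ofSeq p),
      Measure.isProbabilityMeasure_map hm.aemeasurable⟩
  have h : P (r + 1) = P r := by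
    refine ext_of_isIntensityFunction
      (ρ := fun k => {z : Fin k → ℂ | ∀ i, z i ∈ disc r}.indicator fun z => pdet K z)
      (fun k _ => isIntensityFunction_map_restrict hK hJ (Nat.le_succ r) _ rfl k)
      (fun k _ => isIntensityFunction_map_restrict hK hJ le_rfl _ rfl k) fun R => ⟨C, fun k z _ => ?_⟩
    have h1 := (norm_indicator_le_norm_self (s := {z : Fin k → ℂ | ∀ i, z i ∈ disc r})
      (fun z => pdet K z) z).trans (hK.norm_pdet_le z)
    rw [Fintype.card_fin] at h1
    exact (Real.le_norm_self _).trans h1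
  exact congrArg (fun Q : ProbabilityMeasure Configuration => (Q : Measure Configuration)) h

/-- A bounded positive kernel with nonnegative Janossy densities is the correlation kernel of a
point field. -/
theorem exists_isIntensityFunction (hK : IsBoundedKernel K C)
    (hJ : ∀ r m (z : Fin m → ℂ), 0 ≤ janossy K (lam.restrict (disc r)) z) :
    ∃ P : ProbabilityMeasure Configuration, ∀ k, IsIntensityFunction P k fun z => pdet K z := by
  have hp : ∀ s, IsProbabilityMeasure (listLaw K (lam.restrict (disc s))) := fun s =>
    isProbabilityMeasure_listLaw hK (hJ s)
  have hm : ∀ r, Measurable fun p => restrict (disc r) (ofSeq p) := fun r =>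
    (measurable_restrict (measurableSet_disc r)).comp measurable_ofSeq
  obtain ⟨Q, hQ, hmarg, hjoint⟩ := exists_coupling
    (fun s => listLaw K (lam.restrict (disc s))) hm hm (map_restrict_listLaw_eq hK hJ)
  -- Agreement of consecutive lists is tested on the counts of one Borel set at a time; only
  -- finitely many counts enter a factorial moment.
  have hstep : ∀ (r : ℕ) (B : Set ℂ), MeasurableSet B → B ⊆ disc r →
      ∀ᵐ x ∂Q, ((ofSeq (x r)).count B).toNat = ((ofSeq (x (r + 1))).count B).toNat := by
    intro r B hB hr
    have hBm := measurable_toNat_count hB ((isBounded_disc r).subset hr)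
    have hset : MeasurableSet {q : Configuration × (ℕ × (ℕ → ℂ)) |
        (q.1.count B).toNat = ((ofSeq q.2).count B).toNat} :=
      measurableSet_eq_fun (hBm.comp measurable_fst)
        ((hBm.comp measurable_ofSeq).comp measurable_snd)
    have hinter : B ∩ disc r = B := Set.inter_eq_left.2 hr
    have h1 : ∀ᵐ q ∂(listLaw K (lam.restrict (disc (r + 1)))).map
        (fun y => (restrict (disc r) (ofSeq y), y)),
        (q.1.count B).toNat = ((ofSeq q.2).count B).toNat := by
      have hm1 : Measurable fun y => (restrict (disc r) (ofSeq y), y) :=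
        (hm r).prodMk measurable_id
      rw [ae_map_iff hm1.aemeasurable hset]
      refine Eventually.of_forall fun y => ?_
      simp only [count_restrict, hinter]
    have hm2 : Measurable fun x : ℕ → ℕ × (ℕ → ℂ) => (restrict (disc r) (ofSeq (x r)), x (r + 1)) :=
      ((hm r).comp (measurable_pi_apply r)).prodMk (measurable_pi_apply (r + 1))
    rw [← hjoint r, ae_map_iff hm2.aemeasurable hset] at h1
    filter_upwards [h1] with x hx
    simpa only [count_restrict, hinter] using hx
  have hchain : ∀ (r d : ℕ) (B : Set ℂ), MeasurableSet B → B ⊆ disc r →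
      ∀ᵐ x ∂Q, ((ofSeq (x r)).count B).toNat = ((ofSeq (x (r + d))).count B).toNat := by
    intro r d B hB hr
    induction d with
    | zero => exact Eventually.of_forall fun x => rfl
    | succ d ih =>
      filter_upwards [ih, hstep (r + d) B hB (hr.trans (disc_mono (by omega)))] with x h1 h2
      rw [h1, h2, add_assoc]
  -- The glued configuration uses the list r on the annulus r. Along the chain each of these counts
  -- almost surely equals the count for the list R, so the whole count does.
  have hglue : ∀ (R : ℕ) (B : Set ℂ), MeasurableSet B → B ⊆ disc R →
      ∀ᵐ x ∂Q, ((glue x).count B).toNat = ((ofSeq (x R)).count B).toNat := by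
    intro R B hB hR
    have h1 : ∀ᵐ x ∂Q, ∀ r : Fin (R + 1), ((ofSeq (x r)).count (B ∩ annulus r)).toNat
        = ((ofSeq (x R)).count (B ∩ annulus r)).toNat := by
      rw [ae_all_iff]
      intro r
      have h2 := hchain r (R - r) (B ∩ annulus r) (hB.inter (measurableSet_annulus r))
        (Set.inter_subset_right.trans (annulus_subset_disc r))
      rwa [show (r : ℕ) + (R - r) = R by omega] at h2
    filter_upwards [h1] with x hx
    have hb : ∀ r, Bornology.IsBounded (B ∩ annulus r) := fun r =>
      ((isBounded_disc R).subset hR).subset Set.inter_subset_left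
    have h3 : (ofSeq (x R)).count B
        = ∑ r ∈ Finset.range (R + 1), (ofSeq (x R)).count (B ∩ annulus r) := by
      conv_lhs => rw [← biUnion_annulus_of_subset hR]
      rw [count_biUnion _ _ _ (pairwiseDisjoint_annulus _ B)]
    rw [count_glue x hR, h3]
    congr 1
    refine Finset.sum_congr rfl fun r hr => ?_
    have h4 := hx ⟨r, Finset.mem_range.1 hr⟩
    simp only at h4
    rw [← ENat.natCast_toNat ((ofSeq (x r)).count_ne_top (hb r)), h4,
      ENat.natCast_toNat ((ofSeq (x R)).count_ne_top (hb r))]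
  refine ⟨⟨Q.map glue, Measure.isProbabilityMeasure_map measurable_glue.aemeasurable⟩, fun k =>
    ⟨fun z => hK.pos.pdet_nonneg z, ?_, fun M B σ hBm hb hB => ?_⟩⟩
  · have h := hK.locallyIntegrable_pdet_indicator (k := k) MeasurableSet.univ
    rwa [Set.indicator_univ] at h
  · have hmeas : Measurable fun X : Configuration =>
        (descProd (fiberCard σ) (counts B X) : ℝ≥0∞) :=
      (measurable_of_countable fun x => (descProd (fiberCard σ) x : ℝ≥0∞)).comp
        (measurable_counts hBm hb)
    have hmeas' : Measurable fun p : ℕ × (ℕ → ℂ) =>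
        (descProd (fiberCard σ) (counts B (ofSeq p)) : ℝ≥0∞) := hmeas.comp measurable_ofSeq
    obtain ⟨R, hR⟩ := exists_subset_disc (Bornology.isBounded_iUnion.2 hb)
    have hRj : ∀ j, B j ⊆ disc R := fun j => (Set.subset_iUnion B j).trans hR
    change ∫⁻ X, (descProd (fiberCard σ) (counts B X) : ℝ≥0∞) ∂(Q.map glue) = _
    rw [lintegral_map hmeas measurable_glue, ← lintegral_listLaw_disc hK hJ R hBm hRj hB σ,
      ← hmarg R, lintegral_map hmeas' (measurable_pi_apply R)]
    have hae : ∀ᵐ x ∂Q, ∀ j, ((glue x).count (B j)).toNat = ((ofSeq (x R)).count (B j)).toNat := by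
      rw [ae_all_iff]
      exact fun j => hglue R (B j) (hBm j) (hRj j)
    refine lintegral_congr_ae ?_
    filter_upwards [hae] with x hx
    have : counts B (glue x) = counts B (ofSeq (x R)) := funext hx
    simp only [this]

end


/-! ### The Boltzmann weight as a determinant -/

lemma ereal_exp_sum {ι : Type*} (s : Finset ι) (f : ι → EReal) :
    EReal.exp (∑ i ∈ s, f i) = ∏ i ∈ s, EReal.exp (f i) := by
  classical
  induction s using Finset.induction_on with
  | empty => simp
  | insert a s ha ih => rw [Finset.sum_insert ha, Finset.prod_insert ha, EReal.exp_add, ih]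

/-- The square root of the one-particle weight. -/
noncomputable def rootWeight (n : ℕ) (ζ : ℂ) : ℝ :=
  if ‖ζ‖ ≤ 1 then Real.exp (-(n * ‖ζ‖ ^ 2) / 2) else 0

lemma rootWeight_nonneg (n : ℕ) (ζ : ℂ) : 0 ≤ rootWeight n ζ := by
  unfold rootWeight
  split_ifs <;> positivity

lemma rootWeight_le_one (n : ℕ) (ζ : ℂ) : rootWeight n ζ ≤ 1 := by
  unfold rootWeight
  split_ifs
  · refine Real.exp_le_one_iff.2 ?_
    have : 0 ≤ (n : ℝ) * ‖ζ‖ ^ 2 := by positivity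
    linarith
  · exact zero_le_one

lemma inv_exp_potential_pow {n : ℕ} (hn : n ≠ 0) (ζ : ℂ) :
    ((EReal.exp (potential ζ)) ^ n)⁻¹ = ENNReal.ofReal (rootWeight n ζ ^ 2) := by
  unfold potential rootWeight
  split_ifs with h
  · rw [EReal.exp_coe, ← ENNReal.ofReal_pow (Real.exp_pos _).le,
      ← ENNReal.ofReal_inv_of_pos (by positivity), ← Real.exp_nat_mul, ← Real.exp_neg,
      ← Real.exp_nat_mul]
    congr 2
    push_cast
    ring
  · simp [hn]

/-- Extended arithmetic does no harm: the inverted factors are never 0, so inverses distribute over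
the products although some factors may be ∞. -/
lemma boltzmannWeight_eq (n : ℕ) (ζ : Fin n → ℂ) :
    boltzmannWeight n ζ = ENNReal.ofReal ((∏ p ∈ (Finset.univ : Finset (Fin n)).offDiag,
      ‖ζ p.1 - ζ p.2‖) * ∏ j, rootWeight n (ζ j) ^ 2) := by
  have h1 : ∀ j : Fin n, EReal.exp (potential (ζ j)) ≠ 0 := by
    intro j
    rw [Ne, EReal.exp_eq_zero_iff, potential]
    split_ifs
    · exact EReal.coe_ne_bot _
    · exact top_ne_bot
  have hx : ∀ p : Fin n × Fin n, ‖ζ p.1 - ζ p.2‖ₑ⁻¹ ≠ 0 := fun p =>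
    ENNReal.inv_ne_zero.2 enorm_ne_top
  rw [boltzmannWeight, hamiltonian, EReal.exp_neg, EReal.exp_add, EReal.exp_nmul, ereal_exp_sum,
    ereal_exp_sum]
  simp only [EReal.exp_neg, ENNReal.exp_log]
  rw [ENNReal.mul_inv (Or.inl (Finset.prod_ne_zero_iff.2 fun p _ => hx p))
    (Or.inr (pow_ne_zero _ (Finset.prod_ne_zero_iff.2 fun j _ => h1 j))),
    ENNReal.prod_inv_distrib fun p _ q _ _ => Or.inl (hx p), ← Finset.prod_pow,
    ENNReal.prod_inv_distrib fun p _ q _ _ => Or.inl (pow_ne_zero _ (h1 p)),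
    ENNReal.ofReal_mul (Finset.prod_nonneg fun _ _ => norm_nonneg _),
    ENNReal.ofReal_prod_of_nonneg fun _ _ => norm_nonneg _,
    ENNReal.ofReal_prod_of_nonneg fun _ _ => sq_nonneg _]
  congr 1
  · exact Finset.prod_congr rfl fun p _ => by rw [inv_inv, ofReal_norm]
  · exact Finset.prod_congr rfl fun j _ => inv_exp_potential_pow (by have := j.2; omega) _

/-- The Hamiltonian runs over ordered pairs, so each distance occurs twice; hence the square of the
Vandermonde product. -/
lemma prod_offDiag_eq {n : ℕ} (g : Fin n → Fin n → ℝ) (hg : ∀ i j, g i j = g j i) :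
    ∏ p ∈ (Finset.univ : Finset (Fin n)).offDiag, g p.1 p.2
      = (∏ i, ∏ j ∈ Finset.Ioi i, g i j) ^ 2 := by
  have h1 : (Finset.univ : Finset (Fin n)).offDiag
      = (Finset.univ : Finset (Fin n × Fin n)).filter fun p => p.1 ≠ p.2 := by
    ext p
    simp
  have h2 : ∀ i : Fin n, ∏ j ∈ Finset.Ioi i, g i j = ∏ j, if i < j then g i j else 1 := by
    intro i
    rw [← Finset.prod_filter]
    refine Finset.prod_congr ?_ fun _ _ => rfl
    ext j
    simp
  rw [h1, Finset.prod_filter, Fintype.prod_prod_type]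
  simp only [h2]
  have h3 : ∏ i, ∏ j, (if i < j then g i j else 1) = ∏ i, ∏ j, if j < i then g i j else 1 := by
    rw [Finset.prod_comm]
    simp only [hg]
  rw [sq]
  nth_rw 2 [h3]
  rw [← Finset.prod_mul_distrib]
  refine Finset.prod_congr rfl fun i _ => ?_
  rw [← Finset.prod_mul_distrib]
  refine Finset.prod_congr rfl fun j _ => ?_
  rcases lt_trichotomy i j with h | h | h
  · simp [h, h.ne, h.le]
  · simp [h]
  · simp [h, h.ne', h.le]

/-- The squared norms of the monomials. -/
noncomputable def monomialNorm (n j : ℕ) : ℝ :=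
  ∫ s in Set.Ioc (0 : ℝ) 1, s ^ j * Real.exp (-(n * s))

lemma integrableOn_monomial (n j : ℕ) :
    IntegrableOn (fun s : ℝ => s ^ j * Real.exp (-(n * s))) (Set.Ioc 0 1) := by
  have : Continuous fun s : ℝ => s ^ j * Real.exp (-(n * s)) := by fun_prop
  exact (this.continuousOn.integrableOn_Icc (a := 0) (b := 1)).mono_set Set.Ioc_subset_Icc_self

lemma monomialNorm_pos (n j : ℕ) : 0 < monomialNorm n j := by
  rw [monomialNorm, setIntegral_pos_iff_support_of_nonneg_ae]
  · have : Set.Ioc (0 : ℝ) 1 ⊆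
        (Function.support fun s : ℝ => s ^ j * Real.exp (-(n * s))) ∩ Set.Ioc 0 1 := by
      intro s hs
      refine ⟨?_, hs⟩
      have := hs.1
      rw [Function.mem_support]
      positivity
    refine lt_of_lt_of_le ?_ (measure_mono this)
    simp
  · refine (ae_restrict_iff' measurableSet_Ioc).2 (Eventually.of_forall fun s hs => ?_)
    have := hs.1
    simp only [Pi.zero_apply]
    positivity
  · exact integrableOn_monomial n j

/-- The weighted orthonormal polynomials of the hard edge Ginibre ensemble. -/
noncomputable def orthoPoly (n : ℕ) (j : Fin n) (ζ : ℂ) : ℂ :=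
  rootWeight n ζ * ((Real.sqrt (monomialNorm n j))⁻¹ : ℝ) * ζ ^ (j : ℕ)

/-- The Boltzmann weight is a determinant, up to a constant. -/
lemma boltzmannWeight_eq_pdet (n : ℕ) (ζ : Fin n → ℂ) :
    boltzmannWeight n ζ = ENNReal.ofReal (∏ j : Fin n, monomialNorm n j)
      * ENNReal.ofReal (pdet (finKernel (orthoPoly n)) ζ) := by
  -- Weights come out of the rows and normalizing constants out of the columns; a Vandermonde matrix
  -- remains.
  have h1 : (Matrix.of fun i j => orthoPoly n j (ζ i)).det
      = (∏ i, (rootWeight n (ζ i) : ℂ)) * ((∏ j : Fin n, (((Real.sqrt (monomialNorm n j))⁻¹ : ℝ) : ℂ))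
        * (Matrix.vandermonde ζ).det) := by
    rw [← Matrix.det_mul_row, ← Matrix.det_mul_column]
    congr 1
    ext i j
    simp [orthoPoly, Matrix.vandermonde, mul_assoc]
  have h2 : ∀ j : Fin n, monomialNorm n j * ((Real.sqrt (monomialNorm n j))⁻¹) ^ 2 = 1 := by
    intro j
    have := monomialNorm_pos n j
    rw [inv_pow, Real.sq_sqrt this.le, mul_inv_cancel₀ this.ne']
  have h3 : ∏ p ∈ (Finset.univ : Finset (Fin n)).offDiag, ‖ζ p.1 - ζ p.2‖
      = ‖(Matrix.vandermonde ζ).det‖ ^ 2 := by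
    rw [prod_offDiag_eq (fun i j => ‖ζ i - ζ j‖) fun i j => norm_sub_rev _ _,
      Matrix.det_vandermonde]
    simp only [norm_prod, norm_sub_rev]
  have h0 : 0 ≤ ∏ j : Fin n, monomialNorm n j :=
    Finset.prod_nonneg fun j _ => (monomialNorm_pos n j).le
  rw [boltzmannWeight_eq, ← ENNReal.ofReal_mul h0, pdet_finKernel_fin, h1, h3]
  congr 1
  have h4 : ∏ j : Fin n, monomialNorm n j * ((Real.sqrt (monomialNorm n j))⁻¹) ^ 2 = 1 :=
    Finset.prod_eq_one fun j _ => h2 j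
  rw [Finset.prod_mul_distrib] at h4
  simp only [norm_mul, norm_prod, mul_pow, ← Finset.prod_pow, Complex.norm_real, Real.norm_eq_abs,
    sq_abs]
  calc _ = (∏ j : Fin n, monomialNorm n j) * (∏ j : Fin n, ((Real.sqrt (monomialNorm n j))⁻¹) ^ 2)
        * (‖(Matrix.vandermonde ζ).det‖ ^ 2 * ∏ j, rootWeight n (ζ j) ^ 2) := by rw [h4, one_mul]
    _ = _ := by ring


/-! ### Orthonormality -/

/-- Polar coordinates with s = r²: the factor 2π r dr / π is ds, so the normalization of `lam`
leaves no constant. -/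
lemma integral_lam_comp_norm_sq (g : ℝ → ℝ) :
    ∫ z, g (‖z‖ ^ 2) ∂lam = ∫ y in Set.Ioi 0, g y := by
  have h1 := integral_fun_norm_addHaar (volume : Measure ℂ) fun r => g (r ^ 2)
  have h2 := integral_comp_rpow_Ioi_of_pos (g := g) (p := 2) two_pos
  rw [lam, integral_smul_measure, h1, ← h2, Complex.finrank_real_complex, measureReal_def,
    Complex.volume_ball, ENNReal.toReal_ofReal (by positivity)]
  simp only [smul_eq_mul, nsmul_eq_mul, Real.rpow_two]
  norm_num
  simp only [mul_assoc]
  rw [integral_const_mul]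
  have := Real.pi_ne_zero
  field_simp

lemma measurePreserving_rotation (u : Circle) :
    MeasurePreserving (fun z : ℂ => (u : ℂ) * z) lam lam := by
  have h := (rotation u).measurePreserving
  unfold lam
  refine ⟨h.measurable, ?_⟩
  rw [Measure.map_smul]
  congr 1
  exact h.map_eq

lemma measurable_rootWeight (n : ℕ) : Measurable (rootWeight n) := by
  unfold rootWeight
  refine Measurable.ite (measurableSet_le measurable_norm measurable_const) ?_ measurable_const
  fun_prop

lemma measurable_orthoPoly (n : ℕ) (j : Fin n) : Measurable (orthoPoly n j) := by
  unfold orthoPoly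
  have := measurable_rootWeight n
  fun_prop

lemma rootWeight_of_lt {n : ℕ} {ζ : ℂ} (h : 1 < ‖ζ‖) : rootWeight n ζ = 0 := by
  rw [rootWeight, if_neg (not_le.2 h)]

lemma norm_orthoPoly (n : ℕ) (j : Fin n) (ζ : ℂ) :
    ‖orthoPoly n j ζ‖ = rootWeight n ζ * (Real.sqrt (monomialNorm n j))⁻¹ * ‖ζ‖ ^ (j : ℕ) := by
  rw [orthoPoly, norm_mul, norm_mul, norm_pow, Complex.norm_real, Complex.norm_real,
    Real.norm_of_nonneg (rootWeight_nonneg n ζ), Real.norm_of_nonneg (by positivity)]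

lemma norm_orthoPoly_le (n : ℕ) (j : Fin n) (ζ : ℂ) :
    ‖orthoPoly n j ζ‖ ≤ (Real.sqrt (monomialNorm n j))⁻¹ := by
  rw [norm_orthoPoly]
  by_cases h : ‖ζ‖ ≤ 1
  · have h1 := rootWeight_le_one n ζ
    have h0 := rootWeight_nonneg n ζ
    have h2 : ‖ζ‖ ^ (j : ℕ) ≤ 1 := pow_le_one₀ (norm_nonneg _) h
    calc rootWeight n ζ * (Real.sqrt (monomialNorm n j))⁻¹ * ‖ζ‖ ^ (j : ℕ)
        ≤ 1 * (Real.sqrt (monomialNorm n j))⁻¹ * 1 := by gcongr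
      _ = _ := by ring
  · rw [rootWeight_of_lt (not_le.1 h), zero_mul, zero_mul]
    positivity

lemma orthoPoly_of_lt {n : ℕ} (j : Fin n) {ζ : ℂ} (h : 1 < ‖ζ‖) : orthoPoly n j ζ = 0 := by
  rw [orthoPoly, rootWeight_of_lt h, Complex.ofReal_zero, zero_mul, zero_mul]

lemma rootWeight_rotation (n : ℕ) (u : Circle) (ζ : ℂ) :
    rootWeight n (u * ζ) = rootWeight n ζ := by
  simp [rootWeight, Circle.norm_coe]

lemma integrable_orthoPoly_mul (n : ℕ) (j l : Fin n) :
    Integrable (fun x => orthoPoly n j x * (starRingEnd ℂ) (orthoPoly n l x)) lam := by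
  have hm : Measurable fun x => orthoPoly n j x * (starRingEnd ℂ) (orthoPoly n l x) :=
    (measurable_orthoPoly n j).mul
      (Complex.continuous_conj.measurable.comp (measurable_orthoPoly n l))
  have hi : Integrable ((Metric.closedBall (0 : ℂ) 1).indicator fun _ =>
      (Real.sqrt (monomialNorm n j))⁻¹ * (Real.sqrt (monomialNorm n l))⁻¹) lam :=
    (integrable_indicator_iff measurableSet_closedBall).2
      (integrableOn_const (isCompact_closedBall (0 : ℂ) 1).measure_lt_top.ne)
  refine hi.mono' hm.aestronglyMeasurable (Eventually.of_forall fun x => ?_)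
  by_cases h : ‖x‖ ≤ 1
  · rw [Set.indicator_of_mem (by simpa using h), norm_mul, RCLike.norm_conj]
    gcongr <;> exact norm_orthoPoly_le _ _ _
  · rw [Set.indicator_of_notMem (by simpa using h), orthoPoly_of_lt j (not_le.1 h), zero_mul,
      norm_zero]

theorem isOrthonormalFamily_orthoPoly (n : ℕ) : IsOrthonormalFamily (orthoPoly n) lam where
  measurable := measurable_orthoPoly n
  integrable := integrable_orthoPoly_mul n
  integral_eq j l := by
    split_ifs with hjl
    · subst hjl
      set g : ℝ → ℝ := (Set.Iic (1 : ℝ)).indicator fun s =>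
        (monomialNorm n j)⁻¹ * (s ^ (j : ℕ) * Real.exp (-(n * s))) with hg
      have h1 : ∀ x, orthoPoly n j x * (starRingEnd ℂ) (orthoPoly n j x)
          = ((g (‖x‖ ^ 2) : ℝ) : ℂ) := by
        intro x
        rw [Complex.mul_conj, Complex.normSq_eq_norm_sq, norm_orthoPoly]
        congr 1
        by_cases h : ‖x‖ ≤ 1
        · rw [hg, Set.indicator_of_mem (by simpa using h), rootWeight, if_pos h, mul_pow, mul_pow,
            inv_pow, Real.sq_sqrt (monomialNorm_pos n j).le, ← Real.exp_nat_mul]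
          rw [show ((2 : ℕ) : ℝ) * (-(n * ‖x‖ ^ 2) / 2) = -(n * ‖x‖ ^ 2) by push_cast; ring]
          ring
        · rw [hg, Set.indicator_of_notMem (by simpa using h), rootWeight_of_lt (not_le.1 h)]
          ring
      simp only [h1]
      rw [integral_complex_ofReal, integral_lam_comp_norm_sq, hg, setIntegral_indicator measurableSet_Iic,
        Set.Ioi_inter_Iic, integral_const_mul]
      rw [show ∫ s in Set.Ioc (0 : ℝ) 1, s ^ (j : ℕ) * Real.exp (-(n * s)) = monomialNorm n j from rfl,
        inv_mul_cancel₀ (monomialNorm_pos n j).ne', Complex.ofReal_one]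
    · set I := ∫ x, orthoPoly n j x * (starRingEnd ℂ) (orthoPoly n l x) ∂lam with hI
      have hd : ((j : ℕ) : ℝ) - (l : ℕ) ≠ 0 := by
        rw [sub_ne_zero]
        exact_mod_cast fun h => hjl (Fin.ext h)
      -- Rotation by π / (j - l) preserves the measure and changes the sign of the integrand, so the
      -- integral equals its negative.
      set u : Circle := Circle.exp (Real.pi / ((j : ℕ) - (l : ℕ))) with hu
      have hphase : (u : ℂ) ^ (j : ℕ) * (starRingEnd ℂ) ((u : ℂ) ^ (l : ℕ)) = -1 := by
        rw [hu, Circle.coe_exp, ← Complex.exp_nat_mul, ← Complex.exp_nat_mul, ← Complex.exp_conj,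
          ← Complex.exp_add, ← Complex.exp_pi_mul_I]
        congr 1
        have hd' : ((j : ℕ) : ℂ) - (l : ℕ) ≠ 0 := by exact_mod_cast hd
        simp only [map_mul, map_natCast, Complex.conj_I, Complex.conj_ofReal]
        push_cast
        field_simp
        ring
      have hrot : ∀ x, orthoPoly n j (u * x) * (starRingEnd ℂ) (orthoPoly n l (u * x))
          = -(orthoPoly n j x * (starRingEnd ℂ) (orthoPoly n l x)) := by
        intro x
        simp only [orthoPoly, rootWeight_rotation, mul_pow, map_mul, Complex.conj_ofReal]
        rw [map_pow] at hphase
        simp only [map_pow] at hphase ⊢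
        linear_combination (rootWeight n x * ((Real.sqrt (monomialNorm n j))⁻¹ : ℝ) * x ^ (j : ℕ)
          * (rootWeight n x * ((Real.sqrt (monomialNorm n l))⁻¹ : ℝ)
            * (starRingEnd ℂ) x ^ (l : ℕ)) : ℂ) * hphase
      have h1 : I = -I := by
        have h2 := (measurePreserving_rotation u).integral_comp
          (rotation u).toHomeomorph.measurableEmbedding
          (fun x => orthoPoly n j x * (starRingEnd ℂ) (orthoPoly n l x))
        rw [← hI] at h2
        simp only [hrot, integral_neg] at h2
        exact h2.symm
      exact self_eq_neg.1 h1

lemma isBoundedKernel_orthoPoly (n : ℕ) :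
    IsBoundedKernel (finKernel (orthoPoly n)) (∑ j : Fin n, (monomialNorm n j)⁻¹) where
  pos := isPosKernel_finKernel _
  measurable := measurable_finKernel (measurable_orthoPoly n)
  nonneg := Finset.sum_nonneg fun j _ => (inv_pos.2 (monomialNorm_pos n j)).le
  norm_le z := by
    refine (norm_sum_le _ _).trans (Finset.sum_le_sum fun j _ => ?_)
    rw [norm_mul, RCLike.norm_conj, ← sq]
    calc ‖orthoPoly n j z‖ ^ 2 ≤ ((Real.sqrt (monomialNorm n j))⁻¹) ^ 2 := by
          gcongr
          exact norm_orthoPoly_le n j z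
      _ = _ := by rw [inv_pow, Real.sq_sqrt (monomialNorm_pos n j).le]

/-! ### Marginals of determinantal densities -/

section

variable {n : ℕ} {φ : Fin n → ℂ → ℂ} {μ : Measure ℂ} [SigmaFinite μ]

/-- Gaudin's lemma iterated l times. The truncated difference is harmless: with more than n points
the determinant vanishes. -/
lemma IsOrthonormalFamily.lintegral_pdet_sumElim (h : IsOrthonormalFamily φ μ) (l : ℕ) {ι : Type}
    [Fintype ι] [DecidableEq ι] (z : ι → ℂ) :
    ∫⁻ w, ENNReal.ofReal (pdet (finKernel φ) (Sum.elim z w)) ∂powMeasure μ (Fin l)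
      = (n - Fintype.card ι).descFactorial l * ENNReal.ofReal (pdet (finKernel φ) z) := by
  have hpos := isPosKernel_finKernel φ
  have hK := measurable_finKernel h.measurable
  induction l generalizing ι with
  | zero =>
    have h1 : ∀ w : Fin 0 → ℂ, pdet (finKernel φ) (Sum.elim z w) = pdet (finKernel φ) z := by
      intro w
      rw [← pdet_comp_equiv _ (Equiv.sumEmpty ι (Fin 0)) z]
      congr 1
      ext (i | i)
      · rfl
      · exact i.elim0
    simp only [h1, lintegral_const]
    simp [powMeasure]
  | succ l ih =>
    let e : Unit ⊕ Fin l ≃ Fin (l + 1) :=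
      ((Equiv.sumCongr (Equiv.ofUnique Unit (Fin 1)) (Equiv.refl _)).trans finSumFinEquiv).trans
        (finCongr (add_comm 1 l))
    have hm : Measurable fun y : Unit ⊕ Fin l → ℂ =>
        ENNReal.ofReal (pdet (finKernel φ) (Sum.elim z y)) :=
      ((measurable_pdet hK).comp (measurable_sumElim_right z)).ennreal_ofReal
    have h1 : ∫⁻ w, ENNReal.ofReal (pdet (finKernel φ) (Sum.elim z w)) ∂powMeasure μ (Fin (l + 1))
        = ∫⁻ y : Unit ⊕ Fin l → ℂ, ENNReal.ofReal (pdet (finKernel φ) (Sum.elim z y))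
          ∂powMeasure μ _ := by
      rw [← lintegral_comp_equiv (μ := μ) e]
      simp only [pdet_sumElim_comp_right]
    have h2 : ∀ x : Unit → ℂ, ∫⁻ w, ENNReal.ofReal (pdet (finKernel φ)
        (Sum.elim z (Sum.elim x w))) ∂powMeasure μ (Fin l)
        = (n - (Fintype.card ι + 1)).descFactorial l
          * ENNReal.ofReal (pdet (finKernel φ) (Sum.elim z x)) := by
      intro x
      have h3 := ih (Sum.elim z x)
      simp only [pdet_sumElim_assoc, Fintype.card_sum, Fintype.card_unit] at h3
      exact h3
    have hm1 : Measurable fun x : Unit → ℂ => ENNReal.ofReal (pdet (finKernel φ) (Sum.elim z x)) :=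
      ((measurable_pdet hK).comp (measurable_sumElim_right z)).ennreal_ofReal
    rw [h1, lintegral_sum hm]
    simp only [h2]
    rw [lintegral_const_mul _ hm1, lintegral_unique hm1]
    obtain ⟨hi, he⟩ := h.integral_pdet_sumElim z
    rw [← ofReal_integral_eq_lintegral_ofReal hi
      (Eventually.of_forall fun x => hpos.pdet_nonneg _), he]
    rcases lt_or_ge n (Fintype.card ι) with hlt | hge
    · simp [pdet_finKernel_of_lt φ z hlt]
    · have h4 : ((n : ℝ) - Fintype.card ι) = ((n - Fintype.card ι : ℕ) : ℝ) := by
        rw [Nat.cast_sub hge]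
      rw [h4, ENNReal.ofReal_mul (Nat.cast_nonneg _), ENNReal.ofReal_natCast, ← mul_assoc]
      congr 1
      rcases Nat.eq_zero_or_pos (n - Fintype.card ι) with h0 | h0
      · simp [h0]
      · obtain ⟨d, hd⟩ := Nat.exists_eq_succ_of_ne_zero h0.ne'
        rw [hd, Nat.succ_descFactorial_succ, show n - (Fintype.card ι + 1) = d by omega]
        push_cast
        ring

end


/-! ### The intensities of the hard edge Ginibre ensemble -/

lemma lintegral_pdet_orthoPoly (n : ℕ) :
    ∫⁻ ζ, ENNReal.ofReal (pdet (finKernel (orthoPoly n)) ζ) ∂vol n = n.factorial := by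
  have h := (isOrthonormalFamily_orthoPoly n).lintegral_pdet_sumElim n (Empty.elim : Empty → ℂ)
  have h1 : ∀ w : Fin n → ℂ, pdet (finKernel (orthoPoly n)) (Sum.elim Empty.elim w)
      = pdet (finKernel (orthoPoly n)) w := by
    intro w
    rw [← pdet_comp_equiv _ (Equiv.emptySum Empty (Fin n)) w]
    congr 1
    ext (i | i)
    · exact i.elim
    · rfl
  simp only [h1, pdet_of_isEmpty, Fintype.card_empty, Nat.sub_zero, Nat.descFactorial_self,
    ENNReal.ofReal_one, mul_one] at h
  rw [vol_eq_powMeasure]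
  exact h

lemma measurable_pdet_orthoPoly (n : ℕ) {ι : Type} [Fintype ι] [DecidableEq ι] :
    Measurable fun ζ : ι → ℂ => ENNReal.ofReal (pdet (finKernel (orthoPoly n)) ζ) :=
  (measurable_pdet (isBoundedKernel_orthoPoly n).measurable).ennreal_ofReal

/-- The constant relating the weight to the determinant cancels against the partition function, and
the determinant has total mass n!. -/
lemma lintegral_gibbs (n : ℕ) {f : (Fin n → ℂ) → ℝ≥0∞} (hf : Measurable f) :
    ∫⁻ ζ, f ζ ∂gibbs n = (n.factorial : ℝ≥0∞)⁻¹ *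
      ∫⁻ ζ, ENNReal.ofReal (pdet (finKernel (orthoPoly n)) ζ) * f ζ ∂vol n := by
  have hm := measurable_pdet_orthoPoly n (ι := Fin n)
  set c := ENNReal.ofReal (∏ j : Fin n, monomialNorm n j) with hc
  have hc0 : c ≠ 0 := by
    rw [hc, Ne, ENNReal.ofReal_eq_zero, not_le]
    exact Finset.prod_pos fun j _ => monomialNorm_pos n j
  have hb : boltzmannWeight n = fun ζ =>
      c * ENNReal.ofReal (pdet (finKernel (orthoPoly n)) ζ) := funext (boltzmannWeight_eq_pdet n)
  have hZ : partitionFunction n = c * n.factorial := by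
    rw [partitionFunction, hb, lintegral_const_mul _ hm, lintegral_pdet_orthoPoly]
  rw [gibbs, lintegral_smul_measure, hZ, hb,
    lintegral_withDensity_eq_lintegral_mul _ (hm.const_mul c) hf]
  simp only [Pi.mul_apply, mul_assoc, smul_eq_mul]
  have hg : Measurable fun ζ => ENNReal.ofReal (pdet (finKernel (orthoPoly n)) ζ) * f ζ := hm.mul hf
  rw [lintegral_const_mul c hg, ENNReal.mul_inv (Or.inl hc0) (Or.inl ENNReal.ofReal_ne_top),
    mul_mul_mul_comm, ENNReal.inv_mul_cancel hc0 ENNReal.ofReal_ne_top, one_mul]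

instance isProbabilityMeasure_gibbs (n : ℕ) : IsProbabilityMeasure (gibbs n) := by
  refine ⟨?_⟩
  have h := lintegral_gibbs n (f := fun _ => 1) measurable_const
  simp only [mul_one, lintegral_const, one_mul, lintegral_pdet_orthoPoly] at h
  rw [h, ENNReal.inv_mul_cancel (by exact_mod_cast n.factorial_ne_zero) (ENNReal.natCast_ne_top _)]

open Classical in
lemma particleCount_eq {n : ℕ} (ζ : Fin n → ℂ) (B : Set ℂ) :
    particleCount ζ B = (Finset.univ.filter fun i => ζ i ∈ B).card := by
  rw [particleCount, ← Set.ncard_coe_finset]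
  congr 1
  ext i
  simp

lemma measurable_particleCount (n : ℕ) {B : Set ℂ} (hB : MeasurableSet B) :
    Measurable fun ζ : Fin n → ℂ => particleCount ζ B := by
  classical
  simp only [particleCount_eq, Finset.card_filter]
  exact Finset.measurable_sum _ fun i _ =>
    Measurable.ite (measurable_pi_apply i hB) measurable_const measurable_const

lemma sum_particleCount_le {n M : ℕ} {B : Fin M → Set ℂ}
    (hB : Pairwise fun i j => Disjoint (B i) (B j)) (ζ : Fin n → ℂ) :
    ∑ j, particleCount ζ (B j) ≤ n := by
  classical
  simp only [particleCount_eq]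
  rw [← Finset.card_biUnion]
  · exact (Finset.card_le_univ _).trans_eq (Fintype.card_fin n)
  · intro i _ j _ hij
    rw [Function.onFun, Finset.disjoint_left]
    intro a ha hb
    rw [Finset.mem_filter] at ha hb
    exact Set.disjoint_left.1 (hB hij) ha.2 hb.2

lemma measurable_descProd_particleCount (n : ℕ) {M : ℕ} {B : Fin M → Set ℂ}
    (hm : ∀ j, MeasurableSet (B j)) (κ : Fin M → ℕ) :
    Measurable fun ζ : Fin n → ℂ => (descProd κ fun j => particleCount ζ (B j) : ℝ≥0∞) :=
  (measurable_of_countable fun x => (descProd κ x : ℝ≥0∞)).comp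
    (measurable_pi_lambda _ fun j => measurable_particleCount n (hm j))

/-- The factorial moments of the hard edge Ginibre ensemble. -/
theorem lintegral_gibbs_descProd (n : ℕ) {k M : ℕ} {B : Fin M → Set ℂ}
    (hm : ∀ j, MeasurableSet (B j)) (hB : Pairwise fun i j => Disjoint (B i) (B j))
    (σ : Fin k → Fin M) :
    ∫⁻ ζ, (descProd (fiberCard σ) fun j => particleCount ζ (B j) : ℝ≥0∞) ∂gibbs n
      = ∫⁻ x in {x | ∀ i, x i ∈ B (σ i)},
          ENNReal.ofReal (pdet (finKernel (orthoPoly n)) x) ∂vol k := by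
  classical
  rcases lt_or_ge n k with hlt | hle
  · have h1 : ∀ ζ : Fin n → ℂ, descProd (fiberCard σ) (fun j => particleCount ζ (B j)) = 0 := by
      intro ζ
      have h2 : ∃ j, particleCount ζ (B j) < fiberCard σ j := by
        by_contra! h
        have h3 := Finset.sum_le_sum fun j (_ : j ∈ Finset.univ) => h j
        rw [sum_fiberCard] at h3
        exact absurd (h3.trans (sum_particleCount_le hB ζ)) (not_le.2 hlt)
      obtain ⟨j, hj⟩ := h2
      exact Finset.prod_eq_zero (Finset.mem_univ j) (Nat.descFactorial_eq_zero_iff_lt.2 hj)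
    have h2 : ∀ x : Fin k → ℂ, pdet (finKernel (orthoPoly n)) x = 0 := fun x =>
      pdet_finKernel_of_lt _ x (by simpa using hlt)
    simp [h1, h2]
  · obtain ⟨l, rfl⟩ := Nat.exists_eq_add_of_le hle
    rw [lintegral_gibbs _ (measurable_descProd_particleCount _ hm _), vol_eq_powMeasure,
      vol_eq_powMeasure]
    have h1 := lintegral_mul_prod_descFactorial (μ := lam) hm hB σ
      (f := fun ζ : Fin (k + l) → ℂ => ENNReal.ofReal (pdet (finKernel (orthoPoly (k + l))) ζ))
      (measurable_pdet_orthoPoly _) (fun π z => by simp only [pdet_comp_equiv])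
    have h2 : ∀ x : Fin k → ℂ, ∫⁻ w, ENNReal.ofReal (pdet (finKernel (orthoPoly (k + l)))
        (Sum.elim x w ∘ finSumFinEquiv.symm)) ∂powMeasure lam (Fin l)
        = l.factorial * ENNReal.ofReal (pdet (finKernel (orthoPoly (k + l))) x) := by
      intro x
      have h3 := (isOrthonormalFamily_orthoPoly (k + l)).lintegral_pdet_sumElim l x
      simp only [pdet_comp_equiv]
      rw [h3, Fintype.card_fin, Nat.add_sub_cancel_left, Nat.descFactorial_self]
    simp only [h2] at h1
    rw [lintegral_const_mul _ (measurable_pdet_orthoPoly _)] at h1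
    have h4 : ∀ ζ : Fin (k + l) → ℂ, descProd (fiberCard σ) (fun j => particleCount ζ (B j))
        = ∏ j, ((Finset.univ.filter fun i => ζ i ∈ B j).card).descFactorial
          (Finset.univ.filter fun l => σ l = j).card := by
      intro ζ
      simp only [descProd, fiberCard, particleCount_eq]
    simp only [h4]
    rw [h1, ← mul_assoc, ← mul_assoc]
    have h5 : ((k + l).factorial : ℝ≥0∞) = (k + l).descFactorial k * l.factorial := by
      rw [← Nat.factorial_mul_descFactorial (Nat.le_add_right k l), Nat.add_sub_cancel_left]
      push_cast
      ring
    rw [mul_assoc _ _ (l.factorial : ℝ≥0∞), ← h5, ENNReal.inv_mul_cancel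
      (by exact_mod_cast (k + l).factorial_ne_zero) (ENNReal.natCast_ne_top _), one_mul]

lemma lam_ball (x : ℂ) {r : ℝ} (hr : 0 ≤ r) : lam (Metric.ball x r) = ENNReal.ofReal (r ^ 2) := by
  rw [lam, Measure.smul_apply, Complex.volume_ball, smul_eq_mul, ENNReal.ofReal_inv_of_pos Real.pi_pos,
    mul_comm, mul_assoc, ENNReal.ofReal_pow hr, ← NNReal.coe_real_pi, ENNReal.ofReal_coe_nnreal,
    ENNReal.mul_inv_cancel (by exact_mod_cast NNReal.pi_ne_zero) ENNReal.coe_ne_top, mul_one]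

lemma vol_box_ball {k : ℕ} (η : Fin k → ℂ) {r : ℝ} (hr : 0 ≤ r) :
    vol k {x | ∀ i, x i ∈ Metric.ball (η i) r} = ENNReal.ofReal (r ^ (2 * k)) := by
  have : {x : Fin k → ℂ | ∀ i, x i ∈ Metric.ball (η i) r}
      = Set.univ.pi fun i => Metric.ball (η i) r := by
    ext
    simp
  rw [this, vol_eq_pi, Measure.pi_pi]
  simp only [lam_ball _ hr, Finset.prod_const, Finset.card_univ, Fintype.card_fin]
  rw [← ENNReal.ofReal_pow (sq_nonneg r), ← pow_mul]

lemma fiberCard_id {k : ℕ} (j : Fin k) : fiberCard id j = 1 := by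
  rw [fiberCard, Finset.card_eq_one]
  exact ⟨j, by ext i; simp⟩

lemma fiberCard_cons {k : ℕ} (l j : Fin k) :
    fiberCard (Fin.cons (α := fun _ => Fin k) l id) j = if l = j then 2 else 1 := by
  have h := fiberCard_id j
  rw [fiberCard] at h
  rw [fiberCard, Fin.card_filter_univ_succ']
  simp only [Fin.cons_zero, Fin.cons_succ]
  simp only [id] at h
  split_ifs <;> simp [h]

/-- If all N_j ≥ 1 and some N_l ≥ 2, then N_l ≤ N_l(N_l - 1), so one summand dominates the product.
With `ite_le_descProd` this encloses the indicator of occupation between factorial moments of orders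
k and k + 1. -/
lemma prod_le_add_sum_descProd {k : ℕ} (N : Fin k → ℕ) :
    (descProd (fiberCard id) N) ≤ (if ∀ j, 1 ≤ N j then 1 else 0)
      + ∑ l, descProd (fiberCard (Fin.cons (α := fun _ => Fin k) l id)) N := by
  simp only [descProd, fiberCard_id, fiberCard_cons, Nat.descFactorial_one]
  split_ifs with h
  · by_cases h2 : ∃ l, 2 ≤ N l
    · obtain ⟨l, hl⟩ := h2
      refine le_add_left ((Finset.prod_le_prod' fun j _ => ?_).trans (Finset.single_le_sum
        (f := fun l => ∏ j, (N j).descFactorial (if l = j then 2 else 1))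
        (fun _ _ => Nat.zero_le _) (Finset.mem_univ l)))
      split_ifs with hj
      · subst hj
        obtain ⟨m, hm⟩ := Nat.exists_eq_add_of_le' hl
        rw [hm]
        simp only [Nat.descFactorial_succ, Nat.descFactorial_zero, Nat.sub_zero,
          Nat.reduceSubDiff]
        nlinarith
      · simp
    · push Not at h2
      refine le_add_right (Finset.prod_le_one' fun j _ => ?_)
      have := h2 j
      omega
  · push Not at h
    obtain ⟨j, hj⟩ := h
    rw [Finset.prod_eq_zero (Finset.mem_univ j) (by omega)]
    exact Nat.zero_le _

lemma ite_le_descProd {k : ℕ} (N : Fin k → ℕ) :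
    (if ∀ j, 1 ≤ N j then 1 else 0) ≤ descProd (fiberCard id) N := by
  simp only [descProd, fiberCard_id, Nat.descFactorial_one]
  split_ifs with h
  · exact Finset.one_le_prod' fun j _ => h j
  · exact Nat.zero_le _


/-! ### The pointwise limit defining the intensities -/

lemma measurableSet_occupied (n : ℕ) {k : ℕ} {B : Fin k → Set ℂ} (hm : ∀ j, MeasurableSet (B j)) :
    MeasurableSet {ζ : Fin n → ℂ | ∀ j, 1 ≤ particleCount ζ (B j)} := by
  have : {ζ : Fin n → ℂ | ∀ j, 1 ≤ particleCount ζ (B j)}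
      = ⋂ j, {ζ | 1 ≤ particleCount ζ (B j)} := by
    ext
    simp
  rw [this]
  exact MeasurableSet.iInter fun j => measurableSet_le measurable_const
    (measurable_particleCount n (hm j))

/-- The error comes from discs with two particles. Each such term is an integral of a (k+1)-point
determinant, at most C^(k+1), over a box of volume ε^(2(k+1)). -/
lemma abs_gibbs_sub_integral_le {n k : ℕ} {C : ℝ} (hK : IsBoundedKernel (finKernel (orthoPoly n)) C)
    {η : Fin k → ℂ} {ε : ℝ} (hε : 0 < ε)
    (hB : Pairwise fun i j => Disjoint (Metric.ball (η i) ε) (Metric.ball (η j) ε)) :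
    |(gibbs n).real {ζ | ∀ j, 1 ≤ particleCount ζ (Metric.ball (η j) ε)}
      - ∫ x in {x | ∀ i, x i ∈ Metric.ball (η i) ε}, pdet (finKernel (orthoPoly n)) x ∂vol k|
      ≤ k * (C ^ (k + 1) * ε ^ (2 * (k + 1))) := by
  have hm : ∀ j, MeasurableSet (Metric.ball (η j) ε) := fun j => measurableSet_ball
  set N : (Fin n → ℂ) → Fin k → ℕ := fun ζ j => particleCount ζ (Metric.ball (η j) ε) with hN
  set S : Set (Fin n → ℂ) := {ζ | ∀ j, 1 ≤ particleCount ζ (Metric.ball (η j) ε)} with hS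
  have hSm : MeasurableSet S := measurableSet_occupied n hm
  have hp : gibbs n S = ∫⁻ ζ, ((if ∀ j, 1 ≤ N ζ j then 1 else 0 : ℕ) : ℝ≥0∞) ∂gibbs n := by
    rw [← lintegral_indicator_one hSm]
    refine lintegral_congr fun ζ => ?_
    by_cases h : ζ ∈ S
    · rw [Set.indicator_of_mem h, if_pos (show ∀ j, 1 ≤ N ζ j from h)]
      simp
    · rw [Set.indicator_of_notMem h, if_neg (show ¬∀ j, 1 ≤ N ζ j from h)]
      simp
  have hmom := lintegral_gibbs_descProd n hm hB id
  have hmom2 := fun l => lintegral_gibbs_descProd n hm hB (Fin.cons (α := fun _ => Fin k) l id)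
  have hupper : gibbs n S ≤ ∫⁻ x in {x | ∀ i, x i ∈ Metric.ball (η i) ε},
      ENNReal.ofReal (pdet (finKernel (orthoPoly n)) x) ∂vol k := by
    rw [hp]
    refine le_trans (lintegral_mono fun ζ => ?_) hmom.le
    exact (Nat.cast_le (α := ℝ≥0∞)).2 (ite_le_descProd (N ζ))
  have hsecond : ∀ l : Fin k, ∫⁻ x in {x : Fin (k + 1) → ℂ | ∀ i, x i ∈ Metric.ball
      (η (Fin.cons (α := fun _ => Fin k) l id i)) ε},
      ENNReal.ofReal (pdet (finKernel (orthoPoly n)) x) ∂vol (k + 1)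
      ≤ ENNReal.ofReal (C ^ (k + 1) * ε ^ (2 * (k + 1))) := by
    intro l
    have hb : ∀ x : Fin (k + 1) → ℂ, ENNReal.ofReal (pdet (finKernel (orthoPoly n)) x)
        ≤ ENNReal.ofReal (C ^ (k + 1)) := by
      intro x
      refine ENNReal.ofReal_le_ofReal ((Real.le_norm_self _).trans ((hK.norm_pdet_le x).trans_eq ?_))
      rw [Fintype.card_fin]
    refine (lintegral_mono hb).trans ?_
    rw [setLIntegral_const, vol_box_ball (fun i => η (Fin.cons (α := fun _ => Fin k) l id i)) hε.le,
      ENNReal.ofReal_mul (pow_nonneg hK.nonneg _)]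
  have hlower : ∫⁻ x in {x | ∀ i, x i ∈ Metric.ball (η i) ε},
      ENNReal.ofReal (pdet (finKernel (orthoPoly n)) x) ∂vol k
      ≤ gibbs n S + k * ENNReal.ofReal (C ^ (k + 1) * ε ^ (2 * (k + 1))) := by
    have h1 : ∫⁻ ζ, (descProd (fiberCard id) (N ζ) : ℝ≥0∞) ∂gibbs n
        ≤ ∫⁻ ζ, (((if ∀ j, 1 ≤ N ζ j then 1 else 0 : ℕ) : ℝ≥0∞) + ∑ l, (descProd
          (fiberCard (Fin.cons (α := fun _ => Fin k) l id)) (N ζ) : ℝ≥0∞)) ∂gibbs n := by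
      refine lintegral_mono fun ζ => ?_
      have h2 := (Nat.cast_le (α := ℝ≥0∞)).2 (prod_le_add_sum_descProd (N ζ))
      rw [Nat.cast_add, Nat.cast_sum] at h2
      exact h2
    rw [lintegral_add_right _ (Finset.measurable_sum _ fun l _ =>
      measurable_descProd_particleCount n hm _), ← hp, lintegral_finsetSum _ fun l _ =>
      measurable_descProd_particleCount n hm _] at h1
    refine hmom.symm.le.trans (h1.trans ?_)
    gcongr
    calc _ ≤ ∑ _l : Fin k, ENNReal.ofReal (C ^ (k + 1) * ε ^ (2 * (k + 1))) :=
          Finset.sum_le_sum fun l _ => (hmom2 l).trans_le (hsecond l)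
      _ = _ := by simp
  have hint : ∫ x in {x | ∀ i, x i ∈ Metric.ball (η i) ε}, pdet (finKernel (orthoPoly n)) x ∂vol k
      = (∫⁻ x in {x | ∀ i, x i ∈ Metric.ball (η i) ε},
        ENNReal.ofReal (pdet (finKernel (orthoPoly n)) x) ∂vol k).toReal :=
    integral_eq_lintegral_of_nonneg_ae (Eventually.of_forall fun x => hK.pos.pdet_nonneg x)
      (measurable_pdet hK.measurable).aestronglyMeasurable
  have hpos : 0 ≤ C ^ (k + 1) * ε ^ (2 * (k + 1)) :=
    mul_nonneg (pow_nonneg hK.nonneg _) (by positivity)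
  have hfin : gibbs n S + k * ENNReal.ofReal (C ^ (k + 1) * ε ^ (2 * (k + 1))) ≠ ⊤ :=
    ENNReal.add_ne_top.2 ⟨measure_ne_top _ _, ENNReal.mul_ne_top (ENNReal.natCast_ne_top _)
      ENNReal.ofReal_ne_top⟩
  have hfin1 := ne_top_of_le_ne_top hfin hlower
  rw [hint, measureReal_def, abs_le]
  have hu := ENNReal.toReal_mono hfin1 hupper
  have hl := ENNReal.toReal_mono hfin hlower
  rw [ENNReal.toReal_add (measure_ne_top _ _) (ENNReal.mul_ne_top (ENNReal.natCast_ne_top _)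
      ENNReal.ofReal_ne_top), ENNReal.toReal_mul, ENNReal.toReal_natCast,
      ENNReal.toReal_ofReal hpos] at hl
  constructor
  · linarith
  · have : 0 ≤ (k : ℝ) * (C ^ (k + 1) * ε ^ (2 * (k + 1))) := by positivity
    linarith

lemma continuousAt_orthoPoly (n : ℕ) (j : Fin n) {ζ : ℂ} (h : ‖ζ‖ ≠ 1) :
    ContinuousAt (orthoPoly n j) ζ := by
  have hw : ContinuousAt (rootWeight n) ζ := by
    rcases lt_or_gt_of_ne h with h | h
    · have h1 : rootWeight n =ᶠ[𝓝 ζ] fun x => Real.exp (-(n * ‖x‖ ^ 2) / 2) := by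
        filter_upwards [continuous_norm.continuousAt.eventually_lt continuousAt_const h] with x hx
        rw [rootWeight, if_pos hx.le]
      exact (Continuous.continuousAt (by fun_prop)).congr h1.symm
    · have h1 : rootWeight n =ᶠ[𝓝 ζ] fun _ => 0 := by
        filter_upwards [continuousAt_const.eventually_lt continuous_norm.continuousAt h] with x hx
        exact rootWeight_of_lt hx
      exact continuousAt_const.congr h1.symm
  unfold orthoPoly
  fun_prop

lemma continuousAt_pdet_orthoPoly (n : ℕ) {k : ℕ} {η : Fin k → ℂ} (h : ∀ i, ‖η i‖ ≠ 1) :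
    ContinuousAt (fun x : Fin k → ℂ => pdet (finKernel (orthoPoly n)) x) η := by
  have hdet : Continuous fun M : Matrix (Fin k) (Fin k) ℂ => M.det.re :=
    Complex.continuous_re.comp (Continuous.matrix_det continuous_id)
  have hentry : ContinuousAt (fun x : Fin k → ℂ => kernelMatrix (finKernel (orthoPoly n)) x) η := by
    refine continuousAt_pi.2 fun i => continuousAt_pi.2 fun j => ?_
    have h1 : ∀ (i : Fin k) (l : Fin n), ContinuousAt (fun x : Fin k → ℂ => orthoPoly n l (x i)) η :=
      fun i l => ContinuousAt.comp (f := fun x : Fin k → ℂ => x i) (continuousAt_orthoPoly n l (h i))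
        (continuous_apply i).continuousAt
    change ContinuousAt (fun x : Fin k → ℂ =>
      ∑ l, orthoPoly n l (x i) * (starRingEnd ℂ) (orthoPoly n l (x j))) η
    refine tendsto_finsetSum _ fun l _ => ?_
    exact (h1 i l).mul (Complex.continuous_conj.continuousAt.comp (h1 j l))
  exact ContinuousAt.comp (g := fun M : Matrix (Fin k) (Fin k) ℂ => M.det.re) hdet.continuousAt hentry

lemma exists_pairwise_disjoint_ball {k : ℕ} {η : Fin k → ℂ} (hη : Function.Injective η) :
    ∀ᶠ ε in 𝓝[>] (0 : ℝ),
      Pairwise fun i j => Disjoint (Metric.ball (η i) ε) (Metric.ball (η j) ε) := by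
  have h : ∀ i j, i ≠ j → ∀ᶠ ε in 𝓝[>] (0 : ℝ),
      Disjoint (Metric.ball (η i) ε) (Metric.ball (η j) ε) := by
    intro i j hij
    have hd : 0 < dist (η i) (η j) := dist_pos.2 (hη.ne hij)
    filter_upwards [nhdsWithin_le_nhds (eventually_lt_nhds (half_pos hd))] with ε hε
    exact Metric.ball_disjoint_ball (by linarith)
  rw [show (∀ᶠ ε in 𝓝[>] (0 : ℝ),
      Pairwise fun i j => Disjoint (Metric.ball (η i) ε) (Metric.ball (η j) ε))
      ↔ ∀ i j, ∀ᶠ ε in 𝓝[>] (0 : ℝ), i ≠ j → Disjoint (Metric.ball (η i) ε) (Metric.ball (η j) ε)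
    by simp only [Pairwise, eventually_all]]
  intro i j
  by_cases hij : i = j
  · exact Eventually.of_forall fun ε h => absurd hij h
  · filter_upwards [h i j hij] with ε hε _ using hε

/-- Off the unit circle the intensities are determinants. -/
theorem jointIntensity_eq_pdet (n k : ℕ) {η : Fin k → ℂ} (h : ∀ i, ‖η i‖ ≠ 1) :
    jointIntensity n k η = pdet (finKernel (orthoPoly n)) η := by
  rw [jointIntensity]
  split_ifs with hη
  swap
  · rw [Function.Injective] at hη
    push Not at hη
    obtain ⟨i, j, hij, hne⟩ := hη
    exact (pdet_eq_zero_of_eq η hne hij).symm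
  have hK := isBoundedKernel_orthoPoly n
  set C := ∑ j : Fin n, (monomialNorm n j)⁻¹
  set box : ℝ → Set (Fin k → ℂ) := fun ε => {x | ∀ i, x i ∈ Metric.ball (η i) ε} with hbox
  have hpos : ∀ᶠ ε in 𝓝[>] (0 : ℝ), 0 < ε := self_mem_nhdsWithin
  have hsmall : Tendsto box (𝓝[>] 0) (𝓝 η).smallSets := by
    rw [tendsto_smallSets_iff]
    intro t ht
    obtain ⟨δ, hδ, hδt⟩ := Metric.mem_nhds_iff.1 ht
    filter_upwards [hpos, nhdsWithin_le_nhds (eventually_lt_nhds hδ)] with ε hε hεδ x hx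
    refine hδt (Metric.ball_subset_ball hεδ.le ?_)
    rw [Metric.mem_ball, dist_pi_lt_iff hε]
    exact hx
  have hvol : (fun ε => (vol k).real (box ε)) =ᶠ[𝓝[>] (0 : ℝ)] fun ε => ε ^ (2 * k) := by
    filter_upwards [hpos] with ε hε
    rw [measureReal_def, hbox, vol_box_ball η hε.le, ENNReal.toReal_ofReal (by positivity)]
  -- Averages over shrinking boxes converge to the value at a continuity point; the box has volume
  -- ε^(2k).
  have h1 := (continuousAt_pdet_orthoPoly n h).integral_sub_linear_isLittleO_ae (μ := vol k)
    ((measurable_pdet hK.measurable).stronglyMeasurable.stronglyMeasurableAtFilter) hsmall _ hvol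
  have h2 : Tendsto (fun ε : ℝ => ((gibbs n).real
      {ζ | ∀ j, 1 ≤ particleCount ζ (Metric.ball (η j) ε)}
      - ∫ x in box ε, pdet (finKernel (orthoPoly n)) x ∂vol k) / ε ^ (2 * k)) (𝓝[>] 0) (𝓝 0) := by
    -- After division by ε^(2k) the error from doubly occupied discs is O(ε²).
    have h3 : Tendsto (fun ε : ℝ => k * C ^ (k + 1) * ε ^ 2) (𝓝[>] 0) (𝓝 0) := by
      have : Continuous fun ε : ℝ => k * C ^ (k + 1) * ε ^ 2 := by fun_prop
      have h4 := (this.tendsto 0).mono_left (nhdsWithin_le_nhds (s := Set.Ioi 0))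
      simpa using h4
    refine squeeze_zero_norm' ?_ h3
    filter_upwards [hpos, exists_pairwise_disjoint_ball hη] with ε hε hd
    rw [norm_div, Real.norm_eq_abs, Real.norm_of_nonneg (by positivity), div_le_iff₀ (by positivity)]
    refine (abs_gibbs_sub_integral_le hK hε hd).trans_eq ?_
    ring
  refine Tendsto.limUnder_eq ?_
  have h3 := h2.add h1.tendsto_div_nhds_zero
  rw [add_zero] at h3
  have h4 := h3.add_const (pdet (finKernel (orthoPoly n)) η)
  rw [zero_add] at h4
  refine h4.congr' ?_
  filter_upwards [hpos] with ε hε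
  have : ε ^ (2 * k) ≠ 0 := by positivity
  simp only [smul_eq_mul]
  field_simp
  ring


/-! ### The rescaled kernel -/

/-- Gauge change: the factors come out of rows and columns as |u|², so the phase of u is free to be
chosen for convergence. -/
lemma pdet_conj_mul (K : ℂ → ℂ → ℂ) (u p : ℂ → ℂ) {ι : Type} [Fintype ι] [DecidableEq ι]
    (z : ι → ℂ) :
    pdet (fun z w => u z * K (p z) (p w) * (starRingEnd ℂ) (u w)) z
      = (∏ i, ‖u (z i)‖ ^ 2) * pdet K (p ∘ z) := by
  have h : kernelMatrix (fun z w => u z * K (p z) (p w) * (starRingEnd ℂ) (u w)) z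
      = Matrix.of fun i j => (starRingEnd ℂ) (u (z j)) *
        (Matrix.of fun i j => u (z i) * kernelMatrix K (p ∘ z) i j) i j := by
    ext i j
    simp only [kernelMatrix, Matrix.of_apply, Function.comp_apply]
    ring
  rw [pdet, h, Matrix.det_mul_row, Matrix.det_mul_column, ← mul_assoc, ← Finset.prod_mul_distrib]
  have h2 : ∏ i, (starRingEnd ℂ) (u (z i)) * u (z i) = ((∏ i, ‖u (z i)‖ ^ 2 : ℝ) : ℂ) := by
    push_cast
    exact Finset.prod_congr rfl fun i _ => Complex.conj_mul' _
  rw [h2, Complex.re_ofReal_mul, pdet]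

/-- The scaling about the boundary point `1`. -/
noncomputable def zoom (n : ℕ) (z : ℂ) : ℂ := 1 + z / (Real.sqrt n : ℂ)

/-- The normalizing factor of the rescaled kernel, with a phase that makes it converge. -/
noncomputable def phase (n : ℕ) (z : ℂ) : ℂ :=
  leftHalfPlane.indicator (fun _ => 1) z * ((Real.sqrt n)⁻¹ : ℝ)
    * Complex.exp (-(Real.sqrt n * z.im * Complex.I))

/-- The rescaled weighted orthonormal polynomials. -/
noncomputable def rescaledPoly (n : ℕ) (j : Fin n) (z : ℂ) : ℂ :=
  phase n z * orthoPoly n j (zoom n z)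

/-- The rescaled correlation kernel. -/
noncomputable def rescaledKernel (n : ℕ) : ℂ → ℂ → ℂ := finKernel (rescaledPoly n)

lemma rescaledKernel_eq (n : ℕ) : rescaledKernel n = fun z w =>
    phase n z * finKernel (orthoPoly n) (zoom n z) (zoom n w) * (starRingEnd ℂ) (phase n w) := by
  ext z w
  rw [rescaledKernel, finKernel, finKernel, Finset.mul_sum, Finset.sum_mul]
  refine Finset.sum_congr rfl fun j _ => ?_
  rw [rescaledPoly, rescaledPoly, map_mul]
  ring

lemma phase_of_notMem {n : ℕ} {z : ℂ} (h : z ∉ leftHalfPlane) : phase n z = 0 := by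
  rw [phase, Set.indicator_of_notMem h, zero_mul, zero_mul]

lemma norm_phase_of_mem {n : ℕ} {z : ℂ} (h : z ∈ leftHalfPlane) :
    ‖phase n z‖ = (Real.sqrt n)⁻¹ := by
  rw [phase, Set.indicator_of_mem h, one_mul, norm_mul, Complex.norm_exp, Complex.norm_real,
    Real.norm_of_nonneg (by positivity)]
  simp

lemma norm_phase_sq_of_mem {n : ℕ} {z : ℂ} (h : z ∈ leftHalfPlane) :
    ‖phase n z‖ ^ 2 = 1 / (n : ℝ) := by
  rw [norm_phase_of_mem h, inv_pow, Real.sq_sqrt (Nat.cast_nonneg n), one_div]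

lemma norm_phase_le_one {n : ℕ} (hn : 1 ≤ n) (z : ℂ) : ‖phase n z‖ ≤ 1 := by
  by_cases h : z ∈ leftHalfPlane
  · rw [norm_phase_of_mem h]
    refine inv_le_one_of_one_le₀ (Real.one_le_sqrt.2 ?_)
    exact_mod_cast hn
  · rw [phase_of_notMem h, norm_zero]
    exact zero_le_one

lemma measurableSet_leftHalfPlane : MeasurableSet leftHalfPlane :=
  measurableSet_lt Complex.measurable_re measurable_const

lemma measurable_phase (n : ℕ) : Measurable (phase n) := by
  unfold phase
  have h : Measurable (leftHalfPlane.indicator fun _ => (1 : ℂ)) :=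
    measurable_const.indicator measurableSet_leftHalfPlane
  refine (h.mul measurable_const).mul ?_
  have : Continuous fun z : ℂ => Complex.exp (-(Real.sqrt n * z.im * Complex.I)) := by fun_prop
  exact this.measurable

lemma measurable_zoom (n : ℕ) : Measurable (zoom n) := by
  unfold zoom
  fun_prop

lemma measurable_rescaledPoly (n : ℕ) (j : Fin n) : Measurable (rescaledPoly n j) :=
  (measurable_phase n).mul ((measurable_orthoPoly n j).comp (measurable_zoom n))

lemma measurable_rescaledKernel (n : ℕ) : Measurable (Function.uncurry (rescaledKernel n)) :=
  measurable_finKernel (measurable_rescaledPoly n)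

lemma normSq_zoom {n : ℕ} (hn : n ≠ 0) (z : ℂ) :
    ‖zoom n z‖ ^ 2 = 1 + 2 * z.re / Real.sqrt n + ‖z‖ ^ 2 / n := by
  have h0 : Real.sqrt n ≠ 0 := by positivity
  have h1 : Real.sqrt n ^ 2 = n := Real.sq_sqrt (Nat.cast_nonneg n)
  rw [← Complex.normSq_eq_norm_sq, ← Complex.normSq_eq_norm_sq, zoom, Complex.normSq_apply,
    Complex.normSq_apply]
  simp only [Complex.add_re, Complex.one_re, Complex.div_ofReal_re, Complex.add_im, Complex.one_im,
    Complex.div_ofReal_im, zero_add]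
  set s := Real.sqrt n
  rw [← h1]
  field_simp
  ring

/-- In the zoomed coordinate the open unit disc is tangent to the imaginary axis from the left, so
the indicator built into `phase` removes no interior point. -/
lemma mem_leftHalfPlane_of_norm_zoom_lt {n : ℕ} (hn : n ≠ 0) {z : ℂ} (h : ‖zoom n z‖ < 1) :
    z ∈ leftHalfPlane := by
  by_contra hz
  have hz' : 0 ≤ z.re := not_lt.1 hz
  have h1 := normSq_zoom hn z
  have h2 : ‖zoom n z‖ ^ 2 < 1 := by
    have := norm_nonneg (zoom n z)
    nlinarith
  have h3 : 0 ≤ 2 * z.re / Real.sqrt n := by positivity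
  have h4 : 0 ≤ ‖z‖ ^ 2 / n := by positivity
  linarith

/-- The intensities of the rescaled process are determinants of the rescaled kernel. -/
theorem rescaledIntensity_eq_pdet {n : ℕ} (hn : n ≠ 0) {k : ℕ} {z : Fin k → ℂ}
    (h : ∀ i, ‖zoom n (z i)‖ ≠ 1) : rescaledIntensity n k z = pdet (rescaledKernel n) z := by
  have h1 : jointIntensity n k (fun j => 1 + z j / (Real.sqrt n : ℂ))
      = pdet (finKernel (orthoPoly n)) (zoom n ∘ z) := jointIntensity_eq_pdet n k h
  rw [rescaledIntensity, h1, rescaledKernel_eq, pdet_conj_mul]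
  by_cases hz : ∀ i, z i ∈ leftHalfPlane
  · congr 1
    simp only [norm_phase_sq_of_mem (hz _), Finset.prod_const, Finset.card_univ, Fintype.card_fin]
    rw [one_div_pow]
  · push Not at hz
    obtain ⟨i, hi⟩ := hz
    have h2 : 1 < ‖zoom n (z i)‖ := lt_of_le_of_ne
      (not_lt.1 fun hlt => hi (mem_leftHalfPlane_of_norm_zoom_lt hn hlt)) (h i).symm
    have h3 : pdet (finKernel (orthoPoly n)) (zoom n ∘ z) = 0 := by
      refine pdet_eq_zero_of_row _ i fun w => ?_
      rw [finKernel]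
      exact Finset.sum_eq_zero fun j _ => by
        rw [Function.comp_apply, orthoPoly_of_lt j h2, zero_mul]
    rw [h3, mul_zero, mul_zero]

lemma ae_norm_zoom_ne_one {n : ℕ} (hn : n ≠ 0) : ∀ᵐ z : ℂ, ‖zoom n z‖ ≠ 1 := by
  have h0 : Real.sqrt n ≠ 0 := by positivity
  have h0' : (Real.sqrt n : ℂ) ≠ 0 := by exact_mod_cast h0
  have h1 : ∀ᵐ z : ℂ, z ∉ Metric.sphere (-(Real.sqrt n : ℂ)) (Real.sqrt n) :=
    measure_eq_zero_iff_ae_notMem.1 (Measure.addHaar_sphere volume _ _)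
  filter_upwards [h1] with z hz h2
  refine hz ?_
  rw [mem_sphere_iff_norm, sub_neg_eq_add]
  have h3 : z + (Real.sqrt n : ℂ) = Real.sqrt n * zoom n z := by
    rw [zoom]
    field_simp
    ring
  rw [h3, norm_mul, h2, mul_one, Complex.norm_real, Real.norm_of_nonneg (Real.sqrt_nonneg _)]

lemma lam_absolutelyContinuous : lam ≪ volume := Measure.smul_absolutelyContinuous

lemma integral_lam_zoom {n : ℕ} (hn : n ≠ 0) (f : ℂ → ℂ) :
    ∫ z, f (zoom n z) ∂lam = (n : ℂ) * ∫ z, f z ∂lam := by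
  have h0 : Real.sqrt n ≠ 0 := by positivity
  have h1 : ∀ z, f (zoom n z) = (fun y => f (1 + y)) ((Real.sqrt n)⁻¹ • z) := by
    intro z
    simp only [zoom, Complex.real_smul, Complex.ofReal_inv]
    rw [div_eq_inv_mul]
  simp only [h1]
  rw [lam, integral_smul_measure, integral_smul_measure,
    Measure.integral_comp_smul volume (fun y => f (1 + y)), integral_add_left_eq_self,
    Complex.finrank_real_complex, inv_pow, inv_inv, Real.sq_sqrt (Nat.cast_nonneg n),
    abs_of_nonneg (Nat.cast_nonneg n), smul_comm]
  rw [Complex.real_smul]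
  simp

lemma integrable_lam_zoom {n : ℕ} (hn : n ≠ 0) {f : ℂ → ℂ} (hf : Integrable f lam) :
    Integrable (fun z => f (zoom n z)) lam := by
  have h0 : (Real.sqrt n)⁻¹ ≠ 0 := by positivity
  have hpi : ENNReal.ofReal Real.pi⁻¹ ≠ 0 := by
    rw [Ne, ENNReal.ofReal_eq_zero, not_le]
    exact inv_pos.2 Real.pi_pos
  have h1 : ∀ z, f (zoom n z) = (fun y => f (1 + y)) ((Real.sqrt n)⁻¹ • z) := by
    intro z
    simp only [zoom, Complex.real_smul, Complex.ofReal_inv]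
    rw [div_eq_inv_mul]
  simp only [h1]
  rw [lam, integrable_smul_measure hpi ENNReal.ofReal_ne_top] at hf ⊢
  exact (hf.comp_add_left 1).comp_smul h0

/-- Only almost everywhere: on the unit circle the cut-off by the half plane and that by the closed
disc can disagree. -/
lemma rescaledPoly_mul_conj_ae {n : ℕ} (hn : n ≠ 0) (j l : Fin n) :
    (fun z => rescaledPoly n j z * (starRingEnd ℂ) (rescaledPoly n l z)) =ᵐ[lam] fun z =>
      (n : ℂ)⁻¹ * (orthoPoly n j (zoom n z) * (starRingEnd ℂ) (orthoPoly n l (zoom n z))) := by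
  filter_upwards [lam_absolutelyContinuous.ae_le (ae_norm_zoom_ne_one hn)] with z hz
  by_cases h : z ∈ leftHalfPlane
  · have h1 : phase n z * (starRingEnd ℂ) (phase n z) = (n : ℂ)⁻¹ := by
      rw [Complex.mul_conj', ← Complex.ofReal_pow, norm_phase_sq_of_mem h]
      simp
    rw [rescaledPoly, rescaledPoly, map_mul, ← h1]
    ring
  · have h2 : 1 < ‖zoom n z‖ := lt_of_le_of_ne
      (not_lt.1 fun hlt => h (mem_leftHalfPlane_of_norm_zoom_lt hn hlt)) hz.symm
    simp [rescaledPoly, orthoPoly_of_lt _ h2]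

theorem isOrthonormalFamily_rescaledPoly {n : ℕ} (hn : n ≠ 0) :
    IsOrthonormalFamily (rescaledPoly n) lam where
  measurable := measurable_rescaledPoly n
  integrable j l := by
    rw [integrable_congr (rescaledPoly_mul_conj_ae hn j l)]
    exact (integrable_lam_zoom hn (integrable_orthoPoly_mul n j l)).const_mul _
  integral_eq j l := by
    rw [integral_congr_ae (rescaledPoly_mul_conj_ae hn j l), integral_const_mul,
      integral_lam_zoom hn fun x => orthoPoly n j x * (starRingEnd ℂ) (orthoPoly n l x),
      (isOrthonormalFamily_orthoPoly n).integral_eq, ← mul_assoc,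
      inv_mul_cancel₀ (by exact_mod_cast hn), one_mul]

lemma isBoundedKernel_rescaledKernel {n : ℕ} (hn : n ≠ 0) :
    IsBoundedKernel (rescaledKernel n) (∑ j : Fin n, (monomialNorm n j)⁻¹) where
  pos := isPosKernel_finKernel _
  measurable := measurable_rescaledKernel n
  nonneg := (isBoundedKernel_orthoPoly n).nonneg
  norm_le z := by
    have h1 := norm_phase_le_one (Nat.one_le_iff_ne_zero.2 hn) z
    have h2 := (isBoundedKernel_orthoPoly n).norm_le (zoom n z)
    rw [rescaledKernel_eq]
    simp only [norm_mul, RCLike.norm_conj]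
    calc ‖phase n z‖ * ‖finKernel (orthoPoly n) (zoom n z) (zoom n z)‖ * ‖phase n z‖
        ≤ 1 * ‖finKernel (orthoPoly n) (zoom n z) (zoom n z)‖ * 1 := by gcongr
      _ ≤ _ := by simpa using h2


/-! ### Elementary limits and bounds -/

lemma logTaylor_three (u : ℂ) : Complex.logTaylor (2 + 1) u = u - u ^ 2 / 2 := by
  rw [Complex.logTaylor_succ, Complex.logTaylor_succ, Complex.logTaylor_succ, Complex.logTaylor_zero]
  simp only [Pi.add_apply]
  norm_num
  ring

lemma norm_log_sub_le {u : ℂ} (hu : ‖u‖ ≤ 1 / 2) :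
    ‖Complex.log (1 + u) - (u - u ^ 2 / 2)‖ ≤ ‖u‖ ^ 3 := by
  have h := Complex.norm_log_sub_logTaylor_le 2 (z := u) (by linarith)
  rw [logTaylor_three] at h
  refine h.trans ?_
  have h1 : (1 - ‖u‖)⁻¹ ≤ 2 := by
    rw [inv_le_comm₀ (by linarith) two_pos]
    linarith
  have h2 : 0 ≤ ‖u‖ ^ 3 := by positivity
  norm_num
  nlinarith

/-- A second order version of `(1 + a / n) ^ n → exp a`. -/
lemma tendsto_one_add_pow_mul_exp {ι : Type*} {l : Filter ι} {N j : ι → ℕ} {a b : ι → ℂ} {A B : ℂ}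
    {t : ℝ} (hN : Tendsto N l atTop) (ha : Tendsto a l (𝓝 A)) (hb : Tendsto b l (𝓝 B))
    (hj : Tendsto (fun i => ((j i : ℝ) - N i) / Real.sqrt (N i)) l (𝓝 t)) :
    Tendsto (fun i => (1 + a i / (Real.sqrt (N i) : ℂ) + b i / (N i : ℂ)) ^ j i
      * Complex.exp (-((Real.sqrt (N i) : ℂ) * a i))) l
      (𝓝 (Complex.exp (B - A ^ 2 / 2 + t * A))) := by
  set x : ι → ℝ := fun i => Real.sqrt (N i) with hx
  set s : ι → ℂ := fun i => ((((j i : ℝ) - N i) / x i : ℝ) : ℂ) with hs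
  have hx_top : Tendsto x l atTop :=
    Real.tendsto_sqrt_atTop.comp (tendsto_natCast_atTop_atTop.comp hN)
  have hinv : Tendsto (fun i => ((x i : ℂ))⁻¹) l (𝓝 0) := by
    have := (Complex.continuous_ofReal.tendsto 0).comp (tendsto_inv_atTop_zero.comp hx_top)
    simpa only [Function.comp_def, Complex.ofReal_inv, Complex.ofReal_zero] using this
  have hst : Tendsto s l (𝓝 (t : ℂ)) := (Complex.continuous_ofReal.tendsto t).comp hj
  -- The base becomes 1 + v/√N with v → A, and below j = N + s√N with s → t.
  set v : ι → ℂ := fun i => a i + b i * (x i : ℂ)⁻¹ with hv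
  have hvA : Tendsto v l (𝓝 A) := by
    have := ha.add (hb.mul hinv)
    simpa using this
  set u : ι → ℂ := fun i => v i * (x i : ℂ)⁻¹ with hu
  have hu0 : Tendsto u l (𝓝 0) := by
    have := hvA.mul hinv
    simpa using this
  have hx1 : ∀ᶠ i in l, 0 < x i := hx_top.eventually_gt_atTop 0
  have hu1 : ∀ᶠ i in l, ‖u i‖ < 1 / 2 := by
    have := hu0.norm
    rw [norm_zero] at this
    exact this.eventually_lt_const (by norm_num)
  set E : ι → ℂ := fun i => Complex.log (1 + u i) - (u i - u i ^ 2 / 2) with hE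
  have hmain : Tendsto (fun i => b i + s i * a i + s i * b i * (x i : ℂ)⁻¹
      - (1 + s i * (x i : ℂ)⁻¹) * v i ^ 2 / 2 + (j i : ℂ) * E i) l
      (𝓝 (B - A ^ 2 / 2 + t * A)) := by
    -- The cubic remainder of the logarithm is O(N^(-3/2)), and j is of order N.
    have h1 : Tendsto (fun i => (j i : ℂ) * E i) l (𝓝 0) := by
      have h2 : Tendsto (fun i => ‖1 + s i * (x i : ℂ)⁻¹‖ * ‖v i‖ ^ 3 * ‖(x i : ℂ)⁻¹‖) l (𝓝 0) := by
        have := (((hst.mul hinv).const_add 1).norm.mul (hvA.norm.pow 3)).mul hinv.norm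
        simpa using this
      refine squeeze_zero_norm' ?_ h2
      filter_upwards [hx1, hu1] with i hi hui
      have hxc : (x i : ℂ) ≠ 0 := by exact_mod_cast hi.ne'
      have hsq : (x i) ^ 2 = N i := Real.sq_sqrt (Nat.cast_nonneg _)
      have h3 : (j i : ℂ) = (x i : ℂ) ^ 2 * (1 + s i * (x i : ℂ)⁻¹) := by
        have : (j i : ℝ) = (x i) ^ 2 * (1 + ((j i : ℝ) - N i) / x i * (x i)⁻¹) := by
          rw [← hsq]
          field_simp
          ring
        have h4 := congrArg Complex.ofReal this
        simp only [hs]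
        push_cast at h4 ⊢
        exact h4
      rw [norm_mul]
      calc ‖(j i : ℂ)‖ * ‖E i‖ ≤ ‖(j i : ℂ)‖ * ‖u i‖ ^ 3 := by
            gcongr
            exact norm_log_sub_le hui.le
        _ = _ := by
            rw [h3, hu]
            simp only [norm_mul, norm_pow, norm_inv, Complex.norm_real]
            have : ‖x i‖ ≠ 0 := norm_ne_zero_iff.2 hi.ne'
            field_simp
    have h4 := (((hb.add (hst.mul ha)).add ((hst.mul hb).mul hinv)).sub
      ((((hst.mul hinv).const_add 1).mul (hvA.pow 2)).div_const 2)).add h1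
    convert h4 using 2
    ring
  refine ((Complex.continuous_exp.tendsto _).comp hmain).congr' ?_
  filter_upwards [hx1, hu1] with i hi hui
  have hxc : (x i : ℂ) ≠ 0 := by exact_mod_cast hi.ne'
  have hsq : (x i : ℂ) ^ 2 = N i := by
    have : (x i) ^ 2 = N i := Real.sq_sqrt (Nat.cast_nonneg _)
    exact_mod_cast this
  have h3 : (j i : ℂ) = (x i : ℂ) ^ 2 + s i * x i := by
    have h5 : s i * x i = j i - N i := by
      rw [hs]
      push_cast
      field_simp
    rw [h5, hsq]
    ring
  have hne : 1 + u i ≠ 0 := by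
    intro h0
    have : u i = -1 := by linear_combination h0
    rw [this] at hui
    norm_num at hui
  have h6 : 1 + a i / (x i : ℂ) + b i / (N i : ℂ) = 1 + u i := by
    rw [← hsq, hu, hv]
    field_simp
    ring
  rw [Function.comp_apply, h6]
  have h7 : (1 + u i) ^ j i = Complex.exp (j i * Complex.log (1 + u i)) := by
    rw [Complex.exp_nat_mul, Complex.exp_log hne]
  rw [h7, ← Complex.exp_add]
  congr 1
  have h8 : Complex.log (1 + u i) = u i - u i ^ 2 / 2 + E i := by
    rw [hE]
    ring
  rw [h8]
  have h9 : (j i : ℂ) * (u i - u i ^ 2 / 2) - x i * a i = b i + s i * a i + s i * b i * (x i : ℂ)⁻¹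
      - (1 + s i * (x i : ℂ)⁻¹) * v i ^ 2 / 2 := by
    rw [h3, hu, hv]
    field_simp
    ring
  linear_combination -h9

lemma one_sub_le_exp {x : ℝ} (h0 : 0 ≤ x) (h1 : x ≤ 1) : 1 - x ≤ Real.exp (-x - x ^ 2 / 2) := by
  rcases eq_or_lt_of_le h1 with rfl | h1
  · rw [sub_self]
    positivity
  · have h := Real.hasSum_pow_div_log_of_abs_lt_one (by rwa [abs_of_nonneg h0])
    have h2 := sum_le_hasSum (Finset.range 2) (fun i _ => by positivity) h
    rw [← Real.log_le_iff_le_exp (by linarith)]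
    norm_num [Finset.sum_range_succ] at h2
    linarith

lemma exp_le_one_sub {x : ℝ} (h1 : x ≤ 1 / 2) :
    Real.exp (-x - 2 * x ^ 2) ≤ 1 - x := by
  have h2 : 0 < 1 - x := by linarith
  rw [← Real.le_log_iff_exp_le h2]
  refine le_trans ?_ (Real.one_sub_inv_le_log_of_pos h2)
  have h3 : (1 - x)⁻¹ ≤ 1 + x + 2 * x ^ 2 := by
    rw [inv_le_iff_one_le_mul₀ h2]
    nlinarith [mul_nonneg (sq_nonneg x) (by linarith : 0 ≤ 1 - 2 * x)]
  linarith

lemma integrable_exp_sub_sq {c : ℝ} (hc : 0 < c) (T : ℝ) :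
    Integrable fun y : ℝ => Real.exp (T * y - c * y ^ 2) := by
  have h := ((integrable_exp_neg_mul_sq hc).comp_sub_right (T / (2 * c))).const_mul
    (Real.exp (T ^ 2 / (4 * c)))
  refine h.congr (Eventually.of_forall fun y => ?_)
  simp only
  rw [← Real.exp_add]
  congr 1
  field_simp
  ring

/-! ### The limit of the norms of the monomials -/

/-- The Gaussian integral that is the limit of the rescaled norms of the monomials. -/
noncomputable def edgeNorm (t : ℝ) : ℝ := ∫ y in Set.Ioi (0 : ℝ), Real.exp (-(t * y) - y ^ 2 / 2)

/-- The substitution s = 1 - y/√n zooms in on the edge s = 1, which carries the mass when n - j is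
of order √n. -/
lemma sqrt_mul_monomialNorm {n : ℕ} (hn : n ≠ 0) (j : ℕ) :
    Real.sqrt n * Real.exp n * monomialNorm n j
      = ∫ y in Set.Ioi (0 : ℝ), (Set.Iic (Real.sqrt n)).indicator
        (fun y => (1 - y / Real.sqrt n) ^ j * Real.exp (Real.sqrt n * y)) y := by
  have h0 : 0 < Real.sqrt n := by positivity
  have hsq : Real.sqrt n * Real.sqrt n = n := Real.mul_self_sqrt (Nat.cast_nonneg n)
  have h1 := intervalIntegral.integral_comp_sub_div (a := 0) (b := Real.sqrt n)
    (fun s : ℝ => s ^ j * Real.exp (-(n * s))) h0.ne' 1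
  rw [zero_div, sub_zero, div_self h0.ne', sub_self, intervalIntegral.integral_of_le h0.le,
    intervalIntegral.integral_of_le zero_le_one, smul_eq_mul] at h1
  rw [setIntegral_indicator measurableSet_Iic, Set.Ioi_inter_Iic, mul_comm (Real.sqrt n), mul_assoc,
    monomialNorm, ← h1, ← integral_const_mul]
  refine integral_congr_ae (Eventually.of_forall fun y => ?_)
  simp only
  rw [mul_left_comm, ← Real.exp_add]
  congr 2
  field_simp
  rw [Real.sq_sqrt (Nat.cast_nonneg n)]
  ring

lemma tendsto_sqrt_mul_monomialNorm {j : ℕ → ℕ} {t : ℝ}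
    (hj : Tendsto (fun n : ℕ => ((j n : ℝ) - n) / Real.sqrt n) atTop (𝓝 t)) :
    Tendsto (fun n : ℕ => Real.sqrt n * Real.exp n * monomialNorm n (j n)) atTop
      (𝓝 (edgeNorm t)) := by
  have hsqrt : Tendsto (fun n : ℕ => Real.sqrt n) atTop atTop :=
    Real.tendsto_sqrt_atTop.comp tendsto_natCast_atTop_atTop
  have hev : ∀ᶠ n : ℕ in atTop, n ≠ 0 := eventually_ne_atTop 0
  have h1 : Tendsto (fun n : ℕ => ∫ y in Set.Ioi (0 : ℝ), (Set.Iic (Real.sqrt n)).indicator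
      (fun y => (1 - y / Real.sqrt n) ^ j n * Real.exp (Real.sqrt n * y)) y) atTop
      (𝓝 (edgeNorm t)) := by
    -- With s = (j - n)/√n the exponent is at most -s y - (1 + s/√n) y²/2. Eventually s > t - 1 and
    -- s/√n > -1/2, which gives this majorant.
    refine tendsto_integral_filter_of_dominated_convergence
      (fun y => Real.exp ((1 - t) * y - 1 / 4 * y ^ 2)) ?_ ?_ ?_ ?_
    · refine Eventually.of_forall fun n => Measurable.aestronglyMeasurable ?_
      refine Measurable.indicator ?_ measurableSet_Iic
      fun_prop
    · have hhalf : ∀ᶠ n : ℕ in atTop, -(1 / 2 : ℝ) < ((j n : ℝ) - n) / Real.sqrt n * (Real.sqrt n)⁻¹ := by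
        have := hj.mul (tendsto_inv_atTop_zero.comp hsqrt)
        rw [mul_zero] at this
        exact this.eventually_const_lt (by norm_num)
      filter_upwards [hev, hj.eventually_const_lt (show t - 1 < t by linarith), hhalf]
        with n hn hn1 hn2
      refine (ae_restrict_iff' measurableSet_Ioi).2 (Eventually.of_forall fun y hy => ?_)
      have hy0 : 0 < y := hy
      by_cases hyn : y ≤ Real.sqrt n
      · have h0 : 0 < Real.sqrt n := by positivity
        have hsq : Real.sqrt n ^ 2 = n := Real.sq_sqrt (Nat.cast_nonneg n)
        set x := Real.sqrt n with hx
        have hyx : y / x ≤ 1 := (div_le_one h0).2 hyn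
        have hyx0 : 0 ≤ y / x := by positivity
        rw [Set.indicator_of_mem (by exact hyn), Real.norm_of_nonneg
          (mul_nonneg (pow_nonneg (by linarith) _) (Real.exp_pos _).le)]
        have h2 : (1 - y / x) ^ j n ≤ Real.exp (-(y / x) - (y / x) ^ 2 / 2) ^ j n :=
          pow_le_pow_left₀ (by linarith) (one_sub_le_exp hyx0 hyx) _
        rw [← Real.exp_nat_mul] at h2
        refine (mul_le_mul_of_nonneg_right h2 (Real.exp_pos _).le).trans ?_
        rw [← Real.exp_add, Real.exp_le_exp]
        set s := ((j n : ℝ) - n) / x with hs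
        have h3 : (j n : ℝ) = x ^ 2 * (1 + s * x⁻¹) := by
          rw [hs, ← hsq]
          field_simp
          ring
        have h4 : (j n : ℝ) * (-(y / x) - (y / x) ^ 2 / 2) + x * y
            = -s * y - (1 + s * x⁻¹) * (y ^ 2 / 2) := by
          rw [h3]
          field_simp
          ring
        rw [h4]
        have h5 : 0 ≤ y ^ 2 / 2 := by positivity
        nlinarith [mul_le_mul_of_nonneg_right (show (1 / 2 : ℝ) ≤ 1 + s * x⁻¹ by linarith) h5,
          mul_le_mul_of_nonneg_right hn1.le hy0.le]
      · rw [Set.indicator_of_notMem (by exact hyn), norm_zero]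
        positivity
    · exact (integrable_exp_sub_sq (by norm_num) _).integrableOn
    · refine (ae_restrict_iff' measurableSet_Ioi).2 (Eventually.of_forall fun y hy => ?_)
      have hlim := tendsto_one_add_pow_mul_exp (N := fun n : ℕ => n) (a := fun _ => ((-y : ℝ) : ℂ))
        (b := fun _ => 0) tendsto_id tendsto_const_nhds tendsto_const_nhds hj
      have hre := (Complex.continuous_re.tendsto _).comp hlim
      have e1 : (Complex.exp (0 - ((-y : ℝ) : ℂ) ^ 2 / 2 + t * ((-y : ℝ) : ℂ))).re
          = Real.exp (-(t * y) - y ^ 2 / 2) := by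
        rw [← Complex.exp_ofReal_re]
        congr 2
        push_cast
        ring
      rw [e1] at hre
      refine hre.congr' ?_
      filter_upwards [hsqrt.eventually_ge_atTop y] with n hn
      rw [Set.indicator_of_mem (by exact hn), Function.comp_apply]
      have e2 : (1 + ((-y : ℝ) : ℂ) / (Real.sqrt n : ℂ) + 0 / (n : ℂ)) ^ j n
          * Complex.exp (-((Real.sqrt n : ℂ) * ((-y : ℝ) : ℂ)))
          = (((1 - y / Real.sqrt n) ^ j n * Real.exp (Real.sqrt n * y) : ℝ) : ℂ) := by
        push_cast
        congr 1
        · congr 1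
          ring
        · congr 1
          ring
      rw [e2, Complex.ofReal_re]
  refine h1.congr' ?_
  filter_upwards [hev] with n hn
  exact (sqrt_mul_monomialNorm hn _).symm


/-! ### The plasma functions -/

/-- The standard Gaussian density. -/
noncomputable def realGaussian (v : ℝ) : ℝ := (Real.sqrt (2 * Real.pi))⁻¹ * Real.exp (-(1 / 2) * v ^ 2)

lemma gaussian_ofReal (v : ℝ) : gaussian v = realGaussian v := by
  rw [gaussian, realGaussian]
  push_cast
  rw [one_div]
  congr 2
  ring

lemma realGaussian_pos (v : ℝ) : 0 < realGaussian v := by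
  unfold realGaussian
  positivity

lemma integrable_realGaussian : Integrable realGaussian :=
  (integrable_exp_neg_mul_sq (by norm_num)).const_mul _

lemma integral_realGaussian : ∫ v, realGaussian v = 1 := by
  unfold realGaussian
  rw [integral_const_mul, integral_gaussian, show Real.pi / (1 / 2) = 2 * Real.pi by ring]
  exact inv_mul_cancel₀ (by positivity)

lemma integral_Ioi_realGaussian : ∫ v in Set.Ioi (0 : ℝ), realGaussian v = 1 / 2 := by
  unfold realGaussian
  rw [integral_const_mul, integral_gaussian_Ioi, show Real.pi / (1 / 2) = 2 * Real.pi by ring,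
    mul_div_assoc', inv_mul_cancel₀ (by positivity)]

/-- The tail of the standard Gaussian. -/
noncomputable def gaussianTail (t : ℝ) : ℝ := ∫ v in Set.Ioi t, realGaussian v

lemma freePlasma_ofReal (t : ℝ) : freePlasma t = gaussianTail t := by
  have h1 : ∀ s : ℝ, gaussian ((t : ℂ) - s) * (Set.Iio (0 : ℝ)).indicator (fun _ => (1 : ℂ)) s
      = (((Set.Ioi t).indicator realGaussian (t - s) : ℝ) : ℂ) := by
    intro s
    rw [← Complex.ofReal_sub, gaussian_ofReal]
    by_cases h : s < 0
    · have h' : t - s ∈ Set.Ioi t := by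
        rw [Set.mem_Ioi]
        linarith
      rw [Set.indicator_of_mem (by exact h), Set.indicator_of_mem h', mul_one]
    · have h' : t - s ∉ Set.Ioi t := by
        rw [Set.mem_Ioi]
        linarith
      rw [Set.indicator_of_notMem (by exact h), Set.indicator_of_notMem h', mul_zero,
        Complex.ofReal_zero]
  rw [freePlasma, gaussianConv]
  simp only [h1]
  rw [integral_complex_ofReal,
    integral_sub_left_eq_self (fun s => (Set.Ioi t).indicator realGaussian s) volume t,
    integral_indicator measurableSet_Ioi, gaussianTail]

lemma half_le_gaussianTail {t : ℝ} (ht : t ≤ 0) : 1 / 2 ≤ gaussianTail t := by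
  rw [← integral_Ioi_realGaussian]
  exact setIntegral_mono_set integrable_realGaussian.integrableOn
    (Eventually.of_forall fun v => (realGaussian_pos v).le) (Set.Ioi_subset_Ioi ht).eventuallyLE

/-- Completing the square; `gaussianTail` is the function F on the real axis. -/
lemma edgeNorm_eq (t : ℝ) :
    edgeNorm t = Real.sqrt (2 * Real.pi) * Real.exp (t ^ 2 / 2) * gaussianTail t := by
  have h1 : gaussianTail t = ∫ y, (Set.Ioi t).indicator realGaussian (t + y) := by
    rw [integral_add_left_eq_self, integral_indicator measurableSet_Ioi, gaussianTail]
  have h2 : ∀ y, (Set.Ioi t).indicator realGaussian (t + y)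
      = (Set.Ioi 0).indicator (fun y => realGaussian (t + y)) y := by
    intro y
    by_cases h : 0 < y
    · rw [Set.indicator_of_mem (by simpa using h), Set.indicator_of_mem (by exact h)]
    · rw [Set.indicator_of_notMem (by simpa using h), Set.indicator_of_notMem (by exact h)]
  rw [h1]
  simp only [h2]
  rw [integral_indicator measurableSet_Ioi, ← integral_const_mul, edgeNorm]
  refine integral_congr_ae (Eventually.of_forall fun y => ?_)
  simp only [realGaussian]
  have h3 : Real.sqrt (2 * Real.pi) ≠ 0 := by positivity
  rw [mul_mul_mul_comm, mul_inv_cancel₀ h3, one_mul, ← Real.exp_add]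
  congr 1
  ring

lemma edgeNorm_pos {t : ℝ} (ht : t ≤ 0) : 0 < edgeNorm t := by
  rw [edgeNorm_eq]
  have := half_le_gaussianTail ht
  have h2 : 0 < gaussianTail t := by linarith
  positivity

/-- For t < 0 one has F(t) ≥ 1/2, so on the real axis a function bounded by 2 is averaged against a
probability density. -/
lemma norm_hardPlasma_ofReal_le (x : ℝ) : ‖hardPlasma x‖ ≤ 2 := by
  have h1 : ∀ t : ℝ, ‖gaussian ((x : ℂ) - t)
      * (Set.Iio (0 : ℝ)).indicator (fun t => 1 / freePlasma (t : ℂ)) t‖ ≤ 2 * realGaussian (x - t) := by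
    intro t
    have h0 := (realGaussian_pos (x - t)).le
    rw [← Complex.ofReal_sub, gaussian_ofReal, norm_mul, Complex.norm_real, Real.norm_of_nonneg h0,
      mul_comm]
    refine mul_le_mul_of_nonneg_right ?_ h0
    by_cases h : t < 0
    · have h2 := half_le_gaussianTail h.le
      rw [Set.indicator_of_mem (by exact h), freePlasma_ofReal, norm_div, norm_one,
        Complex.norm_real, Real.norm_of_nonneg (by linarith), div_le_iff₀ (by linarith)]
      linarith
    · rw [Set.indicator_of_notMem (by exact h), norm_zero]
      exact zero_le_two
  have h2 : Integrable fun t => 2 * realGaussian (x - t) :=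
    (integrable_realGaussian.comp_sub_left x).const_mul 2
  have h3 := norm_integral_le_of_norm_le h2 (Eventually.of_forall h1)
  rw [integral_const_mul, integral_sub_left_eq_self, integral_realGaussian, mul_one] at h3
  exact h3

lemma norm_hardKernel_diag_le (z : ℂ) : ‖hardKernel z z‖ ≤ 2 := by
  have h1 : ‖leftHalfPlane.indicator (fun _ => (1 : ℂ)) z‖ ≤ 1 :=
    (norm_indicator_le_norm_self _ _).trans (by simp)
  have h2 : ginibreKernel z z = 1 := by
    rw [ginibreKernel, Complex.mul_conj', ← Complex.exp_zero]
    congr 1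
    ring
  have h3 : ‖hardPlasma (z + (starRingEnd ℂ) z)‖ ≤ 2 := by
    rw [Complex.add_conj]
    exact norm_hardPlasma_ofReal_le _
  rw [hardKernel, h2, one_mul, norm_mul, norm_mul]
  calc ‖hardPlasma (z + (starRingEnd ℂ) z)‖ * ‖leftHalfPlane.indicator (fun _ => (1 : ℂ)) z‖
        * ‖leftHalfPlane.indicator (fun _ => (1 : ℂ)) z‖ ≤ 2 * 1 * 1 := by gcongr
    _ = 2 := by norm_num

/-! ### Uniform bounds -/

/-- Here x = √n, τ = (n - j)/√n, r = |ζ|² within c/√n of 1, and the right side bounds from below the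
logarithmic gain of s^j e^(-ns) when s moves from r to r - y/x. The gain yτ faces losses 2cy and
8y²; at y = τ/32 what exceeds τ²/128 - c²/16 is the square (τ/8 - c/4)², and the shift of y by at
most 1 costs at most 2c + 8. -/
lemma exponent_bound {x τ r y c : ℝ} (hx : 0 < x) (hr : 1 / 2 ≤ r) (hr1 : r ≤ 1)
    (hrc : 1 - c / x ≤ r)
    (hτ : 0 ≤ τ) (hc : 0 ≤ c) (h1 : τ / 32 ≤ y) (h2 : y ≤ τ / 32 + 1) :
    τ ^ 2 / 128 - (c ^ 2 / 16 + 2 * c + 8)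
      ≤ (x ^ 2 - τ * x) * (-(y / (r * x)) - 2 * (y / (r * x)) ^ 2) + x * y := by
  have hr0 : 0 < r := by linarith
  have hy : 0 ≤ y := by linarith [div_nonneg hτ (by norm_num : (0 : ℝ) ≤ 32)]
  have e1 : (x ^ 2 - τ * x) * (-(y / (r * x)) - 2 * (y / (r * x)) ^ 2) + x * y
      = y * (τ - x * (1 - r)) * r⁻¹ - 2 * y ^ 2 * r⁻¹ ^ 2 + 2 * (τ / x) * (y * r⁻¹) ^ 2 := by
    field_simp
    ring
  have hxr : x * (1 - r) ≤ c := by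
    have := mul_le_mul_of_nonneg_left hrc hx.le
    rw [mul_sub, mul_div_cancel₀ _ hx.ne'] at this
    linarith
  have hinv1 : r⁻¹ ≤ 2 := by
    rw [inv_le_comm₀ hr0 two_pos]
    linarith
  have hinv0 : 0 < r⁻¹ := inv_pos.2 hr0
  have hinv2 : 1 ≤ r⁻¹ := (one_le_inv₀ hr0).2 hr1
  have e2 : y * τ - 2 * c * y ≤ y * (τ - x * (1 - r)) * r⁻¹ := by
    have h3 : y * (x * (1 - r)) * r⁻¹ ≤ y * c * 2 := by
      calc y * (x * (1 - r)) * r⁻¹ ≤ y * c * r⁻¹ := by gcongr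
        _ ≤ y * c * 2 := by gcongr
    have h4 : y * τ * 1 ≤ y * τ * r⁻¹ := by gcongr
    linarith
  have e3 : 2 * y ^ 2 * r⁻¹ ^ 2 ≤ 2 * y ^ 2 * 2 ^ 2 := by gcongr
  have e4 : 0 ≤ 2 * (τ / x) * (y * r⁻¹) ^ 2 := by positivity
  obtain ⟨δ, rfl⟩ : ∃ δ, y = τ / 32 + δ := ⟨y - τ / 32, by ring⟩
  have hδ0 : 0 ≤ δ := by linarith
  have hδ1 : δ ≤ 1 := by linarith
  have e5 : τ ^ 2 / 128 - (c ^ 2 / 16 + 2 * c + 8)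
      ≤ (τ / 32 + δ) * τ - 2 * c * (τ / 32 + δ) - 8 * (τ / 32 + δ) ^ 2 := by
    nlinarith [sq_nonneg (τ / 8 - c / 4), mul_nonneg hδ0 hτ, mul_le_mul_of_nonneg_left hδ1 hc,
      mul_le_mul_of_nonneg_left hδ1 hδ0]
  rw [e1]
  linarith

/-- A lower bound for the norms of the monomials. -/
lemma pow_mul_exp_le_monomialNorm {c : ℝ} (hc : 0 ≤ c) {n j : ℕ} (hjn : j ≤ n)
    (hn5 : 5 ≤ Real.sqrt n) (hnc : 2 * c ≤ Real.sqrt n) {r : ℝ} (hr : 1 - c / Real.sqrt n ≤ r)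
    (hr1 : r ≤ 1) :
    r ^ j * Real.exp (-(n * r)) ≤ Real.exp (c ^ 2 / 16 + 2 * c + 8
      - (((n : ℝ) - j) / Real.sqrt n) ^ 2 / 128) * (Real.sqrt n * monomialNorm n j) := by
  set x := Real.sqrt n with hx
  set τ := ((n : ℝ) - j) / x with hτ
  set D := c ^ 2 / 16 + 2 * c + 8 with hD
  have hx0 : 0 < x := by linarith
  have hsq : x ^ 2 = n := Real.sq_sqrt (Nat.cast_nonneg n)
  have hjn' : (j : ℝ) ≤ n := by exact_mod_cast hjn
  have hτ0 : 0 ≤ τ := div_nonneg (by linarith) hx0.le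
  have hτx : τ ≤ x := by
    rw [hτ, div_le_iff₀ hx0, ← sq, hsq]
    linarith [Nat.cast_nonneg (α := ℝ) j]
  have hj : (j : ℝ) = x ^ 2 - τ * x := by
    rw [hτ, hsq]
    field_simp
    ring
  have hr2 : 1 / 2 ≤ r := by
    have : c / x ≤ 1 / 2 := by
      rw [div_le_iff₀ hx0]
      linarith
    linarith
  have hr0 : 0 < r := by linarith
  -- On the window s = r - y/√n with τ/32 ≤ y < τ/32 + 1, of length 1/√n, the integrand is at least
  -- A. Since √n ≥ 5 and r ≥ 1/2, the window stays in (0,1], and its contribution A/√n bounds the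
  -- norm from below.
  set A := r ^ j * Real.exp (-(n * r)) * Real.exp (τ ^ 2 / 128 - D) with hA
  set s₁ := r - (τ / 32 + 1) / x with hs₁
  set s₂ := r - τ / 32 / x with hs₂
  have hquot : (τ / 32 + 1) / x ≤ 1 / 4 := by
    rw [div_le_iff₀ hx0]
    linarith
  have hs₂1 : s₂ ≤ 1 := by
    have : 0 ≤ τ / 32 / x := by positivity
    linarith
  have hpoint : ∀ s ∈ Set.Ioc s₁ s₂, A ≤ s ^ j * Real.exp (-(n * s)) := by
    rintro s ⟨h1, h2⟩
    obtain ⟨y, rfl⟩ : ∃ y, s = r - y / x := ⟨(r - s) * x, by field_simp; ring⟩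
    have hy1 : τ / 32 ≤ y := by
      have : τ / 32 / x ≤ y / x := by linarith
      exact (div_le_div_iff_of_pos_right hx0).1 this
    have hy2 : y ≤ τ / 32 + 1 := by
      have : y / x ≤ (τ / 32 + 1) / x := by linarith
      exact (div_le_div_iff_of_pos_right hx0).1 this
    have hy0 : 0 ≤ y := by linarith [div_nonneg hτ0 (by norm_num : (0 : ℝ) ≤ 32)]
    have hq : y / (r * x) ≤ 1 / 2 := by
      rw [div_le_iff₀ (by positivity)]
      nlinarith
    have hb := exponent_bound hx0 hr2 hr1 hr hτ0 hc hy1 hy2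
    rw [← hj] at hb
    have h3 : r - y / x = r * (1 - y / (r * x)) := by
      field_simp
    have h4 : Real.exp (-(y / (r * x)) - 2 * (y / (r * x)) ^ 2) ^ j ≤ (1 - y / (r * x)) ^ j :=
      pow_le_pow_left₀ (Real.exp_pos _).le (exp_le_one_sub hq) _
    rw [← Real.exp_nat_mul] at h4
    have h5 : Real.exp (-(n * (r - y / x))) = Real.exp (-(n * r)) * Real.exp (x * y) := by
      rw [← Real.exp_add, ← hsq]
      congr 1
      field_simp
      ring
    calc A = r ^ j * Real.exp (-(n * r)) * Real.exp (τ ^ 2 / 128 - D) := rfl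
      _ ≤ r ^ j * Real.exp (-(n * r)) *
          Real.exp (j * (-(y / (r * x)) - 2 * (y / (r * x)) ^ 2) + x * y) := by gcongr
      _ = r ^ j * Real.exp (-(n * r)) *
          (Real.exp (j * (-(y / (r * x)) - 2 * (y / (r * x)) ^ 2)) * Real.exp (x * y)) := by
          rw [Real.exp_add]
      _ ≤ r ^ j * Real.exp (-(n * r)) * ((1 - y / (r * x)) ^ j * Real.exp (x * y)) := by gcongr
      _ = (r - y / x) ^ j * Real.exp (-(n * (r - y / x))) := by
          rw [h5, h3, mul_pow]
          ring
  have hsub : Set.Ioc s₁ s₂ ⊆ Set.Ioc 0 1 := by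
    rintro s ⟨h1, h2⟩
    exact ⟨by linarith, h2.trans hs₂1⟩
  have hlen : s₂ - s₁ = x⁻¹ := by
    rw [hs₁, hs₂]
    field_simp
    ring
  have hint : A * x⁻¹ ≤ monomialNorm n j := by
    calc A * x⁻¹ = ∫ _ in Set.Ioc s₁ s₂, A := by
          rw [setIntegral_const, measureReal_def, Real.volume_Ioc, hlen,
            ENNReal.toReal_ofReal (by positivity), smul_eq_mul, mul_comm]
      _ ≤ ∫ s in Set.Ioc s₁ s₂, s ^ j * Real.exp (-(n * s)) :=
          setIntegral_mono_on (integrableOn_const (by simp)) ((integrableOn_monomial n j).mono_set hsub)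
            measurableSet_Ioc hpoint
      _ ≤ monomialNorm n j := by
          refine setIntegral_mono_set (integrableOn_monomial n j) ?_ hsub.eventuallyLE
          refine (ae_restrict_iff' measurableSet_Ioc).2 (Eventually.of_forall fun s hs => ?_)
          have := hs.1
          simp only [Pi.zero_apply]
          positivity
  have h6 : A ≤ x * monomialNorm n j := by
    have := mul_le_mul_of_nonneg_left hint hx0.le
    rwa [mul_left_comm, mul_inv_cancel₀ hx0.ne', mul_one] at this
  calc r ^ j * Real.exp (-(n * r)) = Real.exp (D - τ ^ 2 / 128) * A := by
        rw [hA, mul_left_comm, ← Real.exp_add]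
        rw [show D - τ ^ 2 / 128 + (τ ^ 2 / 128 - D) = 0 by ring, Real.exp_zero, mul_one]
    _ ≤ _ := by gcongr

/-- Gaussian decay in the distance from the top degree, uniform in n and in |z| ≤ R: |zoom|² ≥ 1 -
2R/√n, so the bound on the norms applies with c = 2R. -/
lemma norm_rescaledPoly_sq_le {R : ℝ} (hR : 0 ≤ R) {n : ℕ} (hn5 : 5 ≤ Real.sqrt n)
    (hnR : 4 * R ≤ Real.sqrt n) (j : Fin n) {z : ℂ} (hz : ‖z‖ ≤ R) :
    Real.sqrt n * ‖rescaledPoly n j z‖ ^ 2 ≤ Real.exp (R ^ 2 / 4 + 4 * R + 8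
      - (((n : ℝ) - j) / Real.sqrt n) ^ 2 / 128) := by
  have hx0 : 0 < Real.sqrt n := by linarith
  have hn : n ≠ 0 := by
    rintro rfl
    simp at hx0
  by_cases hL : z ∈ leftHalfPlane
  swap
  · rw [rescaledPoly, phase_of_notMem hL, zero_mul, norm_zero]
    simp only [ne_eq, OfNat.ofNat_ne_zero, not_false_eq_true, zero_pow, mul_zero]
    positivity
  by_cases h1 : ‖zoom n z‖ ≤ 1
  swap
  · rw [rescaledPoly, orthoPoly_of_lt j (not_le.1 h1), mul_zero, norm_zero]
    simp only [ne_eq, OfNat.ofNat_ne_zero, not_false_eq_true, zero_pow, mul_zero]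
    positivity
  have hh := monomialNorm_pos n j
  set r := ‖zoom n z‖ ^ 2 with hr
  have hr1 : r ≤ 1 := pow_le_one₀ (norm_nonneg _) h1
  have hrR : 1 - 2 * R / Real.sqrt n ≤ r := by
    rw [hr, normSq_zoom hn]
    have h2 : -R ≤ z.re := by
      have := (abs_le.1 (Complex.abs_re_le_norm z)).1
      linarith
    have h3 : 0 ≤ ‖z‖ ^ 2 / n := by positivity
    have h4 : 2 * (-R) / Real.sqrt n ≤ 2 * z.re / Real.sqrt n := by gcongr
    have h5 : 2 * (-R) / Real.sqrt n = -(2 * R / Real.sqrt n) := by ring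
    linarith
  have hb := pow_mul_exp_le_monomialNorm (c := 2 * R) (by linarith) j.2.le hn5 (by linarith) hrR hr1
  have e1 : Real.sqrt n * ‖rescaledPoly n j z‖ ^ 2
      = r ^ (j : ℕ) * Real.exp (-(n * r)) / (Real.sqrt n * monomialNorm n j) := by
    rw [rescaledPoly, norm_mul, mul_pow, norm_phase_sq_of_mem hL, norm_orthoPoly, rootWeight,
      if_pos h1, mul_pow, mul_pow, inv_pow, Real.sq_sqrt hh.le, ← Real.exp_nat_mul, ← pow_mul,
      mul_comm (j : ℕ) 2, pow_mul, ← hr,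
      show ((2 : ℕ) : ℝ) * (-(n * r) / 2) = -(n * r) by push_cast; ring]
    have hsq : Real.sqrt n * Real.sqrt n = n := Real.mul_self_sqrt (Nat.cast_nonneg n)
    set x := Real.sqrt n
    rw [← hsq]
    field_simp
  rw [e1, div_le_iff₀ (by positivity),
    show R ^ 2 / 4 + 4 * R + 8 = (2 * R) ^ 2 / 16 + 2 * (2 * R) + 8 by ring]
  exact hb


/-! ### The kernel as a Riemann sum -/

lemma integral_comp_floor {x : ℝ} (hx : 0 < x) {g : ℕ → ℂ} {n : ℕ} (hg : ∀ m, n ≤ m → g m = 0) :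
    ∫ τ in Set.Ici (0 : ℝ), g ⌊τ * x⌋₊ = (x : ℂ)⁻¹ * ∑ m ∈ Finset.range n, g m := by
  have h1 : Set.EqOn (fun τ : ℝ => g ⌊τ * x⌋₊) (fun τ => ∑ m ∈ Finset.range n,
      (Set.Ico ((m : ℝ) / x) ((m + 1 : ℝ) / x)).indicator (fun _ => g m) τ) (Set.Ici 0) := by
    intro τ hτ
    have hτ0 : 0 ≤ τ * x := mul_nonneg hτ hx.le
    have h2 : ∀ m : ℕ, τ ∈ Set.Ico ((m : ℝ) / x) ((m + 1 : ℝ) / x) ↔ ⌊τ * x⌋₊ = m := by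
      intro m
      rw [Nat.floor_eq_iff hτ0, Set.mem_Ico, div_le_iff₀ hx, lt_div_iff₀ hx]
    have h3 : ∀ m : ℕ, (Set.Ico ((m : ℝ) / x) ((m + 1 : ℝ) / x)).indicator (fun _ => g m) τ
        = if ⌊τ * x⌋₊ = m then g m else 0 := by
      intro m
      rw [Set.indicator_apply]
      simp only [h2]
    simp only [h3]
    rw [Finset.sum_ite_eq]
    split_ifs with h
    · rfl
    · exact hg _ (by simpa using h)
  rw [setIntegral_congr_fun measurableSet_Ici h1, integral_finsetSum, Finset.mul_sum]
  · refine Finset.sum_congr rfl fun m _ => ?_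
    have h4 : Set.Ici (0 : ℝ) ∩ Set.Ico ((m : ℝ) / x) ((m + 1 : ℝ) / x)
        = Set.Ico ((m : ℝ) / x) ((m + 1 : ℝ) / x) := by
      refine Set.inter_eq_right.2 fun τ hτ => ?_
      have : (0 : ℝ) ≤ m / x := by positivity
      exact this.trans hτ.1
    rw [setIntegral_indicator measurableSet_Ico, h4, setIntegral_const, measureReal_def,
      Real.volume_Ico, show (m + 1 : ℝ) / x - m / x = x⁻¹ by field_simp; ring,
      ENNReal.toReal_ofReal (by positivity), Complex.real_smul, Complex.ofReal_inv]
  · intro m _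
    refine ((integrable_indicator_iff measurableSet_Ico).2 (integrableOn_const ?_)).integrableOn
    simp

/-- The terms of the rescaled kernel, counted from the top degree. -/
noncomputable def kernelTerm (n : ℕ) (z w : ℂ) (m : ℕ) : ℂ :=
  if h : m < n then (Real.sqrt n : ℂ) * (rescaledPoly n (Fin.rev ⟨m, h⟩) z
    * (starRingEnd ℂ) (rescaledPoly n (Fin.rev ⟨m, h⟩) w)) else 0

/-- Degrees counted from the top have spacing 1/√n in τ. Writing the sum as the exact integral of a
step function makes dominated convergence available instead of a Riemann sum argument. -/
lemma rescaledKernel_eq_integral {n : ℕ} (hn : n ≠ 0) (z w : ℂ) :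
    rescaledKernel n z w = ∫ τ in Set.Ici (0 : ℝ), kernelTerm n z w ⌊τ * Real.sqrt n⌋₊ := by
  have h0 : 0 < Real.sqrt n := by positivity
  rw [integral_comp_floor h0 (n := n) fun m hm => by rw [kernelTerm, dif_neg (not_lt.2 hm)],
    Finset.sum_range]
  simp only [kernelTerm, Fin.is_lt, dite_true, Fin.eta]
  rw [← Finset.mul_sum, ← mul_assoc, inv_mul_cancel₀ (by exact_mod_cast h0.ne'), one_mul,
    rescaledKernel, finKernel]
  exact (Equiv.sum_comp Fin.revPerm fun j : Fin n =>
    rescaledPoly n j z * (starRingEnd ℂ) (rescaledPoly n j w)).symm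

/-- The off-diagonal product is at most the mean of the two squares. The index m counts degree n -
(m + 1), and m + 1 ≥ τ√n, so the bound at the actual degree is at least as good as at τ. -/
lemma norm_kernelTerm_le {R : ℝ} (hR : 0 ≤ R) {n : ℕ} (hn5 : 5 ≤ Real.sqrt n)
    (hnR : 4 * R ≤ Real.sqrt n) {z w : ℂ} (hz : ‖z‖ ≤ R) (hw : ‖w‖ ≤ R) {τ : ℝ} (hτ : 0 ≤ τ) :
    ‖kernelTerm n z w ⌊τ * Real.sqrt n⌋₊‖ ≤ Real.exp (R ^ 2 / 4 + 4 * R + 8 - τ ^ 2 / 128) := by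
  have hx0 : 0 < Real.sqrt n := by linarith
  rw [kernelTerm]
  split_ifs with h
  swap
  · rw [norm_zero]
    positivity
  set m := ⌊τ * Real.sqrt n⌋₊ with hm
  set j : Fin n := Fin.rev ⟨m, h⟩ with hj
  have hj' : ((n : ℝ) - (j : ℕ)) = m + 1 := by
    have h1 : (j : ℕ) + (m + 1) = n := by
      rw [hj, Fin.val_rev]
      simp only
      omega
    have h2 : ((j : ℕ) : ℝ) + (m + 1) = n := by exact_mod_cast h1
    linarith
  have hτm : τ ≤ ((n : ℝ) - (j : ℕ)) / Real.sqrt n := by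
    rw [hj', le_div_iff₀ hx0]
    exact (Nat.lt_floor_add_one _).le
  have hmono : Real.exp (R ^ 2 / 4 + 4 * R + 8 - (((n : ℝ) - (j : ℕ)) / Real.sqrt n) ^ 2 / 128)
      ≤ Real.exp (R ^ 2 / 4 + 4 * R + 8 - τ ^ 2 / 128) := by
    rw [Real.exp_le_exp]
    have : τ ^ 2 ≤ (((n : ℝ) - (j : ℕ)) / Real.sqrt n) ^ 2 := by gcongr
    linarith
  have h1 := (norm_rescaledPoly_sq_le hR hn5 hnR j hz).trans hmono
  have h2 := (norm_rescaledPoly_sq_le hR hn5 hnR j hw).trans hmono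
  rw [norm_mul, norm_mul, RCLike.norm_conj, Complex.norm_real, Real.norm_of_nonneg hx0.le]
  nlinarith [mul_nonneg hx0.le (sq_nonneg (‖rescaledPoly n j z‖ - ‖rescaledPoly n j w‖))]

/-- The phase completes √n Re z, coming from the weight, to √n z. In the kernel only the combination
z + conj w then carries the factor √n. -/
lemma rescaledPoly_eq {n : ℕ} (hn : n ≠ 0) (j : Fin n) {z : ℂ} (hL : z ∈ leftHalfPlane)
    (h1 : ‖zoom n z‖ ≤ 1) :
    rescaledPoly n j z = ((Real.sqrt n)⁻¹ * (Real.sqrt (monomialNorm n j))⁻¹ : ℝ)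
      * (zoom n z ^ (j : ℕ)
        * Complex.exp (-((n : ℂ) / 2) - Real.sqrt n * z - (‖z‖ : ℂ) ^ 2 / 2)) := by
  have hx0 : Real.sqrt n ≠ 0 := by positivity
  have hsq : Real.sqrt n ^ 2 = n := Real.sq_sqrt (Nat.cast_nonneg n)
  have h2 : Complex.exp (-(Real.sqrt n * z.im * Complex.I)) * (rootWeight n (zoom n z) : ℂ)
      = Complex.exp (-((n : ℂ) / 2) - Real.sqrt n * z - (‖z‖ : ℂ) ^ 2 / 2) := by
    rw [rootWeight, if_pos h1, Complex.ofReal_exp, ← Complex.exp_add, normSq_zoom hn]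
    congr 1
    have e1 : -(n * (1 + 2 * z.re / Real.sqrt n + ‖z‖ ^ 2 / n)) / 2
        = -(n / 2) - Real.sqrt n * z.re - ‖z‖ ^ 2 / 2 := by
      set x := Real.sqrt n
      rw [← hsq]
      field_simp
      ring
    rw [e1]
    push_cast
    linear_combination (Real.sqrt n : ℂ) * (Complex.re_add_im z).symm
  rw [rescaledPoly, phase, Set.indicator_of_mem hL, orthoPoly, ← h2]
  push_cast
  ring

/-- The product zoom z · conj (zoom w) is 1 + a/√n + b/n with a = z + conj w and b = z conj w, the
shape treated by `tendsto_one_add_pow_mul_exp`; the norm carries the matching √n e^n. -/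
lemma kernelTerm_eq {n : ℕ} (hn : n ≠ 0) {m : ℕ} (hm : m < n) {z w : ℂ} (hz : z ∈ leftHalfPlane)
    (hw : w ∈ leftHalfPlane) (hz1 : ‖zoom n z‖ ≤ 1) (hw1 : ‖zoom n w‖ ≤ 1) :
    kernelTerm n z w m = Complex.exp (-((‖z‖ : ℂ) ^ 2 / 2) - (‖w‖ : ℂ) ^ 2 / 2)
      * ((1 + (z + (starRingEnd ℂ) w) / (Real.sqrt n : ℂ) + z * (starRingEnd ℂ) w / (n : ℂ))
          ^ (n - (m + 1)) * Complex.exp (-((Real.sqrt n : ℂ) * (z + (starRingEnd ℂ) w))))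
      * ((Real.sqrt n * Real.exp n * monomialNorm n (n - (m + 1)) : ℝ) : ℂ)⁻¹ := by
  have hx0 : Real.sqrt n ≠ 0 := by positivity
  have hx0' : (Real.sqrt n : ℂ) ≠ 0 := by exact_mod_cast hx0
  have hsq : (Real.sqrt n : ℂ) ^ 2 = n := by exact_mod_cast Real.sq_sqrt (Nat.cast_nonneg n)
  have hval : ((Fin.rev (⟨m, hm⟩ : Fin n) : Fin n) : ℕ) = n - (m + 1) := Fin.val_rev _
  rw [kernelTerm, dif_pos hm, rescaledPoly_eq hn _ hz hz1, rescaledPoly_eq hn _ hw hw1, hval]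
  set h := monomialNorm n (n - (m + 1)) with hh
  have hpos : 0 < h := monomialNorm_pos n _
  have hsh : (Real.sqrt h : ℂ) ^ 2 = h := by exact_mod_cast Real.sq_sqrt hpos.le
  have hsh0 : (Real.sqrt h : ℂ) ≠ 0 := by exact_mod_cast (Real.sqrt_pos.2 hpos).ne'
  set J := n - (m + 1) with hJ
  have e1 : (1 + (z + (starRingEnd ℂ) w) / (Real.sqrt n : ℂ) + z * (starRingEnd ℂ) w / (n : ℂ))
      = zoom n z * (starRingEnd ℂ) (zoom n w) := by
    simp only [zoom, map_add, map_one, map_div₀, Complex.conj_ofReal]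
    rw [← hsq]
    field_simp
    ring
  have e2 : Complex.exp (-((n : ℂ) / 2) - Real.sqrt n * z - (‖z‖ : ℂ) ^ 2 / 2)
      * (starRingEnd ℂ) (Complex.exp (-((n : ℂ) / 2) - Real.sqrt n * w - (‖w‖ : ℂ) ^ 2 / 2))
      = Complex.exp (-((‖z‖ : ℂ) ^ 2 / 2) - (‖w‖ : ℂ) ^ 2 / 2)
        * Complex.exp (-((Real.sqrt n : ℂ) * (z + (starRingEnd ℂ) w))) * (Complex.exp n)⁻¹ := by
    rw [← Complex.exp_conj, ← Complex.exp_neg, ← Complex.exp_add, ← Complex.exp_add,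
      ← Complex.exp_add]
    congr 1
    simp only [map_sub, map_neg, map_div₀, map_mul, map_pow, Complex.conj_ofReal, map_natCast,
      map_ofNat]
    ring
  rw [e1, mul_pow]
  simp only [map_mul, Complex.conj_ofReal, map_pow]
  have e3 : (Real.sqrt n : ℂ) * (((Real.sqrt n)⁻¹ * (Real.sqrt h)⁻¹ : ℝ) : ℂ)
      * (((Real.sqrt n)⁻¹ * (Real.sqrt h)⁻¹ : ℝ) : ℂ) = ((Real.sqrt n : ℂ) * h)⁻¹ := by
    push_cast
    rw [← hsh]
    field_simp
  calc _ = ((Real.sqrt n : ℂ) * (((Real.sqrt n)⁻¹ * (Real.sqrt h)⁻¹ : ℝ) : ℂ)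
      * (((Real.sqrt n)⁻¹ * (Real.sqrt h)⁻¹ : ℝ) : ℂ))
      * (zoom n z ^ J * (starRingEnd ℂ) (zoom n w) ^ J)
      * (Complex.exp (-((n : ℂ) / 2) - Real.sqrt n * z - (‖z‖ : ℂ) ^ 2 / 2)
      * (starRingEnd ℂ) (Complex.exp (-((n : ℂ) / 2) - Real.sqrt n * w - (‖w‖ : ℂ) ^ 2 / 2))) := by
        ring
    _ = _ := by
        rw [e2, e3]
        push_cast
        simp only [mul_inv]
        ring


/-! ### The limiting kernel -/

section Limit

variable {ι : Type*} {l : Filter ι} {N : ι → ℕ} {ζ ω : ι → ℂ} {z₀ w₀ : ℂ}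

lemma tendsto_sqrt_natCast : Tendsto (fun n : ℕ => Real.sqrt n) atTop atTop :=
  Real.tendsto_sqrt_atTop.comp tendsto_natCast_atTop_atTop

lemma eventually_norm_zoom_lt (hN : Tendsto N l atTop) (hζ : Tendsto ζ l (𝓝 z₀))
    (hz₀ : z₀ ∈ leftHalfPlane) : ∀ᶠ i in l, ‖zoom (N i) (ζ i)‖ < 1 := by
  have hx : Tendsto (fun i => Real.sqrt (N i)) l atTop := tendsto_sqrt_natCast.comp hN
  have h1 : Tendsto (fun i => 2 * (ζ i).re + ‖ζ i‖ ^ 2 / Real.sqrt (N i)) l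
      (𝓝 (2 * z₀.re + 0)) :=
    (((Complex.continuous_re.tendsto _).comp hζ).const_mul 2).add
      ((hζ.norm.pow 2).div_atTop hx)
  have h2 : 2 * z₀.re + 0 < 0 := by
    have : z₀.re < 0 := hz₀
    linarith
  filter_upwards [h1.eventually_lt_const h2, hN.eventually_ne_atTop 0, hx.eventually_gt_atTop 0]
    with i hi h0 hpos
  have h3 : ‖zoom (N i) (ζ i)‖ ^ 2
      = 1 + (2 * (ζ i).re + ‖ζ i‖ ^ 2 / Real.sqrt (N i)) / Real.sqrt (N i) := by
    rw [normSq_zoom h0, add_div, div_div, Real.mul_self_sqrt (Nat.cast_nonneg _), add_assoc]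
  have h4 : ‖zoom (N i) (ζ i)‖ ^ 2 < 1 := by
    rw [h3]
    linarith [div_neg_of_neg_of_pos hi hpos]
  exact (sq_lt_one_iff₀ (norm_nonneg _)).1 h4

lemma eventually_mem_leftHalfPlane (hζ : Tendsto ζ l (𝓝 z₀)) (hz₀ : z₀ ∈ leftHalfPlane) :
    ∀ᶠ i in l, ζ i ∈ leftHalfPlane :=
  ((Complex.continuous_re.tendsto _).comp hζ).eventually_lt_const hz₀

lemma eventually_floor_lt (hN : Tendsto N l atTop) (τ : ℝ) :
    ∀ᶠ i in l, ⌊τ * Real.sqrt (N i)⌋₊ < N i := by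
  have hx : Tendsto (fun i => Real.sqrt (N i)) l atTop := tendsto_sqrt_natCast.comp hN
  filter_upwards [hx.eventually_gt_atTop 0, hx.eventually_gt_atTop τ] with i h0 hτ
  have hn : N i ≠ 0 := by
    intro h
    simp [h] at h0
  rw [Nat.floor_lt' hn]
  calc τ * Real.sqrt (N i) < Real.sqrt (N i) * Real.sqrt (N i) := by gcongr
    _ = N i := Real.mul_self_sqrt (Nat.cast_nonneg _)

lemma tendsto_degree {τ : ℝ} (hτ : 0 ≤ τ) :
    Tendsto (fun n : ℕ => (((n - (⌊τ * Real.sqrt n⌋₊ + 1) : ℕ) : ℝ) - n) / Real.sqrt n) atTop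
      (𝓝 (-τ)) := by
  have hx := tendsto_sqrt_natCast
  have h1 : Tendsto (fun n : ℕ => -((⌊τ * Real.sqrt n⌋₊ : ℝ) / Real.sqrt n) - 1 / Real.sqrt n)
      atTop (𝓝 (-τ - 0)) :=
    ((tendsto_nat_floor_mul_div_atTop hτ).comp hx).neg.sub (tendsto_const_nhds.div_atTop hx)
  rw [sub_zero] at h1
  refine h1.congr' ?_
  filter_upwards [eventually_floor_lt tendsto_id τ] with n hn
  rw [Nat.cast_sub (by simpa using hn)]
  push_cast
  ring

/-- The limit of the terms of the rescaled kernel. -/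
noncomputable def limitTerm (z w : ℂ) (τ : ℝ) : ℂ :=
  Complex.exp (-((‖z‖ : ℂ) ^ 2 / 2) - (‖w‖ : ℂ) ^ 2 / 2)
    * Complex.exp (z * (starRingEnd ℂ) w - (z + (starRingEnd ℂ) w) ^ 2 / 2
        + ((-τ : ℝ) : ℂ) * (z + (starRingEnd ℂ) w))
    * ((edgeNorm (-τ) : ℝ) : ℂ)⁻¹

lemma tendsto_kernelTerm (hN : Tendsto N l atTop) (hζ : Tendsto ζ l (𝓝 z₀))
    (hω : Tendsto ω l (𝓝 w₀)) (hz₀ : z₀ ∈ leftHalfPlane) (hw₀ : w₀ ∈ leftHalfPlane)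
    {τ : ℝ} (hτ : 0 ≤ τ) :
    Tendsto (fun i => kernelTerm (N i) (ζ i) (ω i) ⌊τ * Real.sqrt (N i)⌋₊) l
      (𝓝 (limitTerm z₀ w₀ τ)) := by
  have hconj : Tendsto (fun i => (starRingEnd ℂ) (ω i)) l (𝓝 ((starRingEnd ℂ) w₀)) :=
    (Complex.continuous_conj.tendsto _).comp hω
  have hnorm : ∀ {f : ι → ℂ} {a : ℂ}, Tendsto f l (𝓝 a) →
      Tendsto (fun i => (‖f i‖ : ℂ) ^ 2 / 2) l (𝓝 ((‖a‖ : ℂ) ^ 2 / 2)) := fun h =>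
    (((Complex.continuous_ofReal.tendsto _).comp h.norm).pow 2).div_const 2
  have h1 : Tendsto (fun i => Complex.exp (-((‖ζ i‖ : ℂ) ^ 2 / 2) - (‖ω i‖ : ℂ) ^ 2 / 2)) l
      (𝓝 (Complex.exp (-((‖z₀‖ : ℂ) ^ 2 / 2) - (‖w₀‖ : ℂ) ^ 2 / 2))) :=
    (Complex.continuous_exp.tendsto _).comp ((hnorm hζ).neg.sub (hnorm hω))
  have h2 := tendsto_one_add_pow_mul_exp (j := fun i => N i - (⌊τ * Real.sqrt (N i)⌋₊ + 1)) hN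
    (hζ.add hconj) (hζ.mul hconj) ((tendsto_degree hτ).comp hN)
  have h3 := ((Complex.continuous_ofReal.tendsto _).comp
    ((tendsto_sqrt_mul_monomialNorm (tendsto_degree hτ)).comp hN)).inv₀
      (Complex.ofReal_ne_zero.2 (edgeNorm_pos (neg_nonpos.2 hτ)).ne')
  refine ((h1.mul h2).mul h3).congr' ?_
  filter_upwards [hN.eventually_ne_atTop 0, eventually_floor_lt hN τ,
    eventually_mem_leftHalfPlane hζ hz₀, eventually_mem_leftHalfPlane hω hw₀,
    eventually_norm_zoom_lt hN hζ hz₀, eventually_norm_zoom_lt hN hω hw₀]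
    with i e1 e2 e3 e4 e5 e6
  rw [kernelTerm_eq e1 e2 e3 e4 e5.le e6.le]
  rfl

lemma measurable_kernelTerm_floor (n : ℕ) (z w : ℂ) :
    Measurable fun τ : ℝ => kernelTerm n z w ⌊τ * Real.sqrt n⌋₊ :=
  (measurable_of_countable (kernelTerm n z w)).comp
    (Nat.measurable_floor.comp (measurable_id.mul_const _))

lemma integrable_kernelBound (R : ℝ) :
    Integrable (fun τ : ℝ => Real.exp (R ^ 2 / 4 + 4 * R + 8 - τ ^ 2 / 128)) := by
  have h := (integrable_exp_sub_sq (c := 1 / 128) (by norm_num) 0).const_mul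
    (Real.exp (R ^ 2 / 4 + 4 * R + 8))
  refine h.congr (Eventually.of_forall fun τ => ?_)
  simp only
  rw [← Real.exp_add]
  congr 1
  ring

/-- Dominated convergence along the filter; R exceeds both limiting norms by 1, so moving arguments
eventually obey one common bound. -/
lemma tendsto_rescaledKernel_integral [l.IsCountablyGenerated] (hN : Tendsto N l atTop)
    (hζ : Tendsto ζ l (𝓝 z₀)) (hω : Tendsto ω l (𝓝 w₀)) (hz₀ : z₀ ∈ leftHalfPlane)
    (hw₀ : w₀ ∈ leftHalfPlane) :
    Tendsto (fun i => rescaledKernel (N i) (ζ i) (ω i)) l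
      (𝓝 (∫ τ in Set.Ici (0 : ℝ), limitTerm z₀ w₀ τ)) := by
  set R := max ‖z₀‖ ‖w₀‖ + 1 with hR
  have hR0 : 0 ≤ R := by positivity
  have hx : Tendsto (fun i => Real.sqrt (N i)) l atTop := tendsto_sqrt_natCast.comp hN
  have hmain : Tendsto
      (fun i => ∫ τ in Set.Ici (0 : ℝ), kernelTerm (N i) (ζ i) (ω i) ⌊τ * Real.sqrt (N i)⌋₊) l
      (𝓝 (∫ τ in Set.Ici (0 : ℝ), limitTerm z₀ w₀ τ)) := by
    refine tendsto_integral_filter_of_dominated_convergence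
      (fun τ => Real.exp (R ^ 2 / 4 + 4 * R + 8 - τ ^ 2 / 128))
      (Eventually.of_forall fun i => (measurable_kernelTerm_floor _ _ _).aestronglyMeasurable)
      ?_ (integrable_kernelBound R).integrableOn ?_
    · filter_upwards [hx.eventually_ge_atTop 5, hx.eventually_ge_atTop (4 * R),
        hζ.norm.eventually_lt_const (show ‖z₀‖ < R by linarith [le_max_left ‖z₀‖ ‖w₀‖]),
        hω.norm.eventually_lt_const (show ‖w₀‖ < R by linarith [le_max_right ‖z₀‖ ‖w₀‖])]
        with i e1 e2 e3 e4
      filter_upwards [ae_restrict_mem measurableSet_Ici] with τ hτ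
      exact norm_kernelTerm_le hR0 e1 e2 e3.le e4.le hτ
    · filter_upwards [ae_restrict_mem measurableSet_Ici] with τ hτ
      exact tendsto_kernelTerm hN hζ hω hz₀ hw₀ hτ
  refine hmain.congr' ?_
  filter_upwards [hN.eventually_ne_atTop 0] with i hi
  rw [rescaledKernel_eq_integral hi]

lemma hardKernel_of_mem {z w : ℂ} (hz : z ∈ leftHalfPlane) (hw : w ∈ leftHalfPlane) :
    hardKernel z w = ginibreKernel z w * hardPlasma (z + (starRingEnd ℂ) w) := by
  rw [hardKernel, Set.indicator_of_mem hz, Set.indicator_of_mem hw, mul_one, mul_one]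

lemma hardKernel_of_notMem {z w : ℂ} (h : ¬(z ∈ leftHalfPlane ∧ w ∈ leftHalfPlane)) :
    hardKernel z w = 0 := by
  rw [hardKernel]
  by_cases hz : z ∈ leftHalfPlane
  · rw [Set.indicator_of_notMem (s := leftHalfPlane) (fun hw => h ⟨hz, hw⟩), mul_zero]
  · rw [Set.indicator_of_notMem hz, mul_zero, zero_mul]

/-- The factor e^(-τ²/2) hidden in 1/`edgeNorm` completes the square in the exponent to -(z + conj w
+ τ)²/2, which leaves 1/F(-τ). -/
lemma limitTerm_eq (z w : ℂ) (τ : ℝ) :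
    limitTerm z w τ = ginibreKernel z w * (gaussian (z + (starRingEnd ℂ) w - ((-τ : ℝ) : ℂ))
      * (1 / freePlasma ((-τ : ℝ) : ℂ))) := by
  rw [limitTerm, edgeNorm_eq, freePlasma_ofReal, ginibreKernel, gaussian]
  set A := z + (starRingEnd ℂ) w with hA
  have h1 : Complex.exp (-(A - ((-τ : ℝ) : ℂ)) ^ 2 / 2)
      = Complex.exp (-A ^ 2 / 2 + ((-τ : ℝ) : ℂ) * A)
        * (Complex.exp ((((-τ) ^ 2 / 2 : ℝ) : ℂ)))⁻¹ := by
    rw [← Complex.exp_neg, ← Complex.exp_add]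
    congr 1
    push_cast
    ring
  have h2 : Complex.exp (-((‖z‖ : ℂ) ^ 2 / 2) - (‖w‖ : ℂ) ^ 2 / 2)
      * Complex.exp (z * (starRingEnd ℂ) w - A ^ 2 / 2 + ((-τ : ℝ) : ℂ) * A)
      = Complex.exp (z * (starRingEnd ℂ) w - (‖z‖ : ℂ) ^ 2 / 2 - (‖w‖ : ℂ) ^ 2 / 2)
        * Complex.exp (-A ^ 2 / 2 + ((-τ : ℝ) : ℂ) * A) := by
    rw [← Complex.exp_add, ← Complex.exp_add]
    congr 1
    ring
  rw [h1, h2, Complex.ofReal_mul, Complex.ofReal_mul, Complex.ofReal_exp, mul_inv, mul_inv]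
  ring

lemma integral_limitTerm {z w : ℂ} (hz : z ∈ leftHalfPlane) (hw : w ∈ leftHalfPlane) :
    ∫ τ in Set.Ici (0 : ℝ), limitTerm z w τ = hardKernel z w := by
  simp only [limitTerm_eq]
  rw [integral_Ici_eq_integral_Ioi, integral_const_mul, hardKernel_of_mem hz hw]
  congr 1
  rw [hardPlasma, gaussianConv, integral_comp_neg_Ioi (0 : ℝ) fun t : ℝ =>
    gaussian (z + (starRingEnd ℂ) w - (t : ℂ)) * (1 / freePlasma (t : ℂ)), neg_zero,
    integral_Iic_eq_integral_Iio, ← integral_indicator measurableSet_Iio]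
  congr 1
  ext t
  by_cases ht : t ∈ Set.Iio (0 : ℝ)
  · rw [Set.indicator_of_mem ht, Set.indicator_of_mem ht]
  · rw [Set.indicator_of_notMem ht, Set.indicator_of_notMem ht, mul_zero]

/-- Locally uniform convergence of the rescaled kernels on the left half plane. -/
theorem tendsto_rescaledKernel_of_mem [l.IsCountablyGenerated] (hN : Tendsto N l atTop)
    (hζ : Tendsto ζ l (𝓝 z₀)) (hω : Tendsto ω l (𝓝 w₀)) (hz₀ : z₀ ∈ leftHalfPlane)
    (hw₀ : w₀ ∈ leftHalfPlane) :
    Tendsto (fun i => rescaledKernel (N i) (ζ i) (ω i)) l (𝓝 (hardKernel z₀ w₀)) :=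
  integral_limitTerm hz₀ hw₀ ▸ tendsto_rescaledKernel_integral hN hζ hω hz₀ hw₀

end Limit

lemma rescaledPoly_of_notMem {n : ℕ} (j : Fin n) {z : ℂ} (hz : z ∉ leftHalfPlane) :
    rescaledPoly n j z = 0 := by
  rw [rescaledPoly, phase_of_notMem hz]
  simp

lemma rescaledKernel_of_notMem {n : ℕ} {z w : ℂ}
    (h : ¬(z ∈ leftHalfPlane ∧ w ∈ leftHalfPlane)) : rescaledKernel n z w = 0 := by
  rw [rescaledKernel, finKernel]
  refine Finset.sum_eq_zero fun j _ => ?_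
  by_cases hz : z ∈ leftHalfPlane
  · rw [rescaledPoly_of_notMem j (fun hw => h ⟨hz, hw⟩ : w ∉ leftHalfPlane), map_zero, mul_zero]
  · rw [rescaledPoly_of_notMem j hz, zero_mul]

theorem tendsto_rescaledKernel (z w : ℂ) :
    Tendsto (fun n => rescaledKernel n z w) atTop (𝓝 (hardKernel z w)) := by
  by_cases h : z ∈ leftHalfPlane ∧ w ∈ leftHalfPlane
  · exact tendsto_rescaledKernel_of_mem tendsto_id tendsto_const_nhds tendsto_const_nhds h.1 h.2
  · simp only [rescaledKernel_of_notMem h, hardKernel_of_notMem h]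
    exact tendsto_const_nhds

/-- The rescaled kernels are uniformly bounded on bounded parts of the diagonal. -/
theorem exists_norm_rescaledKernel_le (R : ℝ) :
    ∃ M : ℝ, ∀ n : ℕ, n ≠ 0 → ∀ z : ℂ, ‖z‖ ≤ R → ‖rescaledKernel n z z‖ ≤ M := by
  rcases lt_or_ge R 0 with hR | hR
  · exact ⟨0, fun n _ z hz => absurd ((norm_nonneg z).trans hz) (not_le.2 hR)⟩
  -- The Gaussian bound requires √n ≥ 5 and √n ≥ 4R; the finitely many smaller n are covered by the
  -- crude bounds D n.
  obtain ⟨n₀, hn₀⟩ := eventually_atTop.1 ((tendsto_sqrt_natCast.eventually_ge_atTop 5).and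
    (tendsto_sqrt_natCast.eventually_ge_atTop (4 * R)))
  set M₁ := ∫ τ in Set.Ici (0 : ℝ), Real.exp (R ^ 2 / 4 + 4 * R + 8 - τ ^ 2 / 128)
  set D : ℕ → ℝ := fun n => ∑ j : Fin n, (monomialNorm n j)⁻¹
  have hD : ∀ n, 0 ≤ D n := fun n =>
    Finset.sum_nonneg fun j _ => (inv_pos.2 (monomialNorm_pos n j)).le
  have hM₁ : 0 ≤ M₁ := integral_nonneg fun _ => (Real.exp_pos _).le
  refine ⟨M₁ + ∑ n ∈ Finset.range n₀, D n, fun n hn z hz => ?_⟩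
  rcases lt_or_ge n n₀ with h | h
  · have h1 := (isBoundedKernel_rescaledKernel hn).norm_le z
    have h2 : D n ≤ ∑ n ∈ Finset.range n₀, D n :=
      Finset.single_le_sum (fun i _ => hD i) (Finset.mem_range.2 h)
    exact h1.trans (h2.trans (by linarith))
  · have h3 : ‖rescaledKernel n z z‖ ≤ M₁ := by
      rw [rescaledKernel_eq_integral hn]
      refine norm_integral_le_of_norm_le (integrable_kernelBound R).integrableOn ?_
      filter_upwards [ae_restrict_mem measurableSet_Ici] with τ hτ
      exact norm_kernelTerm_le hR (hn₀ n h).1 (hn₀ n h).2 hz hz hτ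
    have := Finset.sum_nonneg fun i (_ : i ∈ Finset.range n₀) => hD i
    linarith


/-! ### The hard edge kernel -/

/-- Continuity comes for free from joint convergence: for points near (z₀, w₀) the approximants
eventually lie in a given closed neighbourhood, so their limits do. No regularity of H is needed. -/
lemma tendsto_uncurry_hardKernel {z₀ w₀ : ℂ} (hz₀ : z₀ ∈ leftHalfPlane)
    (hw₀ : w₀ ∈ leftHalfPlane) :
    Tendsto (Function.uncurry hardKernel) (𝓝 (z₀, w₀)) (𝓝 (hardKernel z₀ w₀)) := by
  have hl : Tendsto (fun p : (ℂ × ℂ) × ℕ => p.1) (𝓝 (z₀, w₀) ×ˢ atTop) (𝓝 (z₀, w₀)) := tendsto_fst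
  have h1 : Tendsto (fun p : (ℂ × ℂ) × ℕ => rescaledKernel p.2 p.1.1 p.1.2)
      (𝓝 (z₀, w₀) ×ˢ atTop) (𝓝 (hardKernel z₀ w₀)) :=
    tendsto_rescaledKernel_of_mem tendsto_snd hl.fst_nhds hl.snd_nhds hz₀ hw₀
  rw [(closed_nhds_basis (hardKernel z₀ w₀)).tendsto_right_iff]
  intro S hS
  have h2 : ∀ᶠ p : ℂ × ℂ in 𝓝 (z₀, w₀), ∀ᶠ n : ℕ in atTop, rescaledKernel n p.1 p.2 ∈ S :=
    (h1.eventually hS.1).curry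
  filter_upwards [h2] with p hp
  exact hS.2.mem_of_tendsto (tendsto_rescaledKernel p.1 p.2) hp

lemma tendsto_hardKernel {ι : Type*} {l : Filter ι} {ζ ω : ι → ℂ} {z₀ w₀ : ℂ}
    (hζ : Tendsto ζ l (𝓝 z₀)) (hω : Tendsto ω l (𝓝 w₀)) (hz₀ : z₀ ∈ leftHalfPlane)
    (hw₀ : w₀ ∈ leftHalfPlane) :
    Tendsto (fun i => hardKernel (ζ i) (ω i)) l (𝓝 (hardKernel z₀ w₀)) := by
  have h : Tendsto (Function.uncurry hardKernel ∘ fun i => (ζ i, ω i)) l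
      (𝓝 (hardKernel z₀ w₀)) :=
    Tendsto.comp (tendsto_uncurry_hardKernel hz₀ hw₀) (hζ.prodMk_nhds hω)
  simpa only [Function.comp_def, Function.uncurry_apply_pair] using h

lemma isPosKernel_of_tendsto {K : ℕ → ℂ → ℂ → ℂ} {L : ℂ → ℂ → ℂ} (hK : ∀ n, IsPosKernel (K n))
    (hlim : ∀ z w, Tendsto (fun n => K n z w) atTop (𝓝 (L z w))) : IsPosKernel L := by
  intro ι _ z
  refine ⟨Matrix.IsHermitian.ext fun i j => ?_, fun x => ?_⟩
  · have h1 : Tendsto (fun n => star (K n (z j) (z i))) atTop (𝓝 (star (L (z j) (z i)))) :=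
      (continuous_star.tendsto _).comp (hlim _ _)
    refine tendsto_nhds_unique h1 ((hlim (z i) (z j)).congr fun n => ?_)
    exact ((hK n ι z).1.apply i j).symm
  · have h2 : Tendsto (fun n => x.sum fun i xi => x.sum fun j xj =>
        star xi * kernelMatrix (K n) z i j * xj) atTop
        (𝓝 (x.sum fun i xi => x.sum fun j xj => star xi * kernelMatrix L z i j * xj)) :=
      tendsto_finsetSum _ fun i _ => tendsto_finsetSum _ fun j _ =>
        ((hlim (z i) (z j)).const_mul _).mul_const _
    exact ge_of_tendsto' h2 fun n => (hK n ι z).2 x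

lemma isBoundedKernel_hardKernel : IsBoundedKernel hardKernel 2 where
  pos := isPosKernel_of_tendsto (fun n => (isBoundedKernel_rescaledKernel n.succ_ne_zero).pos)
    fun z w => (tendsto_rescaledKernel z w).comp (tendsto_add_atTop_nat 1)
  measurable := measurable_of_tendsto_metrizable measurable_rescaledKernel
    (tendsto_pi_nhds.2 fun p => tendsto_rescaledKernel p.1 p.2)
  nonneg := by norm_num
  norm_le := norm_hardKernel_diag_le

/-- The rescaled kernels are projections of finite rank, hence have nonnegative Janossy densities,
and these converge. -/
lemma janossy_hardKernel_nonneg (r m : ℕ) (z : Fin m → ℂ) :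
    0 ≤ janossy hardKernel (lam.restrict (disc r)) z := by
  obtain ⟨s, hs⟩ : ∃ s : ℝ, ∀ i, ‖z i‖ ≤ s := by
    obtain ⟨s, hs⟩ := (Set.finite_range fun i => ‖z i‖).bddAbove
    exact ⟨s, fun i => hs ⟨i, rfl⟩⟩
  -- The radius covers both the disc of integration and the given points z, which may lie outside
  -- it.
  obtain ⟨M, hM⟩ := exists_norm_rescaledKernel_le (max s (r + 1))
  have h1 := tendsto_janossy (K := fun n => rescaledKernel (n + 1)) (L := hardKernel)
    (ν := lam.restrict (disc r)) (B := Metric.closedBall 0 (max s (r + 1))) (C := M)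
    (fun n => (isBoundedKernel_rescaledKernel n.succ_ne_zero).pos)
    (fun n => measurable_rescaledKernel (n + 1))
    (fun z w => (tendsto_rescaledKernel z w).comp (tendsto_add_atTop_nat 1))
    (fun n x hx => hM _ n.succ_ne_zero x (by simpa using hx)) ?_ z
    (fun i => by
      rw [mem_closedBall_zero_iff]
      exact (hs i).trans (le_max_left _ _))
  · refine ge_of_tendsto' h1 fun n => ?_
    exact (isOrthonormalFamily_rescaledPoly n.succ_ne_zero).janossy_nonneg
      (isBoundedKernel_rescaledKernel n.succ_ne_zero) (measurableSet_disc r) z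
  · filter_upwards [ae_restrict_mem (measurableSet_disc r)] with x hx
    exact Metric.ball_subset_closedBall (Metric.ball_subset_ball (le_max_right _ _) hx)

theorem existsUnique_isCorrelationKernel :
    ∃! P : ProbabilityMeasure Configuration, IsCorrelationKernel P hardKernel := by
  have hK := isBoundedKernel_hardKernel
  obtain ⟨P, hP⟩ := exists_isIntensityFunction hK janossy_hardKernel_nonneg
  refine ⟨P, fun k _ => ⟨fun z => pdet hardKernel z, hK.pos.ofReal_pdet, hP k⟩, fun P' hP' => ?_⟩
  refine ext_of_isIntensityFunction (ρ := fun k z => pdet hardKernel z) (fun k hk => ?_)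
    (fun k _ => hP k) fun r => ⟨2, fun k z _ => ?_⟩
  · obtain ⟨ρ, hρ, hρP⟩ := hP' k hk
    have : ρ = fun z => pdet hardKernel z := by
      ext z
      exact Complex.ofReal_injective ((hρ z).trans (hK.pos.ofReal_pdet z).symm)
    exact this ▸ hρP
  · simpa using (Real.le_norm_self _).trans (hK.norm_pdet_le z)

/-! ### Convergence of the intensities -/

lemma ae_forall_norm_zoom_ne_one (k : ℕ) :
    ∀ᵐ z : Fin k → ℂ, ∀ n : ℕ, n ≠ 0 → ∀ i, ‖zoom n (z i)‖ ≠ 1 := by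
  refine ae_all_iff.2 fun n => ?_
  rw [eventually_imp_distrib_left]
  exact fun hn => ae_all_iff.2 fun i =>
    (Measure.quasiMeasurePreserving_eval (fun _ : Fin k => (volume : Measure ℂ)) i).ae
      (ae_norm_zoom_ne_one hn)

lemma ofReal_rescaledIntensity {n : ℕ} (hn : n ≠ 0) {k : ℕ} {z : Fin k → ℂ}
    (h : ∀ i, ‖zoom n (z i)‖ ≠ 1) :
    (rescaledIntensity n k z : ℂ) = kernelDet (rescaledKernel n) k z := by
  rw [rescaledIntensity_eq_pdet hn h]
  exact (isBoundedKernel_rescaledKernel hn).pos.ofReal_pdet z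

lemma tendsto_kernelDet {ι : Type*} {l : Filter ι} {K : ι → ℂ → ℂ → ℂ} {L : ℂ → ℂ → ℂ} {k : ℕ}
    {z : ι → Fin k → ℂ} {z₀ : Fin k → ℂ}
    (h : ∀ i j, Tendsto (fun a => K a (z a i) (z a j)) l (𝓝 (L (z₀ i) (z₀ j)))) :
    Tendsto (fun a => kernelDet (K a) k (z a)) l (𝓝 (kernelDet L k z₀)) := by
  have h1 : Tendsto (fun a => kernelMatrix (K a) (z a)) l (𝓝 (kernelMatrix L z₀)) := by
    refine tendsto_pi_nhds.2 fun i => tendsto_pi_nhds.2 fun j => h i j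
  have h2 : Continuous fun M : Matrix (Fin k) (Fin k) ℂ => M.det :=
    Continuous.matrix_det continuous_id
  exact (h2.tendsto _).comp h1

theorem ae_rescaledIntensity_le {k : ℕ} {C : Set (Fin k → ℂ)} (hC : IsCompact C) :
    ∃ M : ℝ, ∀ᵐ z : Fin k → ℂ, z ∈ C → ∀ n : ℕ, 1 ≤ n → |rescaledIntensity n k z| ≤ M := by
  obtain ⟨R, hR⟩ := hC.isBounded.exists_norm_le
  obtain ⟨M, hM⟩ := exists_norm_rescaledKernel_le R
  refine ⟨M ^ k, ?_⟩
  filter_upwards [ae_forall_norm_zoom_ne_one k] with z hz hzC n hn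
  have hn0 : n ≠ 0 := by omega
  have hpos := (isBoundedKernel_rescaledKernel hn0).pos
  rw [rescaledIntensity_eq_pdet hn0 (hz n hn0), abs_of_nonneg (hpos.pdet_nonneg z)]
  simpa using hpos.pdet_le_pow z fun i => hM n hn0 (z i) ((norm_le_pi_norm z i).trans (hR z hzC))

theorem ae_tendsto_rescaledIntensity (k : ℕ) :
    ∀ᵐ z : Fin k → ℂ, Tendsto (fun n : ℕ => (rescaledIntensity n k z : ℂ)) atTop
      (𝓝 (kernelDet hardKernel k z)) := by
  filter_upwards [ae_forall_norm_zoom_ne_one k] with z hz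
  have h1 : Tendsto (fun n => kernelDet (rescaledKernel n) k z) atTop
      (𝓝 (kernelDet hardKernel k z)) :=
    tendsto_kernelDet fun i j => tendsto_rescaledKernel (z i) (z j)
  refine h1.congr' ?_
  filter_upwards [eventually_ne_atTop 0] with n hn
  rw [ofReal_rescaledIntensity hn (hz n hn)]

theorem tendstoLocallyUniformlyOn_rescaledIntensity (k : ℕ) :
    TendstoLocallyUniformlyOn (fun (n : ℕ) (z : Fin k → ℂ) => (rescaledIntensity n k z : ℂ))
      (kernelDet hardKernel k) atTop {z | ∀ i, z i ∈ leftHalfPlane} := by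
  rw [tendstoLocallyUniformlyOn_iff_forall_tendsto]
  intro x hx
  set l := (atTop : Filter ℕ) ×ˢ 𝓝[{z : Fin k → ℂ | ∀ i, z i ∈ leftHalfPlane}] x with hl
  have hN : Tendsto (fun p : ℕ × (Fin k → ℂ) => p.1) l atTop := tendsto_fst
  have hζ : ∀ i, Tendsto (fun p : ℕ × (Fin k → ℂ) => p.2 i) l (𝓝 (x i)) := fun i =>
    (((continuous_apply i).tendsto x).mono_left nhdsWithin_le_nhds).comp tendsto_snd
  have h1 : Tendsto (fun p : ℕ × (Fin k → ℂ) => kernelDet hardKernel k p.2) l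
      (𝓝 (kernelDet hardKernel k x)) :=
    tendsto_kernelDet (K := fun _ => hardKernel) fun i j =>
      tendsto_hardKernel (hζ i) (hζ j) (hx i) (hx j)
  have h2 : Tendsto (fun p : ℕ × (Fin k → ℂ) => kernelDet (rescaledKernel p.1) k p.2) l
      (𝓝 (kernelDet hardKernel k x)) :=
    tendsto_kernelDet fun i j => tendsto_rescaledKernel_of_mem hN (hζ i) (hζ j) (hx i) (hx j)
  have h3 : Tendsto (fun p : ℕ × (Fin k → ℂ) => (rescaledIntensity p.1 k p.2 : ℂ)) l
      (𝓝 (kernelDet hardKernel k x)) := by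
    refine h2.congr' ?_
    -- Near a point of the open half plane the zoomed points are eventually strictly inside the unit
    -- disc, so here no null set is excluded.
    filter_upwards [hN.eventually_ne_atTop 0,
      eventually_all.2 fun i => eventually_norm_zoom_lt hN (hζ i) (hx i)] with p h0 hp
    rw [ofReal_rescaledIntensity h0 fun i => (hp i).ne]
  -- Kernel and intensity tend to the same value as the point moves, so they become uniformly close.
  exact (h1.prodMk_nhds h3).mono_right (nhds_le_uniformity _)

end HardEdgeGinibre

/-- Existence and uniqueness of the hard edge boundary Ginibre point field, and convergence of all
intensity functions of the rescaled hard edge Ginibre processes to its intensity functions: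
with local uniform bounds, almost everywhere, and locally uniformly on powers of the left
half plane. -/
theorem theorem2p2 :
    (∃! P : ProbabilityMeasure Configuration, IsCorrelationKernel P hardKernel) ∧
    ∀ k : ℕ, 1 ≤ k →
      (∀ C : Set (Fin k → ℂ), IsCompact C → ∃ M : ℝ,
        ∀ᵐ z ∂(volume : Measure (Fin k → ℂ)), z ∈ C →
          ∀ n : ℕ, 1 ≤ n → |rescaledIntensity n k z| ≤ M) ∧
      (∀ᵐ z ∂(volume : Measure (Fin k → ℂ)),
        Tendsto (fun n : ℕ => (rescaledIntensity n k z : ℂ)) atTop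
          (𝓝 (kernelDet hardKernel k z))) ∧
      TendstoLocallyUniformlyOn (fun (n : ℕ) (z : Fin k → ℂ) => (rescaledIntensity n k z : ℂ))
        (kernelDet hardKernel k) atTop {z | ∀ i, z i ∈ leftHalfPlane} :=
  ⟨existsUnique_isCorrelationKernel, fun k _ => ⟨fun _ hC => ae_rescaledIntensity_le hC,
    ae_tendsto_rescaledIntensity k, tendstoLocallyUniformlyOn_rescaledIntensity k⟩⟩
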